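/- For every $n\ge 1$ let $w^{(n)}=(w^{(n)}_1,\dots,w^{(n)}_n)$ be a vector of non-negative reals with positive sum, and put $\rho_n=1/\sum_{i=1}^n w^{(n)}_i$, $\hat w_n=\max_i w^{(n)}_i$, $\check w_n=\min_i w^{(n)}_i$, $\tilde d_n=\rho_n\sum_{i=1}^n (w^{(n)}_i)^2$. Assume: (A1) $\rho_n\hat w_n^2<1$ for all $n$, and $\rho_n\hat w_n^2\to 0$; (A2) for every $k\ge 1$ the limit $\Lambda_k=\lim_{n\to\infty}\frac1n\sum_{i=1}^n (n\rho_n w^{(n)}_i)^k$ exists and is finite; (A3) as $n\to\infty$: (i) $\check w_n>0$ for all large $n$ and $\hat w_n/\check w_n=O(\log n)$; (ii) $1/n=o(\rho_n\hat w_n^2)$; (iii) $n\rho_n=o(1)$; (iv) $n\rho_n\hat w_n=O(1)$; (v) $\hat w_n=O(\log n)$; (vi) $\tilde d_n=o(n/\log n)$. On a probability space, for every $n$ let $a^{(n)}_{ij}=a^{(n)}_{ji}$, $1\le i\le j\le n$, be independent $\{0,1\}$-valued random variables with $\mathbb E\,a^{(n)}_{ij}=\rho_n w^{(n)}_i w^{(n)}_j$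 (the Chung–Lu random graph with self-loops allowed; the joint law for different $n$ is arbitrary, so that independence across $n$ is included). Let $A_n=\sqrt{n\rho_n}\,[a^{(n)}_{ij}]_{i,j=1}^n$, with eigenvalues $\lambda_1(A_n)\le\dots\le\lambda_n(A_n)$ counted with multiplicity, and let $F_n(x)=\frac1n\,\mathrm{card}\{i:\lambda_i(A_n)\le x\}$ be its empirical spectral distribution. Then there is a deterministic probability distribution $F$ on $\mathbb R$ such that, with probability one, $F_n$ converges weakly to $F$, that is, $F_n(x)\to F(x)$ at every continuity point $x$ of $F$. All moments $m_k=\int x^k\,dF(x)$, $k\ge 0$, are finite, and $F$ is the only probability distribution on $\mathbb R$ with these moments. The moments are given by $m_0=1$, $$m_{2s}=\sum_{r\in\mathcal R_s}\frac{2}{s+1}\binom{s+1}{r_1,\dots,r_s}\Lambda_1^{r_1}\Lambda_2^{r_2}\cdots\Lambda_s^{r_s}\quad(s\ge 1),\qquad m_{2s+1}=0\quad(s\ge 0),$$ where $\mathcal R_s=\{r\in\mathbb Z_{\ge 0}^s:\ \sum_{j=1}^s r_j=s+1,\ \sum_{j=1}^s j\,r_j=2s\}$. -/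

import Mathlib

open MeasureTheory ProbabilityTheory Filter Topology Asymptotics

namespace ChungLu

/-- `ρ_n = 1 / ∑ i, w_i^(n)`, the inverse expected volume. -/
noncomputable def invVolume (w : ∀ n : ℕ, Fin n → ℝ) (n : ℕ) : ℝ :=
  1 / ∑ i, w n i

/-- The maximal expected degree. -/
noncomputable def maxDeg (w : ∀ n : ℕ, Fin n → ℝ) (n : ℕ) : ℝ :=
  ⨆ i, w n i

/-- The minimal expected degree. -/
noncomputable def minDeg (w : ∀ n : ℕ, Fin n → ℝ) (n : ℕ) : ℝ :=
  ⨅ i, w n i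

/-- The second-order average degree `(∑ i, w_i ^ 2) / ∑ i, w_i`. -/
noncomputable def secondOrderAvgDeg (w : ∀ n : ℕ, Fin n → ℝ) (n : ℕ) : ℝ :=
  (∑ i, w n i ^ 2) / ∑ i, w n i

/-- The normalized power sum `(1/n) ∑ i, (n ρ_n w_i) ^ k`. -/
noncomputable def normalizedPowerSum (w : ∀ n : ℕ, Fin n → ℝ) (k n : ℕ) : ℝ :=
  1 / (n : ℝ) * ∑ i, ((n : ℝ) * invVolume w n * w n i) ^ k

/-- Sparse and graphical expected degree sequences. -/
structure SparseGraphical (w : ∀ n : ℕ, Fin n → ℝ) : Prop where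
  lt_one : ∀ n, invVolume w n * maxDeg w n ^ 2 < 1
  tendsto_zero : Tendsto (fun n => invVolume w n * maxDeg w n ^ 2) atTop (𝓝 0)

/-- All limiting normalized power sums exist and are finite, with values `Λ 1, Λ 2, …`. -/
def HasPowerSumLimits (w : ∀ n : ℕ, Fin n → ℝ) (Λ : ℕ → ℝ) : Prop :=
  ∀ k, 1 ≤ k → Tendsto (normalizedPowerSum w k) atTop (𝓝 (Λ k))

/-- Controlled growth of the expected degrees. The field `minDeg_pos` says that the ratio in
`ratio` is meaningful for large `n`. -/
structure ControlledGrowth (w : ∀ n : ℕ, Fin n → ℝ) : Prop where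
  minDeg_pos : ∀ᶠ n in atTop, 0 < minDeg w n
  ratio : (fun n => maxDeg w n / minDeg w n) =O[atTop] (fun n : ℕ => Real.log n)
  maxProb : (fun n : ℕ => 1 / (n : ℝ)) =o[atTop] (fun n => invVolume w n * maxDeg w n ^ 2)
  invAvgDeg : (fun n : ℕ => (n : ℝ) * invVolume w n) =o[atTop] (fun _ => (1 : ℝ))
  maxNormalized :
    (fun n : ℕ => (n : ℝ) * invVolume w n * maxDeg w n) =O[atTop] (fun _ => (1 : ℝ))
  maxDeg_log : maxDeg w =O[atTop] (fun n : ℕ => Real.log n)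
  secondOrder : secondOrderAvgDeg w =o[atTop] (fun n : ℕ => (n : ℝ) / Real.log n)

/-- `a n e` is the indicator of the potential edge `e` (an unordered pair of nodes, possibly a
self-loop) of the `n`-th random graph. For every `n`, the indicators are independent 0-1 random
variables with `𝔼 a n {i, j} = ρ_n w_i w_j`. Nothing is asked about the joint law of the graphs
for different `n`. -/
structure IsChungLuGraph {Ω : Type*} [MeasurableSpace Ω] (P : Measure Ω)
    (w : ∀ n : ℕ, Fin n → ℝ) (a : ∀ n : ℕ, Sym2 (Fin n) → Ω → ℝ) : Prop where
  measurable : ∀ n e, Measurable (a n e)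
  zero_or_one : ∀ n e ω, a n e ω = 0 ∨ a n e ω = 1
  indep : ∀ n, iIndepFun (a n) P
  mean : ∀ n i j, ∫ ω, a n s(i, j) ω ∂P = invVolume w n * w n i * w n j

/-- The normalized adjacency matrix `A_n = √(n ρ_n) [a_ij]`. -/
noncomputable def adjMatrix {Ω : Type*} (w : ∀ n : ℕ, Fin n → ℝ)
    (a : ∀ n : ℕ, Sym2 (Fin n) → Ω → ℝ) (n : ℕ) (ω : Ω) : Matrix (Fin n) (Fin n) ℝ :=
  Matrix.of fun i j => Real.sqrt (n * invVolume w n) * a n s(i, j) ω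

theorem adjMatrix_isHermitian {Ω : Type*} (w : ∀ n : ℕ, Fin n → ℝ)
    (a : ∀ n : ℕ, Sym2 (Fin n) → Ω → ℝ) (n : ℕ) (ω : Ω) :
    (adjMatrix w a n ω).IsHermitian := by
  ext i j
  simp [adjMatrix, Sym2.eq_swap]

open scoped Classical in
/-- The empirical spectral distribution function
`F_n(x) = (1/n) #{i : λ_i(A) ≤ x}` of a real symmetric matrix, eigenvalues being counted with
multiplicity. -/
noncomputable def esd {n : ℕ} {A : Matrix (Fin n) (Fin n) ℝ} (hA : A.IsHermitian) (x : ℝ) : ℝ :=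
  1 / (n : ℝ) * ((Finset.univ.filter fun i => hA.eigenvalues i ≤ x).card : ℝ)

/-- Weak convergence of distribution functions: convergence at every continuity point of the
limit. -/
def WeaklyConverges (Fn : ℕ → ℝ → ℝ) (F : ℝ → ℝ) : Prop :=
  ∀ x, ContinuousAt F x → Tendsto (fun n => Fn n x) atTop (𝓝 (F x))

/-- `R_s = {r ∈ ℕ₀^s : ∑_{j=1}^s r_j = s + 1, ∑_{j=1}^s j r_j = 2 s}`; the index `j : Fin s`
stands for the degree `j + 1`. -/
def treeDegreeDistributions (s : ℕ) : Finset (Fin s → ℕ) :=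
  (Finset.piAntidiag Finset.univ (s + 1)).filter fun r => ∑ j : Fin s, ((j : ℕ) + 1) * r j = 2 * s

theorem mem_treeDegreeDistributions {s : ℕ} {r : Fin s → ℕ} :
    r ∈ treeDegreeDistributions s ↔
      ∑ j, r j = s + 1 ∧ ∑ j : Fin s, ((j : ℕ) + 1) * r j = 2 * s := by
  simp [treeDegreeDistributions]

/-- The value
`∑_{r ∈ R_s} 2/(s+1) * (s+1)!/(r_1! ⋯ r_s!) * Λ_1^{r_1} ⋯ Λ_s^{r_s}`. -/
noncomputable def evenMoment (Λ : ℕ → ℝ) (s : ℕ) : ℝ :=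
  ∑ r ∈ treeDegreeDistributions s,
    2 / ((s : ℝ) + 1) * (Nat.multinomial Finset.univ r : ℝ) * ∏ j : Fin s, Λ ((j : ℕ) + 1) ^ r j

end ChungLu

/-! Put `x_i = n ρ_n w_i`. The mean of `a_ij` is `ρ_n w_i w_j` on the diagonal as well, so centring
`A_n` subtracts a matrix of rank one, and by the rank inequality (`card_eigenvalues_le_add_rank`)
this moves `F_n` by at most `1/n`. The centred matrix has entries bounded by `√(n ρ_n) → 0` and
variances `x_i x_j / n + o(1/n)`, with bounded `x_i`.

Let `G` be its resolvent at `z = iη`, `η ≥ 1`, and `m_k = (1/n) ∑ x_i^k 𝔼 G_ii`. Expanding `𝔼 (b_ij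
G_ji)` in the single entry `b_ij` and using concentration of weighted traces gives `1 + z 𝔼 G_ii +
x_i (𝔼 G_ii) m_1 ≈ 0` (`norm_rankOne_resolvent_equation_le`). Multiplying by `x_i^k` and averaging
yields in the limit the hierarchy `z m_k + Λ_k + m_{k+1} m_1 = 0` with `Λ_0 = 1`.

The hierarchy is solved asymptotically as `η → ∞`. With `t = z⁻²` and `φ(y) = ∑ Λ_{k+1} y^k`, the
quantity `τ = -m_1 / z` satisfies `τ = t φ(τ)` to every order, while the Stieltjes transform `S =
m_0` satisfies `-z S = 1 + τ² / t`. Lagrange inversion gives `[t^{s+1}] τ² = 2/(s+1) [y^{s-1}]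
φ^{s+1}`, whose multinomial expansion is the stated `m_{2s}` (`stieltjes_expansion_of_recursion`).
The coefficients in such an expansion of a Stieltjes transform are the moments
(`moments_of_stieltjes_expansion`). Since `|Λ_k| ≤ C^k`, the even moments grow at most
geometrically, so they determine the law; with tightness, the mean spectral distributions converge
(`exists_tendsto_meanESD`).

Almost sure convergence comes from bounded differences: resampling the edges with a given larger
endpoint changes the matrix by rank at most two, hence `F_n(x)` by at most `2/n`. The tails are then
exponentially small in `n`, and Borel–Cantelli applies whatever the joint law over different `n`. -/

namespace ChungLu

/-! ### Lagrange inversion, formal and asymptotic. -/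

section Lagrange

open PowerSeries

/-- The power series `∑ k, Λ (k + 1) y ^ k`. -/
noncomputable def offspringSeries (Λ : ℕ → ℝ) : ℝ⟦X⟧ :=
  PowerSeries.mk fun k => Λ (k + 1)

/-- The coefficient of `t ^ n` in `T ^ m`, where `T = t φ(T)`, according to Lagrange's formula. -/
noncomputable def lagrangeCoeff (f : ℝ⟦X⟧) (m n : ℕ) : ℝ :=
  if n = 0 then (if m = 0 then 1 else 0)
  else if m ≤ n then (m : ℝ) / n * coeff (n - m) (f ^ n) else 0

lemma lagrangeCoeff_of_lt (f : ℝ⟦X⟧) {m n : ℕ} (h : n < m) : lagrangeCoeff f m n = 0 := by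
  unfold lagrangeCoeff
  split_ifs <;> first | rfl | omega

lemma lagrangeCoeff_zero_left (f : ℝ⟦X⟧) (n : ℕ) :
    lagrangeCoeff f 0 n = if n = 0 then 1 else 0 := by
  unfold lagrangeCoeff
  split_ifs <;> simp_all

lemma lagrangeCoeff_zero_right (f : ℝ⟦X⟧) (m : ℕ) :
    lagrangeCoeff f m 0 = if m = 0 then 1 else 0 := by
  simp [lagrangeCoeff]

lemma lagrangeCoeff_pos (f : ℝ⟦X⟧) {m n : ℕ} (h : m ≤ n) (hn : n ≠ 0) :
    lagrangeCoeff f m n = (m : ℝ) / n * coeff (n - m) (f ^ n) := by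
  simp [lagrangeCoeff, h, hn]

/-- Comparison of the coefficients of `y ^ d` in `(n + 1) f ^ n · y f' = y (f ^ (n + 1))'`. -/
lemma sum_antidiagonal_mul_coeff_pow (f : ℝ⟦X⟧) (n d : ℕ) :
    (∑ p ∈ Finset.HasAntidiagonal.antidiagonal d, (p.1 : ℝ) * coeff p.1 f * coeff p.2 (f ^ n)) * (n + 1)
      = d * coeff d (f ^ (n + 1)) := by
  rcases d with _ | e
  · simp
  have h := coeff_derivative (R := ℝ) (f ^ (n + 1)) e
  rw [derivative_pow] at h
  rw [Finset.Nat.sum_antidiagonal_succ]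
  have h2 : coeff e ((((n + 1 : ℕ) : ℝ⟦X⟧)) * f ^ n * derivative ℝ f) =
      (n + 1) * ∑ p ∈ Finset.HasAntidiagonal.antidiagonal e,
        ((p.1 : ℝ) + 1) * coeff (p.1 + 1) f * coeff p.2 (f ^ n) := by
    rw [mul_assoc, mul_comm (f ^ n)]
    have : ((n + 1 : ℕ) : ℝ⟦X⟧) = C ((n : ℝ) + 1) := by
      simp
    rw [this, coeff_C_mul, coeff_mul]
    congr 1
    refine Finset.sum_congr rfl fun p _ => ?_
    rw [coeff_derivative]
    ring
  simp only [Nat.add_sub_cancel] at h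
  rw [h2] at h
  push_cast
  simp only [zero_mul, zero_add]
  linarith

/-- Coefficient form of `T ^ (m + 1) = t f(T) T ^ m`. The series `T` is never constructed: the
recursion is checked on the closed formula, where the factor `m + k` splits into a convolution
computing `f ^ (n + 1)` and one computing its derivative. Terms with `m + k > n` vanish, so any
range longer than `n` serves. -/
lemma lagrangeCoeff_succ_succ (f : ℝ⟦X⟧) (m n N : ℕ) (hN : n < N) :
    lagrangeCoeff f (m + 1) (n + 1) =
      ∑ k ∈ Finset.range N, coeff k f * lagrangeCoeff f (m + k) n := by
  rcases lt_or_ge n m with hmn | hmn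
  · rw [lagrangeCoeff_of_lt f (by omega)]
    symm
    refine Finset.sum_eq_zero fun k _ => ?_
    rw [lagrangeCoeff_of_lt f (by omega), mul_zero]
  obtain ⟨d, rfl⟩ := Nat.exists_eq_add_of_le hmn
  rw [lagrangeCoeff_pos f (by omega) (by omega)]
  have hsub : Finset.range (d + 1) ⊆ Finset.range N := by
    intro k hk
    simp only [Finset.mem_range] at *
    omega
  rw [← Finset.sum_subset hsub]
  swap
  · intro k _ hk
    simp only [Finset.mem_range] at hk
    rw [lagrangeCoeff_of_lt f (by omega), mul_zero]
  rcases Nat.eq_zero_or_pos (m + d) with h0 | h0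
  · obtain ⟨rfl, rfl⟩ : m = 0 ∧ d = 0 := by omega
    simp [lagrangeCoeff_zero_right]
  have hcast : ((m : ℝ) + d) ≠ 0 := by
    have : (0 : ℝ) < ((m + d : ℕ) : ℝ) := by exact_mod_cast h0
    push_cast at this
    exact this.ne'
  have key := sum_antidiagonal_mul_coeff_pow f (m + d) d
  have hmul : ∑ p ∈ Finset.HasAntidiagonal.antidiagonal d, coeff p.1 f * coeff p.2 (f ^ (m + d)) =
      coeff d (f ^ (m + d + 1)) := by
    rw [pow_succ', coeff_mul]
  have hsum : ∑ k ∈ Finset.range (d + 1), coeff k f * lagrangeCoeff f (m + k) (m + d) =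
      ∑ p ∈ Finset.HasAntidiagonal.antidiagonal d,
        ((m : ℝ) / (m + d) * (coeff p.1 f * coeff p.2 (f ^ (m + d))) +
          1 / (m + d) * ((p.1 : ℝ) * coeff p.1 f * coeff p.2 (f ^ (m + d)))) := by
    rw [Finset.Nat.sum_antidiagonal_eq_sum_range_succ_mk]
    refine Finset.sum_congr rfl fun k hk => ?_
    have hk' : k ≤ d := by simp only [Finset.mem_range] at hk; omega
    rw [lagrangeCoeff_pos f (by omega) (by omega), show m + d - (m + k) = d - k by omega]
    push_cast
    field_simp
  rw [hsum, Finset.sum_add_distrib, ← Finset.mul_sum, ← Finset.mul_sum, hmul,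
    show m + d + 1 - (m + 1) = d by omega]
  have hc1 : ((m : ℝ) + d + 1) ≠ 0 := by positivity
  have key' : ∑ p ∈ Finset.HasAntidiagonal.antidiagonal d, (p.1 : ℝ) * coeff p.1 f * coeff p.2 (f ^ (m + d)) =
      d * coeff d (f ^ (m + d + 1)) / (m + d + 1) := by
    rw [eq_div_iff hc1, ← key]
    push_cast
    ring
  rw [key']
  push_cast
  field_simp
  ring

/-- Multinomial theorem, after truncating the series below degree `s`, which leaves the coefficient
of degree `s - 1` intact. Replacing the degree `j` by `j + 1` adds `∑ r_j = s + 1` to the weighted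
sum and so turns `s - 1` into `2 s`. -/
lemma coeff_offspringSeries_pow (Λ : ℕ → ℝ) {s : ℕ} (hs : 1 ≤ s) :
    coeff (s - 1) (offspringSeries Λ ^ (s + 1)) =
      ∑ r ∈ treeDegreeDistributions s,
        (Nat.multinomial Finset.univ r : ℝ) * ∏ j : Fin s, Λ ((j : ℕ) + 1) ^ r j := by
  have h1 : coeff (s - 1) (offspringSeries Λ ^ (s + 1)) =
      ((trunc s (offspringSeries Λ)) ^ (s + 1)).coeff (s - 1) := by
    have := congrArg (fun p => p.coeff (s - 1)) (trunc_trunc_pow (offspringSeries Λ) s (s + 1))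
    simp only [coeff_trunc, show s - 1 < s by omega, if_true] at this
    rw [← this, ← Polynomial.coe_pow, Polynomial.coeff_coe]
  have h2 : trunc s (offspringSeries Λ) = ∑ j : Fin s, Polynomial.monomial (j : ℕ) (Λ (j + 1)) := by
    rw [Fin.sum_univ_eq_sum_range (fun j => Polynomial.monomial j (Λ (j + 1))) s]
    ext k
    rw [coeff_trunc, Polynomial.finsetSum_coeff]
    simp only [Polynomial.coeff_monomial, Finset.sum_ite_eq', Finset.mem_range, offspringSeries,
      coeff_mk]
  rw [h1, h2, Finset.sum_pow_eq_sum_piAntidiag, Polynomial.finsetSum_coeff,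
    treeDegreeDistributions, Finset.sum_filter]
  refine Finset.sum_congr rfl fun r hr => ?_
  have hprod : ∏ j : Fin s, (Polynomial.monomial (j : ℕ) (Λ (j + 1))) ^ r j =
      Polynomial.monomial (∑ j : Fin s, (j : ℕ) * r j) (∏ j : Fin s, Λ ((j : ℕ) + 1) ^ r j) := by
    simp_rw [Polynomial.monomial_pow]
    rw [← Polynomial.C_mul_X_pow_eq_monomial, map_prod, ← Finset.prod_pow_eq_pow_sum,
      ← Finset.prod_mul_distrib]
    exact Finset.prod_congr rfl fun j _ => (Polynomial.C_mul_X_pow_eq_monomial).symm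
  rw [hprod, ← Polynomial.C_eq_natCast, Polynomial.coeff_C_mul, Polynomial.coeff_monomial]
  have hr' : ∑ j, r j = s + 1 := (Finset.mem_piAntidiag.1 hr).1
  have hiff : (∑ j : Fin s, (j : ℕ) * r j = s - 1) ↔ ∑ j : Fin s, ((j : ℕ) + 1) * r j = 2 * s := by
    simp only [add_mul, one_mul, Finset.sum_add_distrib, hr']
    omega
  simp only [hiff]
  split_ifs <;> simp

lemma evenMoment_eq_lagrangeCoeff (Λ : ℕ → ℝ) {s : ℕ} (hs : 1 ≤ s) :
    evenMoment Λ s = lagrangeCoeff (offspringSeries Λ) 2 (s + 1) := by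
  rw [lagrangeCoeff_pos _ (by omega) (by omega), show s + 1 - 2 = s - 1 by omega,
    coeff_offspringSeries_pow Λ hs, evenMoment, Finset.mul_sum]
  push_cast
  exact Finset.sum_congr rfl fun r _ => by ring

end Lagrange

/-- Asymptotic form of Lagrange inversion: powers of an approximate solution of `τ = t φ(τ)` have
the Lagrange expansion. -/
lemma isBigO_pow_sub_lagrange {α : Type*} {l : Filter α} (f : PowerSeries ℝ) (t τ : α → ℂ)
    (hτ : τ =O[l] fun _ => (1 : ℂ))
    (h : ∀ K : ℕ, (fun a => τ a - t a * ∑ k ∈ Finset.range K,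
      ((PowerSeries.coeff k f : ℝ) : ℂ) * τ a ^ k) =O[l] fun a => t a ^ (K + 1)) (N m : ℕ) :
    (fun a => τ a ^ m - ∑ n ∈ Finset.range N, (lagrangeCoeff f m n : ℂ) * t a ^ n)
      =O[l] fun a => t a ^ N := by
  induction N generalizing m with
  | zero => simpa using hτ.pow m
  | succ N ih =>
    rcases m with _ | m
    · have : (fun a => τ a ^ 0 - ∑ n ∈ Finset.range (N + 1), (lagrangeCoeff f 0 n : ℂ) * t a ^ n)
          = fun _ => 0 := by
        funext a
        rw [Finset.sum_range_succ']
        simp [lagrangeCoeff_zero_left]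
      rw [this]
      exact isBigO_zero _ _
    -- Writing one factor `τ` as `t φ(τ)` plus its defect, the recursion for the coefficients leaves
    -- `τ ^ m` times the defect, plus `t` times the order `N` errors of the powers `m + k`. The
    -- factor `t` supplies the extra order.
    have key : ∀ a, τ a ^ (m + 1) -
        ∑ n ∈ Finset.range (N + 1), (lagrangeCoeff f (m + 1) n : ℂ) * t a ^ n =
        τ a ^ m * (τ a - t a * ∑ k ∈ Finset.range N,
          ((PowerSeries.coeff k f : ℝ) : ℂ) * τ a ^ k) +
        t a * ∑ k ∈ Finset.range N, ((PowerSeries.coeff k f : ℝ) : ℂ) *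
          (τ a ^ (m + k) - ∑ n ∈ Finset.range N, (lagrangeCoeff f (m + k) n : ℂ) * t a ^ n) := by
      intro a
      rw [Finset.sum_range_succ']
      have h1 : ∑ n ∈ Finset.range N, (lagrangeCoeff f (m + 1) (n + 1) : ℂ) * t a ^ (n + 1) =
          t a * ∑ k ∈ Finset.range N, ((PowerSeries.coeff k f : ℝ) : ℂ) *
            ∑ n ∈ Finset.range N, (lagrangeCoeff f (m + k) n : ℂ) * t a ^ n := by
        simp_rw [Finset.mul_sum]
        rw [Finset.sum_comm]
        refine Finset.sum_congr rfl fun n hn => ?_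
        rw [lagrangeCoeff_succ_succ f m n N (Finset.mem_range.1 hn)]
        push_cast
        rw [Finset.sum_mul]
        refine Finset.sum_congr rfl fun k _ => ?_
        ring
      rw [h1, lagrangeCoeff_zero_right]
      simp only [mul_sub, Finset.sum_sub_distrib, pow_add]
      simp only [Nat.add_eq_zero_iff, one_ne_zero, and_false, if_false]
      have h2 : ∑ k ∈ Finset.range N, ((PowerSeries.coeff k f : ℝ) : ℂ) * (τ a ^ m * τ a ^ k) =
          τ a ^ m * ∑ k ∈ Finset.range N, ((PowerSeries.coeff k f : ℝ) : ℂ) * τ a ^ k := by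
        rw [Finset.mul_sum]
        exact Finset.sum_congr rfl fun k _ => by ring
      rw [h2]
      push_cast
      ring
    simp_rw [key]
    refine IsBigO.add ?_ ?_
    · simpa using (hτ.pow m).mul (h N)
    · have := (isBigO_refl t l).mul (IsBigO.sum (s := Finset.range N)
        (A := fun k a => ((PowerSeries.coeff k f : ℝ) : ℂ) *
          (τ a ^ (m + k) - ∑ n ∈ Finset.range N, (lagrangeCoeff f (m + k) n : ℂ) * t a ^ n))
        fun k _ => (ih (m + k)).const_mul_left _)
      simpa [pow_succ'] using this

end ChungLu

namespace ChungLu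

/-! ### Determinacy of the moment problem and growth of the limiting moments. -/

section Determinacy

/-- Markov's inequality for `x ^ (2 s)` at level `(R + 1) ^ s` bounds the outside mass by `(R / (R +
1)) ^ s`, which tends to zero with `s`. -/
lemma ae_abs_le_of_moments_le (F : Measure ℝ) [IsProbabilityMeasure F] (R : ℝ) (hR : 0 ≤ R)
    (hint : ∀ k : ℕ, Integrable (fun x : ℝ => x ^ k) F)
    (hm : ∀ s : ℕ, ∫ x, x ^ (2 * s) ∂F ≤ R ^ s) : ∀ᵐ x ∂F, |x| ≤ Real.sqrt (R + 1) := by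
  set B := Real.sqrt (R + 1) with hB
  have hB2 : B ^ 2 = R + 1 := Real.sq_sqrt (by linarith)
  have hB0 : 0 ≤ B := Real.sqrt_nonneg _
  have hle : ∀ s : ℕ, F.real {x | B < |x|} ≤ (R / (R + 1)) ^ s := by
    intro s
    have h1 := mul_meas_ge_le_integral_of_nonneg (μ := F) (f := fun x : ℝ => x ^ (2 * s))
      (ae_of_all _ fun x => by simp only [pow_mul]; positivity) (hint (2 * s)) ((R + 1) ^ s)
    have h2 : F.real {x | B < |x|} ≤ F.real {x : ℝ | (R + 1) ^ s ≤ x ^ (2 * s)} := by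
      refine measureReal_mono fun x hx => ?_
      simp only [Set.mem_ofPred_eq] at *
      rw [pow_mul, ← hB2, ← sq_abs x]
      gcongr
    have hpos : 0 < (R + 1) ^ s := by positivity
    rw [div_pow, le_div_iff₀ hpos]
    nlinarith [hm s]
  have hlim : Tendsto (fun s : ℕ => (R / (R + 1)) ^ s) atTop (𝓝 0) :=
    tendsto_pow_atTop_nhds_zero_of_lt_one (by positivity)
      (by rw [div_lt_one (by linarith)]; linarith)
  have h0 : F.real {x | B < |x|} = 0 :=
    le_antisymm (ge_of_tendsto' hlim hle) measureReal_nonneg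
  rw [measureReal_eq_zero_iff] at h0
  rw [ae_iff]
  simpa only [not_le] using h0

/-- On a bounded support the partial sums of the exponential series are dominated by a constant, so
the characteristic function is a function of the moments alone. -/
lemma tendsto_charFun_of_bounded (F : Measure ℝ) [IsProbabilityMeasure F] (B : ℝ)
    (hB : ∀ᵐ x ∂F, |x| ≤ B) (hint : ∀ k : ℕ, Integrable (fun x : ℝ => x ^ k) F) (t : ℝ) :
    Tendsto (fun n : ℕ => ∑ k ∈ Finset.range n,
      ((t : ℂ) * Complex.I) ^ k / (k.factorial : ℂ) * ((∫ x, x ^ k ∂F : ℝ) : ℂ)) atTop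
      (𝓝 (charFun F t)) := by
  have heq : ∀ n : ℕ, ∑ k ∈ Finset.range n,
      ((t : ℂ) * Complex.I) ^ k / (k.factorial : ℂ) * ((∫ x, x ^ k ∂F : ℝ) : ℂ) =
      ∫ x : ℝ, ∑ k ∈ Finset.range n, ((t : ℂ) * x * Complex.I) ^ k / (k.factorial : ℂ) ∂F := by
    intro n
    have hterm : ∀ (k : ℕ) (x : ℝ), ((t : ℂ) * x * Complex.I) ^ k / (k.factorial : ℂ) =
        ((t : ℂ) * Complex.I) ^ k / (k.factorial : ℂ) * ((x ^ k : ℝ) : ℂ) := by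
      intro k x
      push_cast
      rw [mul_right_comm, mul_pow]
      ring
    simp_rw [hterm]
    rw [integral_finsetSum _ fun k _ => ((hint k).ofReal).const_mul _]
    refine Finset.sum_congr rfl fun k _ => ?_
    rw [integral_const_mul, integral_complex_ofReal]
  simp_rw [heq, charFun_apply_real]
  refine tendsto_integral_of_dominated_convergence (fun _ => Real.exp (|t| * B)) (fun n => ?_)
    (integrable_const _) (fun n => ?_) (ae_of_all _ fun x => ?_)
  · exact (Continuous.aestronglyMeasurable (by fun_prop))
  · filter_upwards [hB] with x hx
    refine (norm_sum_le _ _).trans ?_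
    have : ∀ k ∈ Finset.range n, ‖((t : ℂ) * x * Complex.I) ^ k / (k.factorial : ℂ)‖ ≤
        (|t| * B) ^ k / (k.factorial : ℝ) := by
      intro k _
      rw [norm_div, norm_pow, norm_mul, norm_mul, Complex.norm_I, mul_one, Complex.norm_natCast,
        Complex.norm_real, Complex.norm_real, Real.norm_eq_abs, Real.norm_eq_abs]
      gcongr
    exact (Finset.sum_le_sum this).trans (Real.sum_le_exp_of_nonneg
      (mul_nonneg (abs_nonneg _) ((abs_nonneg x).trans hx)) n)
  · have := (NormedSpace.expSeries_div_hasSum_exp ((t : ℂ) * x * Complex.I)).tendsto_sum_nat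
    rw [← Complex.exp_eq_exp_ℂ] at this
    exact this

/-- A probability measure with exponentially bounded even moments is determined by its moments. -/
lemma eq_of_moments_eq (F G : Measure ℝ) [IsProbabilityMeasure F] [IsProbabilityMeasure G] (R : ℝ)
    (hR : 0 ≤ R) (hF : ∀ k : ℕ, Integrable (fun x : ℝ => x ^ k) F)
    (hG : ∀ k : ℕ, Integrable (fun x : ℝ => x ^ k) G)
    (hm : ∀ s : ℕ, ∫ x, x ^ (2 * s) ∂F ≤ R ^ s)
    (h : ∀ k : ℕ, ∫ x, x ^ k ∂G = ∫ x, x ^ k ∂F) : G = F := by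
  refine Measure.ext_of_charFun (funext fun t => ?_)
  have h1 := tendsto_charFun_of_bounded F _ (ae_abs_le_of_moments_le F R hR hF hm) hF t
  have h2 := tendsto_charFun_of_bounded G _
    (ae_abs_le_of_moments_le G R hR hG fun s => by rw [h]; exact hm s) hG t
  simp_rw [h] at h2
  exact tendsto_nhds_unique h2 h1

/-- Expand `(∑ 2 ^ (-(j + 1))) ^ (s + 1) ≤ 1` by the multinomial theorem: the constraint `∑ (j + 1)
r_j = 2 s` gives every term from `R_s` the same weight `4 ^ (-s)`. -/
lemma sum_multinomial_treeDegreeDistributions_le (s : ℕ) :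
    ∑ r ∈ treeDegreeDistributions s, (Nat.multinomial Finset.univ r : ℝ) ≤ 4 ^ s := by
  have h1 : (∑ j : Fin s, (1 / 2 : ℝ) ^ ((j : ℕ) + 1)) ≤ 1 := by
    rw [Fin.sum_univ_eq_sum_range (fun j => (1 / 2 : ℝ) ^ (j + 1)) s]
    simp_rw [pow_succ]
    rw [← Finset.sum_mul, geom_sum_eq (by norm_num)]
    have : (0 : ℝ) ≤ (1 / 2) ^ s := by positivity
    rw [show ((1 / 2 : ℝ) ^ s - 1) / (1 / 2 - 1) * (1 / 2) = 1 - (1 / 2) ^ s by ring]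
    linarith
  have h2 : (∑ j : Fin s, (1 / 2 : ℝ) ^ ((j : ℕ) + 1)) ^ (s + 1) ≤ 1 :=
    pow_le_one₀ (by positivity) h1
  rw [Finset.sum_pow_eq_sum_piAntidiag] at h2
  have h3 : ∑ r ∈ treeDegreeDistributions s, (Nat.multinomial Finset.univ r : ℝ) * (1 / 4) ^ s ≤ 1 := by
    refine le_trans ?_ h2
    rw [treeDegreeDistributions]
    have : ∀ r ∈ (Finset.piAntidiag Finset.univ (s + 1)).filter
        (fun r : Fin s → ℕ => ∑ j : Fin s, ((j : ℕ) + 1) * r j = 2 * s),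
        (Nat.multinomial Finset.univ r : ℝ) * (1 / 4) ^ s =
        (Nat.multinomial Finset.univ r : ℝ) * ∏ j : Fin s, ((1 / 2 : ℝ) ^ ((j : ℕ) + 1)) ^ r j := by
      intro r hr
      rw [Finset.mem_filter] at hr
      simp_rw [← pow_mul]
      rw [Finset.prod_pow_eq_pow_sum, hr.2, pow_mul]
      norm_num
    rw [Finset.sum_congr rfl this]
    exact Finset.sum_le_sum_of_subset_of_nonneg (Finset.filter_subset _ _)
      fun _ _ _ => by positivity
  rw [← Finset.sum_mul, one_div, inv_pow, ← div_eq_mul_inv, div_le_one (by positivity)] at h3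
  exact h3

lemma abs_evenMoment_le (Λ : ℕ → ℝ) (C : ℝ) (hΛ : ∀ k, 1 ≤ k → |Λ k| ≤ C ^ k) {s : ℕ} (hs : 1 ≤ s) :
    |evenMoment Λ s| ≤ (4 * C ^ 2) ^ s := by
  have hC : 0 ≤ C := by simpa using (abs_nonneg _).trans (hΛ 1 le_rfl)
  rw [evenMoment]
  refine (Finset.abs_sum_le_sum_abs _ _).trans ?_
  have : ∀ r ∈ treeDegreeDistributions s, |2 / ((s : ℝ) + 1) * (Nat.multinomial Finset.univ r : ℝ) *
      ∏ j : Fin s, Λ ((j : ℕ) + 1) ^ r j| ≤ (Nat.multinomial Finset.univ r : ℝ) * C ^ (2 * s) := by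
    intro r hr
    rw [mem_treeDegreeDistributions] at hr
    rw [abs_mul, abs_mul, Nat.abs_cast, Finset.abs_prod]
    have h1 : |2 / ((s : ℝ) + 1)| ≤ 1 := by
      rw [abs_of_nonneg (by positivity), div_le_one (by positivity)]
      have : (1 : ℝ) ≤ s := by exact_mod_cast hs
      linarith
    have h2 : ∏ j : Fin s, |Λ ((j : ℕ) + 1) ^ r j| ≤ C ^ (2 * s) := by
      rw [← hr.2, ← Finset.prod_pow_eq_pow_sum]
      refine Finset.prod_le_prod (fun _ _ => abs_nonneg _) fun j _ => ?_
      rw [abs_pow, pow_mul]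
      gcongr
      exact hΛ _ (by omega)
    calc _ ≤ 1 * (Nat.multinomial Finset.univ r : ℝ) * C ^ (2 * s) := by gcongr
      _ = _ := by ring
  refine (Finset.sum_le_sum this).trans ?_
  rw [← Finset.sum_mul, mul_pow, ← pow_mul]
  gcongr
  exact sum_multinomial_treeDegreeDistributions_le s

end Determinacy

/-! ### Moments from the expansion of the Stieltjes transform along the imaginary axis. -/

section MomentExtraction

/-- The regularised power is at most `η ^ 2 x ^ (2 k - 2)`, so it is integrable one step before `x ^
(2 k)` is known to be. This drives the induction on moments. -/
lemma integrable_div_one_add (F : Measure ℝ) [IsProbabilityMeasure F] (k : ℕ)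
    (h : ∀ j, j < k → Integrable (fun x : ℝ => x ^ (2 * j)) F) (η : ℝ) (hη : 0 < η) :
    Integrable (fun x : ℝ => x ^ (2 * k) / (1 + x ^ 2 / η ^ 2)) F := by
  have hcont : Continuous fun x : ℝ => x ^ (2 * k) / (1 + x ^ 2 / η ^ 2) := by
    refine Continuous.div (by fun_prop) (by fun_prop) fun x => ?_
    positivity
  rcases k with _ | k
  · refine Integrable.of_bound hcont.aestronglyMeasurable 1 (ae_of_all _ fun x => ?_)
    rw [mul_zero, pow_zero, Real.norm_of_nonneg (by positivity), div_le_one (by positivity)]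
    linarith [show 0 ≤ x ^ 2 / η ^ 2 by positivity]
  · refine ((h k (by omega)).const_mul (η ^ 2)).mono' hcont.aestronglyMeasurable
      (ae_of_all _ fun x => ?_)
    have h0 : 0 ≤ x ^ (2 * k) := by rw [pow_mul]; positivity
    have h1 : x ^ (2 * (k + 1)) = x ^ (2 * k) * x ^ 2 := by ring
    rw [h1, Real.norm_of_nonneg (by positivity), div_le_iff₀ (by positivity)]
    have : η ^ 2 * x ^ (2 * k) * (1 + x ^ 2 / η ^ 2) =
      x ^ (2 * k) * x ^ 2 + η ^ 2 * x ^ (2 * k) := by field_simp; ring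
    rw [this]
    have : 0 ≤ η ^ 2 * x ^ (2 * k) := by positivity
    linarith

lemma tendsto_div_one_add (x y : ℝ) :
    Tendsto (fun n : ℕ => y / (1 + x ^ 2 / ((n : ℝ) + 1) ^ 2)) atTop (𝓝 y) := by
  have h1 : Tendsto (fun n : ℕ => ((n : ℝ) + 1) ^ 2) atTop atTop :=
    (tendsto_pow_atTop two_ne_zero).comp
      (tendsto_atTop_add_const_right _ _ tendsto_natCast_atTop_atTop)
  have h2 := h1.const_div_atTop (x ^ 2)
  have h3 := (tendsto_const_nhds (x := y)).div ((tendsto_const_nhds (x := (1 : ℝ))).add h2)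
    (by norm_num)
  simpa only [Pi.div_def, add_zero, div_one] using h3

lemma abs_div_one_add_le (x y z : ℝ) : |y / (1 + x ^ 2 / z ^ 2)| ≤ |y| := by
  rw [abs_div, abs_of_pos (show 0 < 1 + x ^ 2 / z ^ 2 by positivity)]
  exact div_le_self (abs_nonneg _) (by linarith [show 0 ≤ x ^ 2 / z ^ 2 by positivity])

lemma tendsto_integral_div_one_add (F : Measure ℝ) [IsProbabilityMeasure F] (g : ℝ → ℝ)
    (hg : Integrable g F) :
    Tendsto (fun n : ℕ => ∫ x, g x / (1 + x ^ 2 / ((n : ℝ) + 1) ^ 2) ∂F) atTop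
      (𝓝 (∫ x, g x ∂F)) := by
  refine tendsto_integral_of_dominated_convergence (fun x => |g x|) (fun n => ?_) hg.abs
    (fun n => ae_of_all _ fun x => ?_) (ae_of_all _ fun x => tendsto_div_one_add _ _)
  · have : Continuous fun x : ℝ => (1 + x ^ 2 / ((n : ℝ) + 1) ^ 2) := by fun_prop
    exact (hg.aestronglyMeasurable.aemeasurable.div this.aemeasurable).aestronglyMeasurable
  · exact abs_div_one_add_le _ _ _

/-- Fatou's lemma gives integrability of `g`; dominated convergence then identifies its integral
with `L`. -/
lemma integrable_of_tendsto_div_one_add (F : Measure ℝ) [IsProbabilityMeasure F] (g : ℝ → ℝ)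
    (hg : Continuous g) (hg0 : ∀ x, 0 ≤ g x) (L : ℝ)
    (hint : ∀ n : ℕ, Integrable (fun x => g x / (1 + x ^ 2 / ((n : ℝ) + 1) ^ 2)) F)
    (hL : Tendsto (fun n : ℕ => ∫ x, g x / (1 + x ^ 2 / ((n : ℝ) + 1) ^ 2) ∂F) atTop (𝓝 L)) :
    Integrable g F ∧ ∫ x, g x ∂F = L := by
  have hi : Integrable g F := by
    refine ⟨hg.aestronglyMeasurable, ?_⟩
    rw [hasFiniteIntegral_iff_ofReal (ae_of_all _ hg0)]
    have h1 : ∫⁻ x, ENNReal.ofReal (g x) ∂F ≤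
        liminf (fun n : ℕ => ∫⁻ x, ENNReal.ofReal (g x / (1 + x ^ 2 / ((n : ℝ) + 1) ^ 2)) ∂F)
          atTop := by
      refine le_trans (le_of_eq ?_) (lintegral_liminf_le fun n => ?_)
      · refine lintegral_congr fun x => ?_
        exact ((ENNReal.tendsto_ofReal (tendsto_div_one_add x (g x))).liminf_eq).symm
      · exact (Continuous.measurable (Continuous.div hg (by fun_prop)
          fun x => by positivity)).ennreal_ofReal
    refine h1.trans_lt ?_
    have h2 : ∀ n : ℕ, ∫⁻ x, ENNReal.ofReal (g x / (1 + x ^ 2 / ((n : ℝ) + 1) ^ 2)) ∂F =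
        ENNReal.ofReal (∫ x, g x / (1 + x ^ 2 / ((n : ℝ) + 1) ^ 2) ∂F) := fun n =>
      (ofReal_integral_eq_lintegral_ofReal (hint n)
        (ae_of_all _ fun x => div_nonneg (hg0 x) (by positivity))).symm
    simp_rw [h2]
    rw [(ENNReal.tendsto_ofReal hL).liminf_eq]
    exact ENNReal.ofReal_lt_top
  exact ⟨hi, tendsto_nhds_unique (tendsto_integral_div_one_add F g hi) hL⟩

lemma one_div_one_add_eq (y : ℝ) (hy : 1 + y ≠ 0) (k : ℕ) :
    1 / (1 + y) = ∑ s ∈ Finset.range k, (-y) ^ s + (-y) ^ k / (1 + y) := by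
  have h := geom_sum_eq (x := -y) (by intro h; apply hy; linarith) k
  rw [h]
  have : -y - 1 ≠ 0 := by intro h; apply hy; linarith
  rw [div_add_div _ _ this hy, div_eq_div_iff hy (mul_ne_zero this hy)]
  ring

lemma neg_I_mul_mul_inv_sub (x η : ℝ) (hη : η ≠ 0) :
    -(Complex.I * η) * ((x : ℂ) - Complex.I * η)⁻¹ =
      ((1 / (1 + x ^ 2 / η ^ 2) : ℝ) : ℂ) - Complex.I * ((x / η / (1 + x ^ 2 / η ^ 2) : ℝ) : ℂ) := by
  have hη' : (η : ℂ) ≠ 0 := by exact_mod_cast hη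
  have h1 : (x : ℂ) - Complex.I * η ≠ 0 := by
    intro h
    have := congrArg Complex.im h
    simp at this
    exact hη this
  have h2 : (1 + (x : ℂ) ^ 2 / (η : ℂ) ^ 2) ≠ 0 := by
    have : (1 + x ^ 2 / η ^ 2 : ℝ) ≠ 0 := by positivity
    exact_mod_cast this
  push_cast
  rw [← div_eq_mul_inv, div_eq_iff h1]
  have h3 : (1 : ℂ) / (1 + (x : ℂ) ^ 2 / (η : ℂ) ^ 2) -
      Complex.I * ((x : ℂ) / η / (1 + (x : ℂ) ^ 2 / (η : ℂ) ^ 2)) =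
      (1 - Complex.I * (x / η)) / (1 + (x : ℂ) ^ 2 / (η : ℂ) ^ 2) := by ring
  rw [h3, div_mul_eq_mul_div, eq_div_iff h2]
  field_simp
  ring_nf
  simp only [Complex.I_sq]
  ring

lemma neg_I_mul_stieltjes (F : Measure ℝ) [IsProbabilityMeasure F] (η : ℝ) (hη : 0 < η) :
    -(Complex.I * η) * ∫ x : ℝ, ((x : ℂ) - Complex.I * η)⁻¹ ∂F =
      ((∫ x : ℝ, 1 / (1 + x ^ 2 / η ^ 2) ∂F : ℝ) : ℂ) -
        Complex.I * ((∫ x : ℝ, x / η / (1 + x ^ 2 / η ^ 2) ∂F : ℝ) : ℂ) := by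
  have i1 : Integrable (fun x : ℝ => 1 / (1 + x ^ 2 / η ^ 2)) F := by
    simpa using integrable_div_one_add F 0 (by simp) η hη
  have i2 : Integrable (fun x : ℝ => x / η / (1 + x ^ 2 / η ^ 2)) F := by
    refine Integrable.of_bound (Continuous.aestronglyMeasurable
      (Continuous.div (by fun_prop) (by fun_prop) fun x => by positivity)) 1
      (ae_of_all _ fun x => ?_)
    rw [Real.norm_eq_abs, abs_div, abs_of_pos (show 0 < 1 + x ^ 2 / η ^ 2 by positivity),
      div_le_one (by positivity), ← div_pow, ← sq_abs (x / η)]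
    nlinarith [sq_nonneg (|x / η| - 1 / 2), abs_nonneg (x / η)]
  rw [← integral_const_mul, ← integral_complex_ofReal, ← integral_complex_ofReal,
    ← integral_const_mul, ← integral_sub i1.ofReal (i2.ofReal.const_mul _)]
  exact integral_congr_ae (ae_of_all _ fun x => neg_I_mul_mul_inv_sub x η hη.ne')

/-- If `-z S(z)`, `z = i η`, has an asymptotic expansion in powers of `z⁻²` with real coefficients,
where `S` is the Stieltjes transform of `F`, then these coefficients are the even moments of `F` and
the odd moments vanish. -/
lemma moments_of_stieltjes_expansion (F : Measure ℝ) [IsProbabilityMeasure F] (m : ℕ → ℝ)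
    (h : ∀ K : ℕ, (fun η : ℝ => -(Complex.I * η) * ∫ x : ℝ, ((x : ℂ) - Complex.I * η)⁻¹ ∂F -
      ∑ s ∈ Finset.range K, (m s : ℂ) * ((-(1 / η ^ 2) : ℝ) : ℂ) ^ s) =O[atTop]
        fun η : ℝ => (1 / η ^ 2) ^ K) :
    (∀ k : ℕ, Integrable (fun x : ℝ => x ^ k) F) ∧ (∀ s : ℕ, ∫ x, x ^ (2 * s) ∂F = m s) ∧
      ∀ s : ℕ, ∫ x, x ^ (2 * s + 1) ∂F = 0 := by
  have hseq : Tendsto (fun n : ℕ => (n : ℝ) + 1) atTop atTop :=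
    tendsto_atTop_add_const_right _ _ tendsto_natCast_atTop_atTop
  have hinv : Tendsto (fun n : ℕ => 1 / ((n : ℝ) + 1)) atTop (𝓝 0) :=
    tendsto_one_div_add_atTop_nhds_zero_nat
  -- The coefficients `m s` are real, so the real and imaginary parts each inherit the error bound.
  -- The real part will carry the even moments, and the imaginary part, with no main term, the odd
  -- ones.
  have hnorm : ∀ a b : ℝ, ‖a‖ ≤ ‖(a : ℂ) - Complex.I * b‖ ∧ ‖b‖ ≤ ‖(a : ℂ) - Complex.I * b‖ := by
    refine fun a b => ⟨?_, ?_⟩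
    · simpa using Complex.abs_re_le_norm ((a : ℂ) - Complex.I * b)
    · simpa using Complex.abs_im_le_norm ((a : ℂ) - Complex.I * b)
  have hdecomp : ∀ K, ∀ n : ℕ, -(Complex.I * (((n : ℝ) + 1 : ℝ) : ℂ)) *
      ∫ x : ℝ, ((x : ℂ) - Complex.I * (((n : ℝ) + 1 : ℝ) : ℂ))⁻¹ ∂F -
      ∑ s ∈ Finset.range K, (m s : ℂ) * ((-(1 / ((n : ℝ) + 1) ^ 2) : ℝ) : ℂ) ^ s =
      ((∫ x : ℝ, 1 / (1 + x ^ 2 / ((n : ℝ) + 1) ^ 2) ∂F -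
        ∑ s ∈ Finset.range K, m s * (-(1 / ((n : ℝ) + 1) ^ 2)) ^ s : ℝ) : ℂ) -
        Complex.I * ((∫ x : ℝ, x / ((n : ℝ) + 1) / (1 + x ^ 2 / ((n : ℝ) + 1) ^ 2) ∂F : ℝ) : ℂ) := by
    intro K n
    rw [neg_I_mul_stieltjes F _ (by positivity), Complex.ofReal_sub, Complex.ofReal_sum]
    simp only [Complex.ofReal_mul, Complex.ofReal_pow]
    ring
  have hre : ∀ K : ℕ, (fun n : ℕ => ∫ x : ℝ, 1 / (1 + x ^ 2 / ((n : ℝ) + 1) ^ 2) ∂F -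
        ∑ s ∈ Finset.range K, m s * (-(1 / ((n : ℝ) + 1) ^ 2)) ^ s) =O[atTop]
        fun n : ℕ => (1 / ((n : ℝ) + 1) ^ 2) ^ K := by
    intro K
    refine IsBigO.trans (isBigO_of_le _ fun n => ?_) ((h K).comp_tendsto hseq)
    simp only [Function.comp]
    rw [hdecomp K n]
    exact (hnorm _ _).1
  have him : ∀ K : ℕ, (fun n : ℕ => ∫ x : ℝ, x / ((n : ℝ) + 1) / (1 + x ^ 2 / ((n : ℝ) + 1) ^ 2) ∂F)
      =O[atTop] fun n : ℕ => (1 / ((n : ℝ) + 1) ^ 2) ^ K := by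
    intro K
    refine IsBigO.trans (isBigO_of_le _ fun n => ?_) ((h K).comp_tendsto hseq)
    simp only [Function.comp]
    rw [hdecomp K n]
    exact (hnorm _ _).2
  have heven : ∀ k : ℕ, Integrable (fun x : ℝ => x ^ (2 * k)) F ∧ ∫ x, x ^ (2 * k) ∂F = m k := by
    intro k
    induction k using Nat.strong_induction_on with
    | _ k ih =>
    have hint := fun n : ℕ => integrable_div_one_add F k (fun j hj => (ih j hj).1) ((n : ℝ) + 1)
      (by positivity)
    refine integrable_of_tendsto_div_one_add F (fun x => x ^ (2 * k)) (by fun_prop)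
      (fun x => by simp only [pow_mul]; positivity) _ hint ?_
    -- A finite geometric expansion cancels the moments below `2 k`, which are known by induction.
    -- What remains, after rescaling by `u ^ (2 k)`, is the regularised moment minus `m k`; an error
    -- `O(u ^ (-2 (k + 1)))` becomes `O(u ^ (-2))`.
    have hval : ∀ n : ℕ, ∫ x, x ^ (2 * k) / (1 + x ^ 2 / ((n : ℝ) + 1) ^ 2) ∂F - m k =
        (∫ x : ℝ, 1 / (1 + x ^ 2 / ((n : ℝ) + 1) ^ 2) ∂F -
        ∑ s ∈ Finset.range (k + 1), m s * (-(1 / ((n : ℝ) + 1) ^ 2)) ^ s) *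
          (-(((n : ℝ) + 1) ^ 2)) ^ k := by
      intro n
      set u : ℝ := (n : ℝ) + 1 with hu
      have hu0 : 0 < u := by positivity
      have e1 : ∀ x : ℝ, 1 / (1 + x ^ 2 / u ^ 2) = ∑ s ∈ Finset.range k,
          (-(1 / u ^ 2)) ^ s * x ^ (2 * s) +
            (-(1 / u ^ 2)) ^ k * (x ^ (2 * k) / (1 + x ^ 2 / u ^ 2)) := by
        intro x
        rw [one_div_one_add_eq (x ^ 2 / u ^ 2) (by positivity) k]
        have : -(x ^ 2 / u ^ 2) = -(1 / u ^ 2) * x ^ 2 := by ring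
        simp_rw [this, mul_pow, ← pow_mul]
        ring
      simp_rw [e1]
      rw [integral_add (integrable_finsetSum _ fun s hs =>
        ((ih s (Finset.mem_range.1 hs)).1.const_mul _)) ((hint n).const_mul _),
        integral_finsetSum _ fun s hs => ((ih s (Finset.mem_range.1 hs)).1.const_mul _),
        Finset.sum_range_succ, integral_const_mul]
      have e2 : ∑ s ∈ Finset.range k, ∫ x : ℝ, (-(1 / u ^ 2)) ^ s * x ^ (2 * s) ∂F =
          ∑ s ∈ Finset.range k, m s * (-(1 / u ^ 2)) ^ s :=
        Finset.sum_congr rfl fun s hs => by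
          rw [integral_const_mul, (ih s (Finset.mem_range.1 hs)).2, mul_comm]
      rw [e2]
      have e3 : (-(1 / u ^ 2)) ^ k * (-(u ^ 2)) ^ k = 1 := by
        rw [← mul_pow, show -(1 / u ^ 2) * -(u ^ 2) = 1 by field_simp, one_pow]
      linear_combination (m k - ∫ x, x ^ (2 * k) / (1 + x ^ 2 / u ^ 2) ∂F) * e3
    rw [← tendsto_sub_nhds_zero_iff]
    simp_rw [hval]
    have hO := (hre (k + 1)).mul (isBigO_refl (fun n : ℕ => (-(((n : ℝ) + 1) ^ 2)) ^ k) atTop)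
    refine hO.trans_tendsto ?_
    have e4 : ∀ n : ℕ, (1 / ((n : ℝ) + 1) ^ 2) ^ (k + 1) * (-(((n : ℝ) + 1) ^ 2)) ^ k =
        (-1) ^ k * (1 / ((n : ℝ) + 1)) ^ 2 := by
      intro n
      rw [neg_pow, pow_succ]
      field_simp
      rw [← mul_pow, one_div_mul_cancel (by positivity), one_pow]
    simp_rw [e4]
    simpa using (hinv.pow 2).const_mul ((-1) ^ k)
  have hoddint : ∀ k : ℕ, Integrable (fun x : ℝ => x ^ (2 * k + 1)) F := by
    intro k
    refine ((heven k).1.add (heven (k + 1)).1).mono' (by fun_prop) (ae_of_all _ fun x => ?_)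
    have h0 : 0 ≤ x ^ (2 * k) := by rw [pow_mul]; positivity
    rw [Real.norm_eq_abs, pow_succ, abs_mul, abs_of_nonneg h0]
    simp only [Pi.add_apply]
    rw [show x ^ (2 * (k + 1)) = x ^ (2 * k) * |x| ^ 2 by rw [sq_abs]; ring]
    nlinarith [sq_nonneg (|x| - 1 / 2)]
  have hodd : ∀ k : ℕ, ∫ x, x ^ (2 * k + 1) ∂F = 0 := by
    intro k
    induction k using Nat.strong_induction_on with
    | _ k ih =>
    refine tendsto_nhds_unique (tendsto_integral_div_one_add F _ (hoddint k)) ?_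
    have hint : ∀ n : ℕ, Integrable (fun x => x ^ (2 * k + 1) / (1 + x ^ 2 / ((n : ℝ) + 1) ^ 2)) F := by
      intro n
      refine (hoddint k).mono (Continuous.aestronglyMeasurable
        (Continuous.div (by fun_prop) (by fun_prop) fun x => by positivity)) (ae_of_all _ fun x => ?_)
      exact abs_div_one_add_le _ _ _
    -- Same cancellation for the imaginary part, whose lower coefficients are odd moments already
    -- known to vanish. The rescaling is now by `u ^ (2 k + 1)`.
    have hval : ∀ n : ℕ, ∫ x, x ^ (2 * k + 1) / (1 + x ^ 2 / ((n : ℝ) + 1) ^ 2) ∂F =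
        (∫ x : ℝ, x / ((n : ℝ) + 1) / (1 + x ^ 2 / ((n : ℝ) + 1) ^ 2) ∂F) * ((n : ℝ) + 1) *
          (-(((n : ℝ) + 1) ^ 2)) ^ k := by
      intro n
      set u : ℝ := (n : ℝ) + 1 with hu
      have hu0 : 0 < u := by positivity
      have e1 : ∀ x : ℝ, x / u / (1 + x ^ 2 / u ^ 2) = ∑ s ∈ Finset.range k,
          (u⁻¹ * (-(1 / u ^ 2)) ^ s) * x ^ (2 * s + 1) +
            (u⁻¹ * (-(1 / u ^ 2)) ^ k) * (x ^ (2 * k + 1) / (1 + x ^ 2 / u ^ 2)) := by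
        intro x
        rw [div_eq_mul_one_div (x / u), one_div_one_add_eq (x ^ 2 / u ^ 2) (by positivity) k]
        have : -(x ^ 2 / u ^ 2) = -(1 / u ^ 2) * x ^ 2 := by ring
        simp_rw [this, mul_pow, ← pow_mul]
        rw [mul_add, Finset.mul_sum]
        congr 1
        · exact Finset.sum_congr rfl fun s _ => by ring
        · ring
      simp_rw [e1]
      rw [integral_add (integrable_finsetSum _ fun s hs =>
        ((hoddint s).const_mul _)) ((hint n).const_mul _),
        integral_finsetSum _ fun s hs => ((hoddint s).const_mul _), integral_const_mul]
      have e2 : ∑ s ∈ Finset.range k, ∫ x : ℝ, (u⁻¹ * (-(1 / u ^ 2)) ^ s) * x ^ (2 * s + 1) ∂F = 0 :=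
        Finset.sum_eq_zero fun s hs => by
          rw [integral_const_mul, ih s (Finset.mem_range.1 hs), mul_zero]
      rw [e2]
      have e3 : (-(1 / u ^ 2)) ^ k * (-(u ^ 2)) ^ k = 1 := by
        rw [← mul_pow, show -(1 / u ^ 2) * -(u ^ 2) = 1 by field_simp, one_pow]
      have e4 : u⁻¹ * u = 1 := inv_mul_cancel₀ hu0.ne'
      have e5 : ((-(1 / u ^ 2)) ^ k * (-(u ^ 2)) ^ k) * (u⁻¹ * u) = 1 := by rw [e3, e4, one_mul]
      linear_combination (-(∫ x, x ^ (2 * k + 1) / (1 + x ^ 2 / u ^ 2) ∂F)) * e5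
    simp_rw [hval]
    have hO := ((him (k + 1)).mul (isBigO_refl (fun n : ℕ => (n : ℝ) + 1) atTop)).mul
      (isBigO_refl (fun n : ℕ => (-(((n : ℝ) + 1) ^ 2)) ^ k) atTop)
    refine hO.trans_tendsto ?_
    have e4 : ∀ n : ℕ, (1 / ((n : ℝ) + 1) ^ 2) ^ (k + 1) * ((n : ℝ) + 1) *
        (-(((n : ℝ) + 1) ^ 2)) ^ k = (-1) ^ k * (1 / ((n : ℝ) + 1)) := by
      intro n
      rw [neg_pow, pow_succ]
      field_simp
      rw [← mul_pow, one_div_mul_cancel (by positivity), one_pow]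
    simp_rw [e4]
    simpa using hinv.const_mul ((-1) ^ k)
  refine ⟨fun k => ?_, fun s => (heven s).2, hodd⟩
  rcases Nat.even_or_odd' k with ⟨j, rfl | rfl⟩
  · exact (heven j).1
  · exact hoddint j

end MomentExtraction

end ChungLu

namespace ChungLu

/-! ### Resolvents, ranks and eigenvalues of real symmetric matrices. -/

section LinearAlgebra

open Matrix

variable {ι : Type*} [Fintype ι] [DecidableEq ι]

/-- The resolvent `(B - z)⁻¹` of a real matrix at a complex point. -/
noncomputable def matResolvent (B : Matrix ι ι ℝ) (z : ℂ) : Matrix ι ι ℂ :=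
  (B.map (fun x : ℝ => (x : ℂ)) - z • (1 : Matrix ι ι ℂ))⁻¹

lemma eigenvectorUnitary_transpose_mul {B : Matrix ι ι ℝ} (hB : B.IsHermitian) :
    (hB.eigenvectorUnitary : Matrix ι ι ℝ)ᵀ * (hB.eigenvectorUnitary : Matrix ι ι ℝ) = 1 := by
  have := Unitary.coe_star_mul_self hB.eigenvectorUnitary
  rwa [star_eq_conjTranspose, conjTranspose_eq_transpose_of_trivial] at this

lemma eigenvectorUnitary_mul_transpose {B : Matrix ι ι ℝ} (hB : B.IsHermitian) :
    (hB.eigenvectorUnitary : Matrix ι ι ℝ) * (hB.eigenvectorUnitary : Matrix ι ι ℝ)ᵀ = 1 := by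
  have := Unitary.coe_mul_star_self hB.eigenvectorUnitary
  rwa [Unitary.coe_star, star_eq_conjTranspose, conjTranspose_eq_transpose_of_trivial] at this

lemma eq_eigenvectorUnitary_mul_diagonal {B : Matrix ι ι ℝ} (hB : B.IsHermitian) :
    B = (hB.eigenvectorUnitary : Matrix ι ι ℝ) * diagonal hB.eigenvalues *
      (hB.eigenvectorUnitary : Matrix ι ι ℝ)ᵀ := by
  have := hB.spectral_theorem
  rw [Unitary.conjStarAlgAut_apply, star_eq_conjTranspose,
    conjTranspose_eq_transpose_of_trivial] at this
  exact this

lemma sub_smul_one_mul_spectral {B : Matrix ι ι ℝ} (hB : B.IsHermitian) {z : ℂ} (hz : z.im ≠ 0) :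
    (B.map (fun x : ℝ => (x : ℂ)) - z • (1 : Matrix ι ι ℂ)) *
      ((hB.eigenvectorUnitary : Matrix ι ι ℝ).map (fun x : ℝ => (x : ℂ)) *
        diagonal (fun i => ((hB.eigenvalues i : ℂ) - z)⁻¹) *
        ((hB.eigenvectorUnitary : Matrix ι ι ℝ)ᵀ).map (fun x : ℝ => (x : ℂ))) = 1 := by
  set U : Matrix ι ι ℝ := (hB.eigenvectorUnitary : Matrix ι ι ℝ) with hU
  set V : Matrix ι ι ℂ := U.map (fun x : ℝ => (x : ℂ)) with hV
  set W : Matrix ι ι ℂ := (Uᵀ).map (fun x : ℝ => (x : ℂ)) with hW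
  have hWV : W * V = 1 := by
    have := congrArg (fun M : Matrix ι ι ℝ => M.map Complex.ofRealHom)
      (eigenvectorUnitary_transpose_mul hB)
    simp only [Matrix.map_mul, Matrix.map_one _ (map_zero _) (map_one _)] at this
    exact this
  have hVW : V * W = 1 := by
    have := congrArg (fun M : Matrix ι ι ℝ => M.map Complex.ofRealHom)
      (eigenvectorUnitary_mul_transpose hB)
    simp only [Matrix.map_mul, Matrix.map_one _ (map_zero _) (map_one _)] at this
    exact this
  have hBe : B.map (fun x : ℝ => (x : ℂ)) =
      V * diagonal (fun i => (hB.eigenvalues i : ℂ)) * W := by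
    have := congrArg (fun M : Matrix ι ι ℝ => M.map Complex.ofRealHom)
      (eq_eigenvectorUnitary_mul_diagonal hB)
    simp only [Matrix.map_mul, Matrix.diagonal_map (map_zero _)] at this
    exact this
  have hsub : B.map (fun x : ℝ => (x : ℂ)) - z • (1 : Matrix ι ι ℂ) =
      V * diagonal (fun i => (hB.eigenvalues i : ℂ) - z) * W := by
    have h1 : (diagonal fun i => (hB.eigenvalues i : ℂ) - z) =
        diagonal (fun i => (hB.eigenvalues i : ℂ)) - z • (1 : Matrix ι ι ℂ) := by
      rw [Matrix.smul_one_eq_diagonal, diagonal_sub]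
    rw [h1, mul_sub, sub_mul, ← hBe, mul_smul_comm, smul_mul_assoc, mul_one, hVW]
  have hne : ∀ i, (hB.eigenvalues i : ℂ) - z ≠ 0 := by
    intro i h
    apply hz
    have := congrArg Complex.im h
    simpa using this
  rw [hsub]
  calc _ = V * (diagonal (fun i => (hB.eigenvalues i : ℂ) - z) * (W * V) *
        diagonal (fun i => ((hB.eigenvalues i : ℂ) - z)⁻¹)) * W := by simp only [Matrix.mul_assoc]
    _ = 1 := by
      rw [hWV, mul_one, diagonal_mul_diagonal]
      have : (fun i => ((hB.eigenvalues i : ℂ) - z) * ((hB.eigenvalues i : ℂ) - z)⁻¹) =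
        fun _ => 1 := funext fun i => mul_inv_cancel₀ (hne i)
      rw [this, diagonal_one, mul_one, hVW]

lemma sub_mul_matResolvent {B : Matrix ι ι ℝ} (hB : B.IsHermitian) {z : ℂ} (hz : z.im ≠ 0) :
    (B.map (fun x : ℝ => (x : ℂ)) - z • (1 : Matrix ι ι ℂ)) * matResolvent B z = 1 :=
  Matrix.mul_nonsing_inv _ (Matrix.isUnit_det_of_right_inverse (sub_smul_one_mul_spectral hB hz))

lemma matResolvent_mul_sub {B : Matrix ι ι ℝ} (hB : B.IsHermitian) {z : ℂ} (hz : z.im ≠ 0) :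
    matResolvent B z * (B.map (fun x : ℝ => (x : ℂ)) - z • (1 : Matrix ι ι ℂ)) = 1 :=
  Matrix.nonsing_inv_mul _ (Matrix.isUnit_det_of_right_inverse (sub_smul_one_mul_spectral hB hz))

lemma trace_matResolvent {B : Matrix ι ι ℝ} (hB : B.IsHermitian) {z : ℂ} (hz : z.im ≠ 0) :
    ∑ i, matResolvent B z i i = ∑ i, ((hB.eigenvalues i : ℂ) - z)⁻¹ := by
  have h1 := Matrix.inv_eq_right_inv (sub_smul_one_mul_spectral hB hz)
  have h2 : ∑ i, matResolvent B z i i = trace (matResolvent B z) := rfl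
  rw [h2, matResolvent, h1, Matrix.mul_assoc, Matrix.trace_mul_comm, Matrix.mul_assoc]
  have := congrArg (fun M : Matrix ι ι ℝ => M.map Complex.ofRealHom)
      (eigenvectorUnitary_transpose_mul hB)
  simp only [Matrix.map_mul, Matrix.map_one _ (map_zero _) (map_one _)] at this
  have h3 : ((hB.eigenvectorUnitary : Matrix ι ι ℝ)ᵀ).map (fun x : ℝ => (x : ℂ)) *
    (hB.eigenvectorUnitary : Matrix ι ι ℝ).map (fun x : ℝ => (x : ℂ)) = 1 := this
  rw [h3, mul_one, trace_diagonal]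

lemma transpose_matResolvent {B : Matrix ι ι ℝ} (hB : B.IsHermitian) (z : ℂ) :
    (matResolvent B z)ᵀ = matResolvent B z := by
  have hBt : Bᵀ = B := by rwa [IsHermitian, conjTranspose_eq_transpose_of_trivial] at hB
  rw [matResolvent, Matrix.transpose_nonsing_inv, Matrix.transpose_sub, Matrix.transpose_smul,
    Matrix.transpose_one, ← Matrix.transpose_map, hBt]

lemma matResolvent_symm {B : Matrix ι ι ℝ} (hB : B.IsHermitian) (z : ℂ) (i j : ι) :
    matResolvent B z i j = matResolvent B z j i := by
  conv_lhs => rw [← transpose_matResolvent hB z]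
  rfl

lemma matResolvent_sub {A B : Matrix ι ι ℝ} (hA : A.IsHermitian) (hB : B.IsHermitian) {z : ℂ}
    (hz : z.im ≠ 0) : matResolvent A z - matResolvent B z =
      -(matResolvent A z * (A - B).map (fun x : ℝ => (x : ℂ)) * matResolvent B z) := by
  have h1 : (A - B).map (fun x : ℝ => (x : ℂ)) =
      (A.map (fun x : ℝ => (x : ℂ)) - z • (1 : Matrix ι ι ℂ)) -
        (B.map (fun x : ℝ => (x : ℂ)) - z • (1 : Matrix ι ι ℂ)) := by
    ext i j
    simp
  rw [h1, mul_sub, sub_mul, matResolvent_mul_sub hA hz, one_mul, Matrix.mul_assoc,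
    sub_mul_matResolvent hB hz, mul_one]
  abel

/-- Ward identity: the diagonal entry of `G - Gᴴ = (z - z̄) G Gᴴ`. It makes a whole row of `G`
square summable with a bound independent of the dimension. -/
lemma sum_norm_sq_matResolvent {B : Matrix ι ι ℝ} (hB : B.IsHermitian) {z : ℂ} (hz : 0 < z.im)
    (i : ι) : z.im * ∑ j, ‖matResolvent B z i j‖ ^ 2 = (matResolvent B z i i).im := by
  set G := matResolvent B z with hG
  set M := B.map (fun x : ℝ => (x : ℂ)) - z • (1 : Matrix ι ι ℂ) with hM
  have h1 : M * G = 1 := sub_mul_matResolvent hB hz.ne'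
  have h2 : G * M = 1 := matResolvent_mul_sub hB hz.ne'
  have hBt : Bᵀ = B := by rwa [IsHermitian, conjTranspose_eq_transpose_of_trivial] at hB
  have h3 : Mᴴ = M + (z - (starRingEnd ℂ) z) • (1 : Matrix ι ι ℂ) := by
    ext a b
    have : B b a = B a b := congrFun (congrFun hBt a) b
    by_cases hab : a = b
    · subst hab
      simp [hM, Matrix.conjTranspose_apply]
    · simp [hM, Matrix.conjTranspose_apply, this, hab, Ne.symm hab]
  have h4 : Mᴴ * Gᴴ = 1 := by
    rw [← Matrix.conjTranspose_mul, h2, Matrix.conjTranspose_one]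
  have h5 : G - Gᴴ = (z - (starRingEnd ℂ) z) • (G * Gᴴ) := by
    have : G * Mᴴ * Gᴴ = G := by rw [Matrix.mul_assoc, h4, mul_one]
    rw [h3, mul_add, h2, add_mul, one_mul, mul_smul_comm, mul_one, smul_mul_assoc] at this
    rw [sub_eq_iff_eq_add, add_comm]
    exact this.symm
  have h6 := congrArg Complex.im (congrFun (congrFun h5 i) i)
  have h7 : (G * Gᴴ) i i = ((∑ j, ‖G i j‖ ^ 2 : ℝ) : ℂ) := by
    rw [Matrix.mul_apply]
    push_cast
    refine Finset.sum_congr rfl fun j _ => ?_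
    rw [Matrix.conjTranspose_apply]
    exact Complex.mul_conj' _
  rw [Matrix.smul_apply, h7, smul_eq_mul, Complex.sub_conj, Complex.mul_im] at h6
  rw [Complex.ofReal_re, Complex.ofReal_im] at h6
  simp only [Matrix.sub_apply, Matrix.conjTranspose_apply, Complex.sub_im, RCLike.star_def,
    Complex.conj_im, Complex.mul_im, Complex.ofReal_re, Complex.ofReal_im, Complex.I_re,
    Complex.I_im] at h6
  linarith

/-- Keeping one term of the Ward identity gives `Im z · |G_ii|² ≤ Im G_ii ≤ |G_ii|`. -/
lemma norm_matResolvent_diag_le {B : Matrix ι ι ℝ} (hB : B.IsHermitian) {z : ℂ} (hz : 0 < z.im)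
    (i : ι) : ‖matResolvent B z i i‖ ≤ 1 / z.im := by
  have h1 := sum_norm_sq_matResolvent hB hz i
  have h2 : ‖matResolvent B z i i‖ ^ 2 ≤ ∑ j, ‖matResolvent B z i j‖ ^ 2 :=
    Finset.single_le_sum (f := fun j => ‖matResolvent B z i j‖ ^ 2) (fun _ _ => by positivity)
      (Finset.mem_univ i)
  have h3 := (le_abs_self _).trans (Complex.abs_im_le_norm (matResolvent B z i i))
  rw [le_div_iff₀ hz]
  by_contra hcon
  push Not at hcon
  have h4 : 0 < ‖matResolvent B z i i‖ := by
    by_contra h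
    have : ‖matResolvent B z i i‖ = 0 := le_antisymm (not_lt.1 h) (norm_nonneg _)
    rw [this] at hcon
    linarith
  nlinarith

lemma sum_norm_sq_matResolvent_le {B : Matrix ι ι ℝ} (hB : B.IsHermitian) {z : ℂ} (hz : 0 < z.im)
    (i : ι) : ∑ j, ‖matResolvent B z i j‖ ^ 2 ≤ (1 / z.im) ^ 2 := by
  have h1 := sum_norm_sq_matResolvent hB hz i
  have h3 := (le_abs_self _).trans (Complex.abs_im_le_norm (matResolvent B z i i))
  have h4 := norm_matResolvent_diag_le hB hz i
  have h5 : z.im * ∑ j, ‖matResolvent B z i j‖ ^ 2 ≤ 1 / z.im := by linarith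
  rw [mul_comm, ← le_div_iff₀ hz] at h5
  calc _ ≤ _ := h5
    _ = _ := by ring

lemma norm_matResolvent_le {B : Matrix ι ι ℝ} (hB : B.IsHermitian) {z : ℂ} (hz : 0 < z.im)
    (i j : ι) : ‖matResolvent B z i j‖ ≤ 1 / z.im := by
  have h1 := sum_norm_sq_matResolvent_le hB hz i
  have h2 : ‖matResolvent B z i j‖ ^ 2 ≤ ∑ j, ‖matResolvent B z i j‖ ^ 2 :=
    Finset.single_le_sum (f := fun j => ‖matResolvent B z i j‖ ^ 2) (fun _ _ => by positivity)
      (Finset.mem_univ j)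
  exact le_of_sq_le_sq (h2.trans h1) (by positivity)

lemma dotProduct_mulVec_eq_sum {B : Matrix ι ι ℝ} (hB : B.IsHermitian) (v : ι → ℝ) :
    v ⬝ᵥ (B *ᵥ v) = ∑ i, hB.eigenvalues i *
      (((hB.eigenvectorUnitary : Matrix ι ι ℝ)ᵀ *ᵥ v) i) ^ 2 := by
  conv_lhs => rw [eq_eigenvectorUnitary_mul_diagonal hB]
  rw [← Matrix.mulVec_mulVec, ← Matrix.mulVec_mulVec, Matrix.dotProduct_mulVec,
    ← Matrix.mulVec_transpose]
  simp only [dotProduct, Matrix.mulVec_diagonal]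
  exact Finset.sum_congr rfl fun i _ => by ring

lemma dotProduct_self_eq_sum {B : Matrix ι ι ℝ} (hB : B.IsHermitian) (v : ι → ℝ) :
    v ⬝ᵥ v = ∑ i, (((hB.eigenvectorUnitary : Matrix ι ι ℝ)ᵀ *ᵥ v) i) ^ 2 := by
  have h : v = (hB.eigenvectorUnitary : Matrix ι ι ℝ) *ᵥ
      ((hB.eigenvectorUnitary : Matrix ι ι ℝ)ᵀ *ᵥ v) := by
    rw [Matrix.mulVec_mulVec, eigenvectorUnitary_mul_transpose, Matrix.one_mulVec]
  conv_lhs => arg 2; rw [h]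
  rw [Matrix.dotProduct_mulVec, ← Matrix.mulVec_transpose]
  simp only [dotProduct]
  exact Finset.sum_congr rfl fun i _ => by ring

/-- The rank inequality for the eigenvalue counting functions of symmetric matrices. -/
lemma card_eigenvalues_le_add_rank {A B : Matrix ι ι ℝ} (hA : A.IsHermitian) (hB : B.IsHermitian)
    (x : ℝ) : Fintype.card {i // hA.eigenvalues i ≤ x} ≤
      Fintype.card {i // hB.eigenvalues i ≤ x} + (A - B).rank := by
  by_contra hcon
  push Not at hcon
  -- A kernel vector lies in the span of the eigenvectors of `A` with eigenvalue at most `x`, in the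
  -- span of those of `B` with eigenvalue above `x`, and in the kernel of `A - B`. If the inequality
  -- failed, the target would have too small a dimension and such a nonzero vector would exist; the
  -- two quadratic forms then disagree on it.
  let T : (ι → ℝ) →ₗ[ℝ] ({i // ¬ hA.eigenvalues i ≤ x} → ℝ) × ({i // hB.eigenvalues i ≤ x} → ℝ) ×
      LinearMap.range (A - B).mulVecLin :=
    LinearMap.prod
      ((LinearMap.funLeft ℝ ℝ Subtype.val).comp
        ((hA.eigenvectorUnitary : Matrix ι ι ℝ)ᵀ).mulVecLin)
      (LinearMap.prod ((LinearMap.funLeft ℝ ℝ Subtype.val).comp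
        ((hB.eigenvectorUnitary : Matrix ι ι ℝ)ᵀ).mulVecLin) (A - B).mulVecLin.rangeRestrict)
  have hdim : Module.finrank ℝ (({i // ¬ hA.eigenvalues i ≤ x} → ℝ) ×
      ({i // hB.eigenvalues i ≤ x} → ℝ) × LinearMap.range (A - B).mulVecLin) <
      Module.finrank ℝ (ι → ℝ) := by
    rw [Module.finrank_prod, Module.finrank_prod, Module.finrank_fintype_fun_eq_card,
      Module.finrank_fintype_fun_eq_card, Module.finrank_fintype_fun_eq_card,
      Fintype.card_subtype_compl]
    have h1 : Fintype.card {i // hA.eigenvalues i ≤ x} ≤ Fintype.card ι :=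
      Fintype.card_subtype_le _
    have h2 : Module.finrank ℝ (LinearMap.range (A - B).mulVecLin) = (A - B).rank := rfl
    omega
  obtain ⟨v, hv, hv0⟩ := (Submodule.ne_bot_iff _).1 (LinearMap.ker_ne_bot_of_finrank_lt (f := T) hdim)
  rw [LinearMap.mem_ker] at hv
  have hc : ∀ i, ¬ hA.eigenvalues i ≤ x → ((hA.eigenvectorUnitary : Matrix ι ι ℝ)ᵀ *ᵥ v) i = 0 :=
    fun i hi => congrFun (congrArg Prod.fst hv) ⟨i, hi⟩
  have hd : ∀ i, hB.eigenvalues i ≤ x → ((hB.eigenvectorUnitary : Matrix ι ι ℝ)ᵀ *ᵥ v) i = 0 :=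
    fun i hi => congrFun (congrArg (fun p => p.2.1) hv) ⟨i, hi⟩
  have hk : (A - B) *ᵥ v = 0 := congrArg (fun p => (p.2.2 : ι → ℝ)) hv
  have hAB : A *ᵥ v = B *ᵥ v := by
    rw [Matrix.sub_mulVec] at hk
    exact sub_eq_zero.1 hk
  have e1 : v ⬝ᵥ (A *ᵥ v) ≤ x * (v ⬝ᵥ v) := by
    rw [dotProduct_mulVec_eq_sum hA, dotProduct_self_eq_sum hA, Finset.mul_sum]
    refine Finset.sum_le_sum fun i _ => ?_
    by_cases hi : hA.eigenvalues i ≤ x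
    · gcongr
    · rw [hc i hi]
      simp
  have e2 : x * (v ⬝ᵥ v) < v ⬝ᵥ (B *ᵥ v) := by
    have hpos : 0 < v ⬝ᵥ v := by
      have := dotProduct_star_self_pos_iff (v := v)
      simpa using this.2 hv0
    have hpos' := hpos
    rw [dotProduct_self_eq_sum hB] at hpos'
    obtain ⟨i, -, hi⟩ : ∃ i ∈ Finset.univ,
        0 < (((hB.eigenvectorUnitary : Matrix ι ι ℝ)ᵀ *ᵥ v) i) ^ 2 := by
      by_contra hno
      push Not at hno
      exact absurd hpos' (not_lt.2 (Finset.sum_nonpos hno))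
    rw [dotProduct_mulVec_eq_sum hB, dotProduct_self_eq_sum hB, Finset.mul_sum]
    refine Finset.sum_lt_sum (fun j _ => ?_) ⟨i, Finset.mem_univ i, ?_⟩
    · by_cases hj : hB.eigenvalues j ≤ x
      · rw [hd j hj]
        simp
      · push Not at hj
        gcongr
    · have : ¬ hB.eigenvalues i ≤ x := by
        intro h
        rw [hd i h] at hi
        simp at hi
      push Not at this
      exact mul_lt_mul_of_pos_right this hi
  rw [hAB] at e1
  linarith

/-- A matrix supported on row and column `k` factors through dimension two: `e_k` times the row,
plus the rest of the column times `e_kᵀ`. -/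
lemma rank_le_two_of_cross {A : Matrix ι ι ℝ} (k : ι) (h : ∀ i j, i ≠ k → j ≠ k → A i j = 0) :
    A.rank ≤ 2 := by
  have : A = (Matrix.of fun i (b : Fin 2) => if b = 0 then (if i = k then 1 else 0) else
      (if i = k then 0 else A i k)) *
      (Matrix.of fun (b : Fin 2) j => if b = 0 then A k j else (if j = k then 1 else 0)) := by
    ext i j
    rw [Matrix.mul_apply, Fin.sum_univ_two]
    by_cases hi : i = k
    · subst hi
      simp
    · by_cases hj : j = k
      · subst hj
        simp [hi]
      · simp [hi, hj, h i j hi hj]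
  rw [this]
  exact ((Matrix.rank_mul_le_left _ _).trans (Matrix.rank_le_card_width _)).trans_eq
    (Fintype.card_fin 2)

lemma sum_sq_eigenvalues {B : Matrix ι ι ℝ} (hB : B.IsHermitian) :
    ∑ i, hB.eigenvalues i ^ 2 = ∑ i, ∑ j, B i j ^ 2 := by
  have hBt : Bᵀ = B := by rwa [IsHermitian, conjTranspose_eq_transpose_of_trivial] at hB
  have h1 : trace (B * B) = ∑ i, ∑ j, B i j ^ 2 := by
    simp only [trace, diag_apply, Matrix.mul_apply]
    refine Finset.sum_congr rfl fun i _ => Finset.sum_congr rfl fun j _ => ?_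
    rw [show B j i = B i j from congrFun (congrFun hBt i) j, sq]
  rw [← h1]
  have h2 : B * B = (hB.eigenvectorUnitary : Matrix ι ι ℝ) *
      (diagonal hB.eigenvalues * ((hB.eigenvectorUnitary : Matrix ι ι ℝ)ᵀ *
        (hB.eigenvectorUnitary : Matrix ι ι ℝ)) * diagonal hB.eigenvalues) *
      (hB.eigenvectorUnitary : Matrix ι ι ℝ)ᵀ := by
    conv_lhs => rw [eq_eigenvectorUnitary_mul_diagonal hB]
    simp only [Matrix.mul_assoc]
  rw [h2, eigenvectorUnitary_transpose_mul, mul_one, diagonal_mul_diagonal, Matrix.trace_mul_comm,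
    ← Matrix.mul_assoc, eigenvectorUnitary_transpose_mul, one_mul, trace_diagonal]
  exact Finset.sum_congr rfl fun i _ => sq _

end LinearAlgebra

end ChungLu

namespace ChungLu

/-! ### Concentration on finite product spaces. -/

section Concentration

/-- Hoeffding's lemma: on a finite space `h` attains its minimum and so lies in an interval of
length `c`, giving variance proxy `(c / 2) ^ 2`. -/
lemma integral_exp_sub_integral_le {α : Type*} [Finite α] [MeasurableSpace α]
    [MeasurableSingletonClass α] (μ : Measure α) [IsProbabilityMeasure μ] (h : α → ℝ) (c : ℝ)
    (hc : 0 ≤ c) (hh : ∀ x y, |h x - h y| ≤ c) (t : ℝ) :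
    ∫ x, Real.exp (t * (h x - ∫ y, h y ∂μ)) ∂μ ≤ Real.exp (t ^ 2 * c ^ 2 / 8) := by
  have hne : Nonempty α := by
    by_contra hcon
    rw [not_nonempty_iff] at hcon
    have h0 := measure_univ (μ := μ)
    rw [Set.univ_eq_empty_iff.2 hcon, measure_empty] at h0
    exact zero_ne_one h0
  obtain ⟨x₀, hx₀⟩ := Finite.exists_min h
  have hmem : ∀ᵐ x ∂μ, h x ∈ Set.Icc (h x₀) (h x₀ + c) := ae_of_all _ fun x =>
    ⟨hx₀ x, by linarith [(le_abs_self _).trans (hh x x₀)]⟩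
  have := (hasSubgaussianMGF_of_mem_Icc (μ := μ) (X := h)
    (measurable_of_finite h).aemeasurable hmem).mgf_le t
  rw [mgf] at this
  refine this.trans (le_of_eq ?_)
  congr 1
  simp only [add_sub_cancel_left, NNReal.coe_pow, NNReal.coe_div, coe_nnnorm, NNReal.coe_ofNat,
    Real.norm_of_nonneg hc]
  ring

/-- Bounded differences inequality for functions of blocks of independent coordinates. -/
lemma integral_exp_le_of_bounded_differences (n : ℕ) :
    ∀ {ι : Type} [Fintype ι] (μ : ι → Measure Bool) [∀ i, IsProbabilityMeasure (μ i)] (r : ι → ℕ)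
      (_ : ∀ i, r i < n) (c : ℕ → ℝ) (_ : ∀ k, 0 ≤ c k) (f : (ι → Bool) → ℝ)
      (_ : ∀ k x y, (∀ i, r i ≠ k → x i = y i) → |f x - f y| ≤ c k) (t : ℝ),
      ∫ x, Real.exp (t * (f x - ∫ y, f y ∂(Measure.pi μ))) ∂(Measure.pi μ) ≤
        Real.exp (t ^ 2 * (∑ k ∈ Finset.range n, c k ^ 2) / 8) := by
  induction n with
  | zero =>
    intro ι _ μ _ r hr c _ f _ t
    have hem : IsEmpty ι := ⟨fun i => absurd (hr i) (Nat.not_lt_zero _)⟩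
    have hf : ∀ x, f x = f default := fun x => congrArg f (Subsingleton.elim _ _)
    simp_rw [hf]
    simp
  | succ n ih =>
    intro ι _ μ _ r hr c hc f hf t
    classical
    -- The last block is split off. Given its coordinates, the induction hypothesis handles the
    -- other blocks around the conditional mean `h`; Hoeffding's lemma handles `h`, whose
    -- oscillation is at most `c n`.
    let p : ι → Prop := fun i => r i = n
    let e := MeasurableEquiv.piEquivPiSubtypeProd (fun _ : ι => Bool) p
    have he := (measurePreserving_piEquivPiSubtypeProd (α := fun _ : ι => Bool) μ p)
    set μ₁ := Measure.pi fun i : Subtype p => μ i with hμ₁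
    set μ₂ := Measure.pi fun i : {i // ¬ p i} => μ i with hμ₂
    let g : (Subtype p → Bool) → ({i // ¬ p i} → Bool) → ℝ := fun x y => f (e.symm (x, y))
    have hsymm_pos : ∀ x y i (hi : p i), e.symm (x, y) i = x ⟨i, hi⟩ := fun x y i hi => by
      simp [e, MeasurableEquiv.piEquivPiSubtypeProd, Equiv.piEquivPiSubtypeProd, hi]
    have hsymm_neg : ∀ x y i (hi : ¬ p i), e.symm (x, y) i = y ⟨i, hi⟩ := fun x y i hi => by
      simp [e, MeasurableEquiv.piEquivPiSubtypeProd, Equiv.piEquivPiSubtypeProd, hi]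
    have hint : ∀ φ : (ι → Bool) → ℝ, ∫ x, φ x ∂(Measure.pi μ) =
        ∫ x, ∫ y, φ (e.symm (x, y)) ∂μ₂ ∂μ₁ := by
      intro φ
      rw [← integral_prod (fun z => φ (e.symm z)) Integrable.of_finite, ← he.integral_comp']
      simp only [e, MeasurableEquiv.symm_apply_apply]
    set h : (Subtype p → Bool) → ℝ := fun x => ∫ y, g x y ∂μ₂ with hh
    have hEf : ∫ y, f y ∂(Measure.pi μ) = ∫ x, h x ∂μ₁ := hint f
    have hdiff : ∀ x x', |h x - h x'| ≤ c n := by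
      intro x x'
      simp only [hh]
      rw [← integral_sub Integrable.of_finite Integrable.of_finite]
      refine (abs_integral_le_integral_abs).trans ?_
      have : ∫ y, |g x y - g x' y| ∂μ₂ ≤ ∫ _, c n ∂μ₂ := by
        refine integral_mono Integrable.of_finite Integrable.of_finite fun y => ?_
        refine hf n _ _ fun i hi => ?_
        rw [hsymm_neg x y i hi, hsymm_neg x' y i hi]
      simpa using this
    have hinner : ∀ x, ∫ y, Real.exp (t * (g x y - h x)) ∂μ₂ ≤
        Real.exp (t ^ 2 * (∑ k ∈ Finset.range n, c k ^ 2) / 8) := by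
      intro x
      refine ih (fun i : {i // ¬ p i} => μ i) (fun i => r i) (fun i => ?_) c hc (g x) ?_ t
      · have h1 := hr i.1
        have h2 : r i.1 ≠ n := i.2
        omega
      · intro k y y' hy
        refine hf k _ _ fun i hi => ?_
        by_cases hpi : p i
        · rw [hsymm_pos x y i hpi, hsymm_pos x y' i hpi]
        · rw [hsymm_neg x y i hpi, hsymm_neg x y' i hpi]
          exact hy ⟨i, hpi⟩ hi
    rw [hint, hEf]
    have hstep : ∀ x, ∫ y, Real.exp (t * (f (e.symm (x, y)) - ∫ x, h x ∂μ₁)) ∂μ₂ ≤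
        Real.exp (t ^ 2 * (∑ k ∈ Finset.range n, c k ^ 2) / 8) *
          Real.exp (t * (h x - ∫ x, h x ∂μ₁)) := by
      intro x
      have : ∀ y, Real.exp (t * (f (e.symm (x, y)) - ∫ x, h x ∂μ₁)) =
          Real.exp (t * (g x y - h x)) * Real.exp (t * (h x - ∫ x, h x ∂μ₁)) := by
        intro y
        rw [← Real.exp_add]
        congr 1
        ring
      simp_rw [this]
      rw [integral_mul_const]
      exact mul_le_mul_of_nonneg_right (hinner x) (Real.exp_pos _).le
    refine (integral_mono Integrable.of_finite Integrable.of_finite hstep).trans ?_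
    rw [integral_const_mul]
    refine (mul_le_mul_of_nonneg_left
      (integral_exp_sub_integral_le μ₁ h (c n) (hc n) hdiff t) (Real.exp_pos _).le).trans ?_
    rw [← Real.exp_add, Finset.sum_range_succ]
    refine le_of_eq (congrArg _ ?_)
    ring

variable {ι : Type} [Fintype ι] (μ : ι → Measure Bool) [∀ i, IsProbabilityMeasure (μ i)]

/-- Integrate `|u| ≤ e^u + e^(-u)` at `u = (f - 𝔼 f) / σ`. Each exponential moment is at most
`e^(1/8) < 3`, whence the constant `6`. -/
lemma integral_abs_sub_integral_le (n : ℕ) (r : ι → ℕ)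
    (hr : ∀ i, r i < n) (c : ℝ) (hc : 0 ≤ c) (f : (ι → Bool) → ℝ)
    (hf : ∀ k x y, (∀ i, r i ≠ k → x i = y i) → |f x - f y| ≤ c) (σ : ℝ) (hσ : 0 < σ)
    (hσc : n * c ^ 2 ≤ σ ^ 2) :
    ∫ x, |f x - ∫ y, f y ∂(Measure.pi μ)| ∂(Measure.pi μ) ≤ 6 * σ := by
  have hb := fun t => integral_exp_le_of_bounded_differences n μ r hr (fun _ => c) (fun _ => hc) f hf t
  simp only [Finset.sum_const, Finset.card_range, nsmul_eq_mul] at hb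
  set E := ∫ y, f y ∂(Measure.pi μ) with hE
  have hle : ∀ t : ℝ, t ^ 2 = (1 / σ) ^ 2 → ∫ x, Real.exp (t * (f x - E)) ∂(Measure.pi μ) ≤ 3 := by
    intro t ht
    refine (hb t).trans ?_
    have h1 : t ^ 2 * (n * c ^ 2) / 8 ≤ 1 := by
      rw [ht]
      have : (1 / σ) ^ 2 * (n * c ^ 2) ≤ (1 / σ) ^ 2 * σ ^ 2 := by gcongr
      rw [← mul_pow, one_div_mul_cancel hσ.ne'] at this
      linarith
    exact (Real.exp_le_exp.2 h1).trans Real.exp_one_lt_three.le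
  have hpt : ∀ x, |f x - E| ≤ σ * (Real.exp (1 / σ * (f x - E)) + Real.exp (-(1 / σ) * (f x - E))) := by
    intro x
    have h2 : |1 / σ * (f x - E)| ≤
        Real.exp (1 / σ * (f x - E)) + Real.exp (-(1 / σ) * (f x - E)) := by
      have h3 := Real.add_one_le_exp (1 / σ * (f x - E))
      have h4 := Real.add_one_le_exp (-(1 / σ) * (f x - E))
      have h5 := Real.exp_pos (1 / σ * (f x - E))
      have h6 := Real.exp_pos (-(1 / σ) * (f x - E))
      rw [abs_le]
      constructor <;> linarith
    rw [abs_mul, abs_of_pos (by positivity : 0 < 1 / σ), one_div_mul_eq_div, div_le_iff₀ hσ] at h2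
    linarith
  refine (integral_mono Integrable.of_finite Integrable.of_finite hpt).trans ?_
  rw [integral_const_mul, integral_add Integrable.of_finite Integrable.of_finite]
  have h7 := hle (1 / σ) rfl
  have h8 := hle (-(1 / σ)) (by ring)
  nlinarith

lemma measure_abs_sub_integral_ge_le (n : ℕ) (hn : 0 < n) (r : ι → ℕ)
    (hr : ∀ i, r i < n) (c : ℝ) (hc : 0 < c) (f : (ι → Bool) → ℝ)
    (hf : ∀ k x y, (∀ i, r i ≠ k → x i = y i) → |f x - f y| ≤ c) (δ : ℝ) (hδ : 0 < δ) :
    (Measure.pi μ).real {x | δ ≤ |f x - ∫ y, f y ∂(Measure.pi μ)|} ≤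
      2 * Real.exp (-(2 * δ ^ 2 / (n * c ^ 2))) := by
  have hb := fun t => integral_exp_le_of_bounded_differences n μ r hr (fun _ => c) (fun _ => hc.le) f hf t
  simp only [Finset.sum_const, Finset.card_range, nsmul_eq_mul] at hb
  set E := ∫ y, f y ∂(Measure.pi μ) with hE
  have hn' : (0 : ℝ) < n := by exact_mod_cast hn
  set V : ℝ := n * c ^ 2 with hV
  have hV0 : 0 < V := by positivity
  -- The choice `t = ± 4 δ / V` minimises the Chernoff exponent `t² V / 8 - |t| δ`, with value `-2
  -- δ² / V`.
  have hone : ∀ t : ℝ, t ^ 2 = (4 * δ / V) ^ 2 →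
      (Measure.pi μ).real {x | Real.exp (4 * δ ^ 2 / V) ≤ Real.exp (t * (f x - E))} ≤
      Real.exp (-(2 * δ ^ 2 / V)) := by
    intro t ht
    have h1 := mul_meas_ge_le_integral_of_nonneg (μ := Measure.pi μ)
      (f := fun x => Real.exp (t * (f x - E))) (ae_of_all _ fun x => (Real.exp_pos _).le)
      Integrable.of_finite (Real.exp (4 * δ ^ 2 / V))
    have h2 := h1.trans (hb t)
    rw [ht, mul_comm, ← le_div_iff₀ (Real.exp_pos _), ← Real.exp_sub] at h2
    refine h2.trans (le_of_eq (congrArg _ ?_))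
    field_simp
    ring
  have hsub : {x | δ ≤ |f x - E|} ⊆
      {x | Real.exp (4 * δ ^ 2 / V) ≤ Real.exp (4 * δ / V * (f x - E))} ∪
      {x | Real.exp (4 * δ ^ 2 / V) ≤ Real.exp (-(4 * δ / V) * (f x - E))} := by
    intro x hx
    simp only [Set.mem_ofPred_eq, Set.mem_union, Real.exp_le_exp] at *
    have h3 : 4 * δ ^ 2 / V = 4 * δ / V * δ := by ring
    have h4 : 0 < 4 * δ / V := by positivity
    rw [h3]
    rcases le_abs.1 hx with h | h
    · left
      exact mul_le_mul_of_nonneg_left h h4.le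
    · right
      rw [neg_mul, ← mul_neg]
      exact mul_le_mul_of_nonneg_left h h4.le
  refine (measureReal_mono hsub).trans ((measureReal_union_le _ _).trans ?_)
  have h5 := hone _ rfl
  have h6 := hone (-(4 * δ / V)) (by ring)
  linarith

lemma integral_mul_of_update_eq [DecidableEq ι] (e : ι) (φ : Bool → ℂ) (H : (ι → Bool) → ℂ)
    (hH : ∀ c y, H (Function.update c e y) = H c) :
    ∫ c, φ (c e) * H c ∂(Measure.pi μ) = (∫ y, φ y ∂(μ e)) * ∫ c, H c ∂(Measure.pi μ) := by
  have hind : iIndepFun (fun (i : ι) (c : ι → Bool) => c i) (Measure.pi μ) :=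
    iIndepFun_pi (X := fun _ => id) fun i => aemeasurable_id
  have h1 := hind.indepFun_finset {e} (Finset.univ \ {e}) Finset.disjoint_sdiff
    fun i => measurable_pi_apply i
  have h2 := h1.integral_fun_comp_mul_comp (𝕜 := ℂ)
    (f := fun x => φ (x ⟨e, Finset.mem_singleton_self e⟩))
    -- The value `true` placed at the missing coordinate is arbitrary, as `H` does not depend on it.
    (g := fun y => H fun i => if hi : i ∈ Finset.univ \ {e} then y ⟨i, hi⟩ else true)
    (measurable_of_finite _).aemeasurable (measurable_of_finite _).aemeasurable
    .of_discrete .of_discrete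
  have h3 : ∀ c : ι → Bool, H (fun i => if i ∈ Finset.univ \ {e} then c i else true) = H c := by
    intro c
    rw [← hH c true]
    congr 1
    ext i
    by_cases hi : i = e
    · subst hi
      simp
    · simp [hi]
  simp only [dite_eq_ite, h3] at h2
  rw [h2]
  congr 1
  exact integral_comp_eval (μ := μ) (i := e) (f := φ) .of_discrete

end Concentration

end ChungLu

namespace ChungLu

/-! ### Asymptotic solution of the limiting moment equations. -/

section StieltjesExpansion

/-- The even moments of the limit law, including the zeroth one. -/
noncomputable def limitMoment (Λ : ℕ → ℝ) (s : ℕ) : ℝ :=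
  if s = 0 then 1 else evenMoment Λ s

/-- Solutions of the limiting system of moment equations for the diagonal resolvent entries have a
Stieltjes transform with the expansion given by Lagrange inversion. -/
lemma stieltjes_expansion_of_recursion (Λ : ℕ → ℝ) (C : ℝ) (hC : 0 ≤ C) (S : ℝ → ℂ)
    (m : ℝ → ℕ → ℂ) (hS : ∀ η, 1 ≤ η → Complex.I * η * S η + 1 + m η 1 * m η 1 = 0)
    (hrec : ∀ η, 1 ≤ η → ∀ k, Complex.I * η * m η (k + 1) + Λ (k + 1) + m η (k + 2) * m η 1 = 0)
    (hbound : ∀ η, 1 ≤ η → ∀ k, ‖m η k‖ ≤ C ^ k / η) (K : ℕ) :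
    (fun η : ℝ => -(Complex.I * η) * S η -
      ∑ s ∈ Finset.range K, (limitMoment Λ s : ℂ) * ((-(1 / η ^ 2) : ℝ) : ℂ) ^ s) =O[atTop]
        fun η : ℝ => (1 / η ^ 2) ^ K := by
  set t : ℝ → ℂ := fun η => ((-(1 / η ^ 2) : ℝ) : ℂ) with ht
  set τ : ℝ → ℂ := fun η => -(m η 1) / (Complex.I * η) with hτ
  have htnorm : ∀ η, ‖t η‖ = 1 / η ^ 2 := fun η => by
    simp only [ht, Complex.norm_real, norm_neg]
    exact Real.norm_of_nonneg (by positivity)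
  have hz : ∀ η : ℝ, 1 ≤ η → Complex.I * (η : ℂ) ≠ 0 := fun η hη =>
    mul_ne_zero Complex.I_ne_zero (by exact_mod_cast (by linarith : η ≠ 0))
  have htz : ∀ η : ℝ, 1 ≤ η → t η * (Complex.I * η) ^ 2 = 1 := fun η hη => by
    have : (η : ℂ) ≠ 0 := by exact_mod_cast (by linarith : η ≠ 0)
    simp only [ht]
    push_cast
    rw [mul_pow, Complex.I_sq]
    field_simp
  have hmτ : ∀ η : ℝ, 1 ≤ η → m η 1 = -(Complex.I * η) * τ η := fun η hη => by
    simp only [hτ]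
    rw [neg_div, neg_mul_neg, mul_comm, div_mul_cancel₀ _ (hz η hη)]
  have hτnorm : ∀ η : ℝ, 1 ≤ η → ‖τ η‖ ≤ C * (1 / η ^ 2) := fun η hη => by
    simp only [hτ]
    rw [norm_div, norm_neg, norm_mul, Complex.norm_I, one_mul, Complex.norm_real,
      Real.norm_of_nonneg (by linarith), div_le_iff₀ (by linarith)]
    refine (hbound η hη 1).trans (le_of_eq ?_)
    field_simp
  -- With `z = iη` and `m_1 = -z τ`, the recursion reads `m_{k+1} = -Λ_{k+1} / z + τ m_{k+2}`.
  -- Iterating it `K` times shows that `τ` solves `τ = t φ(τ)` up to an explicit remainder of order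
  -- `t ^ (K + 1)`.
  have hiter : ∀ η : ℝ, 1 ≤ η → ∀ K : ℕ, τ η - t η * ∑ k ∈ Finset.range K,
      (Λ (k + 1) : ℂ) * τ η ^ k = -(τ η ^ K * m η (K + 1) / (Complex.I * η)) := by
    intro η hη K
    induction K with
    | zero => simp [hτ, neg_div]
    | succ K ih =>
      rw [Finset.sum_range_succ, mul_add, ← sub_sub, ih]
      have h1 := hrec η hη K
      rw [hmτ η hη] at h1
      have h2 := htz η hη
      have h3 := hz η hη
      set z : ℂ := Complex.I * η with hzdef
      have h4 : t η = (z ^ 2)⁻¹ := eq_inv_of_mul_eq_one_left h2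
      have h5 : (Λ (K + 1) : ℂ) = -z * m η (K + 1) + m η (K + 2) * z * τ η := by
        linear_combination h1
      rw [h4, h5]
      field_simp
      ring
  have htO : ∀ K : ℕ, (fun η => t η ^ K) =O[atTop] fun η : ℝ => (1 / η ^ 2) ^ K := fun K =>
    isBigO_of_le _ fun η => by
      rw [norm_pow, htnorm, Real.norm_of_nonneg (by positivity)]
  have hcoef : ∀ k, PowerSeries.coeff k (offspringSeries Λ) = Λ (k + 1) := fun k => by
    simp [offspringSeries]
  -- One order more than requested, since `τ ^ 2` will be multiplied by `z ^ 2 = 1 / t`.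
  have key := isBigO_pow_sub_lagrange (l := atTop) (offspringSeries Λ) t τ ?_ ?_ (K + 1) 2
  -- This is `-z S = 1 + z² τ²`. The constant `1` is cancelled by the zeroth moment unless `K = 0`,
  -- when nothing is subtracted.
  · have hid : ∀ η : ℝ, 1 ≤ η → -(Complex.I * η) * S η -
        ∑ s ∈ Finset.range K, (limitMoment Λ s : ℂ) * t η ^ s =
        (if K = 0 then 1 else 0) + (Complex.I * η) ^ 2 * (τ η ^ 2 - ∑ n ∈ Finset.range (K + 1),
          (lagrangeCoeff (offspringSeries Λ) 2 n : ℂ) * t η ^ n) := by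
      intro η hη
      have h1 := hS η hη
      rw [hmτ η hη] at h1
      have h2 : ∑ n ∈ Finset.range (K + 1),
          (lagrangeCoeff (offspringSeries Λ) 2 n : ℂ) * t η ^ n =
          t η * (∑ s ∈ Finset.range K, (limitMoment Λ s : ℂ) * t η ^ s -
            (if K = 0 then 0 else 1)) := by
        rw [Finset.sum_range_succ', lagrangeCoeff_zero_right]
        rcases K with _ | K
        · simp
        · rw [Finset.sum_range_succ', Finset.sum_range_succ' (fun s => (limitMoment Λ s : ℂ) * t η ^ s),
            lagrangeCoeff_of_lt _ (by norm_num : 0 + 1 < 2)]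
          simp only [limitMoment, Nat.add_eq_zero_iff, one_ne_zero, and_false, if_false, if_true]
          rw [mul_sub, mul_add, Finset.mul_sum]
          have : ∀ s ∈ Finset.range K, (lagrangeCoeff (offspringSeries Λ) 2 (s + 1 + 1) : ℂ) *
              t η ^ (s + 1 + 1) = t η * ((evenMoment Λ (s + 1) : ℂ) * t η ^ (s + 1)) := by
            intro s _
            rw [evenMoment_eq_lagrangeCoeff Λ (by omega)]
            ring
          rw [Finset.sum_congr rfl this]
          simp
      rw [h2]
      have h3 := htz η hη
      have h4 : (if K = 0 then (1 : ℂ) else 0) = 1 - (if K = 0 then 0 else 1) := by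
        split_ifs <;> simp
      rw [h4]
      linear_combination (-1 : ℂ) * h1 + (∑ s ∈ Finset.range K, (limitMoment Λ s : ℂ) * t η ^ s -
            (if K = 0 then 0 else 1)) * h3
    have hev : (fun η : ℝ => -(Complex.I * η) * S η -
        ∑ s ∈ Finset.range K, (limitMoment Λ s : ℂ) * t η ^ s) =ᶠ[atTop]
        fun η : ℝ => (if K = 0 then 1 else 0) + (Complex.I * η) ^ 2 *
          (τ η ^ 2 - ∑ n ∈ Finset.range (K + 1),
          (lagrangeCoeff (offspringSeries Λ) 2 n : ℂ) * t η ^ n) :=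
      (eventually_ge_atTop 1).mono hid
    refine hev.trans_isBigO (IsBigO.add ?_ ?_)
    · rcases K with _ | K
      · simpa using isBigO_refl (fun _ : ℝ => (1 : ℂ)) atTop
      · simpa using isBigO_zero _ _
    · have h1 := (isBigO_refl (fun η : ℝ => (Complex.I * (η : ℂ)) ^ 2) atTop).mul key
      refine h1.trans (IsBigO.trans (EventuallyEq.isBigO ?_) (htO K))
      filter_upwards [eventually_ge_atTop 1] with η hη
      have := htz η hη
      linear_combination (t η ^ K) * this
  · refine IsBigO.of_bound C ((eventually_ge_atTop 1).mono fun η hη => ?_)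
    refine (hτnorm η hη).trans ?_
    simp only [norm_one, mul_one]
    refine mul_le_of_le_one_right hC ?_
    rw [div_le_one (by positivity)]
    nlinarith
  · intro L
    simp_rw [hcoef]
    refine IsBigO.of_bound (C ^ L * C ^ (L + 1)) ((eventually_ge_atTop 1).mono fun η hη => ?_)
    rw [hiter η hη L, norm_neg, norm_div, norm_mul, norm_pow, norm_pow, htnorm, norm_mul,
      Complex.norm_I, one_mul, Complex.norm_real, Real.norm_of_nonneg (by linarith : 0 ≤ η)]
    have h1 := hτnorm η hη
    have h2 := hbound η hη (L + 1)
    calc ‖τ η‖ ^ L * ‖m η (L + 1)‖ / η ≤ (C * (1 / η ^ 2)) ^ L * (C ^ (L + 1) / η) / η := by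
          gcongr
      _ = C ^ L * C ^ (L + 1) * (1 / η ^ 2) ^ (L + 1) := by
          rw [mul_pow, pow_succ (1 / η ^ 2)]
          field_simp

end StieltjesExpansion

/-! ### Perturbation of a symmetric matrix in one pair of entries. -/

section ResolventEquation

open Matrix

/-- The symmetric matrix with a prescribed entry for every unordered pair of indices. -/
def symMatrix {n : ℕ} (b : Sym2 (Fin n) → ℝ) : Matrix (Fin n) (Fin n) ℝ :=
  Matrix.of fun i j => b s(i, j)

lemma symMatrix_isHermitian {n : ℕ} (b : Sym2 (Fin n) → ℝ) : (symMatrix b).IsHermitian := by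
  ext i j
  simp [symMatrix, Sym2.eq_swap]

/-- Changing one unordered pair changes the two positions `(i, j)` and `(j, i)`, which coincide for
a loop; hence the second term is dropped when `i = j`. -/
lemma mul_symMatrix_single_mul {n : ℕ} (M N : Matrix (Fin n) (Fin n) ℂ) (b b' : Sym2 (Fin n) → ℝ)
    (i j : Fin n) (h : ∀ e, e ≠ s(i, j) → b e = b' e) (x y : Fin n) :
    (M * (symMatrix b - symMatrix b').map (fun x : ℝ => (x : ℂ)) * N) x y =
      ((b s(i, j) - b' s(i, j) : ℝ) : ℂ) *
        (M x i * N j y + if i = j then 0 else M x j * N i y) := by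
  have hD : (symMatrix b - symMatrix b').map (fun x : ℝ => (x : ℂ)) =
      Matrix.single i j ((b s(i, j) - b' s(i, j) : ℝ) : ℂ) +
        Matrix.single j i (if i = j then 0 else ((b s(i, j) - b' s(i, j) : ℝ) : ℂ)) := by
    ext p q
    simp only [Matrix.map_apply, Matrix.sub_apply, symMatrix, Matrix.of_apply, Matrix.add_apply,
      Matrix.single_apply]
    by_cases hpq : s(p, q) = s(i, j)
    · rw [hpq]
      rcases Sym2.eq_iff.1 hpq with ⟨rfl, rfl⟩ | ⟨rfl, rfl⟩
      · by_cases hij : p = q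
        · simp [hij]
        · simp [hij, Ne.symm hij]
      · by_cases hij : p = q
        · simp [hij]
        · simp [hij, Ne.symm hij]
    · rw [h _ hpq, sub_self]
      have h1 : ¬ (i = p ∧ j = q) := fun hh => hpq (by rw [hh.1, hh.2])
      have h2 : ¬ (j = p ∧ i = q) := fun hh => hpq (by rw [hh.1, hh.2, Sym2.eq_swap])
      simp [h1, h2]
  rw [hD, mul_add, add_mul, Matrix.add_apply]
  have hs : ∀ (p q : Fin n) (d : ℂ), (M * Matrix.single p q d * N) x y = d * (M x p * N q y) := by
    intro p q d
    rw [Matrix.mul_assoc, Matrix.mul_apply, Finset.sum_eq_single p]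
    · rw [Matrix.single_mul_apply_same]
      ring
    · intro k _ hk
      rw [Matrix.single_mul_apply_of_ne _ _ _ _ _ hk, mul_zero]
    · simp
  rw [hs, hs]
  split_ifs <;> ring

end ResolventEquation

end ChungLu

namespace ChungLu

/-! ### The self-consistent equation for the mean resolvent. -/

section RandomMatrix

open Matrix

variable {n : ℕ} (μ : Sym2 (Fin n) → Measure Bool) [∀ e, IsProbabilityMeasure (μ e)]
  (β : Sym2 (Fin n) → Bool → ℝ)

/-- The resolvent of the random symmetric matrix with entries `β e (c e)`. -/
noncomputable def randomResolvent (z : ℂ) (c : Sym2 (Fin n) → Bool) : Matrix (Fin n) (Fin n) ℂ :=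
  matResolvent (symMatrix fun e => β e (c e)) z

/-- Approximate integration by parts in one entry. With `G₀` the resolvent after setting the entry
`b` to zero, the first-order term `𝔼 (b G₀)` vanishes and the second-order term factors by
independence. The resolvent identity makes the remainder at most `4 ε b²`; replacing `G₀` by `G` in
the quadratic term costs `8 ε` times the variance. -/
lemma norm_integral_mul_randomResolvent_add_le (z : ℂ) (hz : 1 ≤ z.im) (ε : ℝ) (i j : Fin n)
    (hij : i ≠ j) (hmean : ∫ y, β s(i, j) y ∂(μ s(i, j)) = 0) (hε : ∀ y, |β s(i, j) y| ≤ ε) :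
    ‖∫ c, (β s(i, j) (c s(i, j)) : ℂ) * randomResolvent β z c j i ∂(Measure.pi μ) +
      ((∫ y, β s(i, j) y ^ 2 ∂(μ s(i, j)) : ℝ) : ℂ) *
        ∫ c, (randomResolvent β z c j i ^ 2 +
          randomResolvent β z c j j * randomResolvent β z c i i) ∂(Measure.pi μ)‖ ≤
      12 * ε * ∫ y, β s(i, j) y ^ 2 ∂(μ s(i, j)) := by
  classical
  have hε0 : 0 ≤ ε := (abs_nonneg _).trans (hε true)
  have hz0 : 0 < z.im := by linarith
  set e := s(i, j) with he
  set v := ∫ y, β e y ^ 2 ∂(μ e) with hv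
  have hv0 : 0 ≤ v := integral_nonneg fun y => sq_nonneg _
  set G := randomResolvent β z with hG
  let b₀ : (Sym2 (Fin n) → Bool) → Sym2 (Fin n) → ℝ := fun c => Function.update (fun e => β e (c e)) e 0
  set G₀ : (Sym2 (Fin n) → Bool) → Matrix (Fin n) (Fin n) ℂ :=
    fun c => matResolvent (symMatrix (b₀ c)) z with hG₀
  have hle1 : 1 / z.im ≤ 1 := by rw [div_le_one hz0]; exact hz
  have hGle : ∀ c x y, ‖G c x y‖ ≤ 1 := fun c x y =>
    (norm_matResolvent_le (symMatrix_isHermitian _) hz0 x y).trans hle1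
  have hG₀le : ∀ c x y, ‖G₀ c x y‖ ≤ 1 := fun c x y =>
    (norm_matResolvent_le (symMatrix_isHermitian _) hz0 x y).trans hle1
  have hdiff : ∀ c x y, G c x y - G₀ c x y =
      -((β e (c e) : ℂ) * (G₀ c x i * G c j y + G₀ c x j * G c i y)) := by
    intro c x y
    have h1 := matResolvent_sub (symMatrix_isHermitian (b₀ c))
      (symMatrix_isHermitian fun e => β e (c e)) hz0.ne'
    have h2 := congrFun (congrFun h1 x) y
    rw [Matrix.neg_apply, mul_symMatrix_single_mul _ _ _ _ i j (fun e' he' => by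
      simp [b₀, he, Function.update_of_ne he']), if_neg hij] at h2
    have h3 : b₀ c s(i, j) = 0 := by simp [b₀, he]
    rw [h3, Matrix.sub_apply, zero_sub] at h2
    have h4 : G₀ c x y - G c x y = -(((-(β e (c e)) : ℝ) : ℂ) *
      (G₀ c x i * G c j y + G₀ c x j * G c i y)) := h2
    push_cast at h4
    linear_combination (-1 : ℂ) * h4
  have hdle : ∀ c x y, ‖G c x y - G₀ c x y‖ ≤ 2 * |β e (c e)| := by
    intro c x y
    rw [hdiff, norm_neg, norm_mul, Complex.norm_real, Real.norm_eq_abs, mul_comm]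
    gcongr
    refine (norm_add_le _ _).trans ?_
    rw [norm_mul, norm_mul]
    have h1 := mul_le_one₀ (hG₀le c x i) (norm_nonneg _) (hGle c j y)
    have h2 := mul_le_one₀ (hG₀le c x j) (norm_nonneg _) (hGle c i y)
    linarith
  have hprod : ∀ (a a' b b' : ℂ) (d : ℝ), ‖a‖ ≤ 1 → ‖b'‖ ≤ 1 → ‖a - a'‖ ≤ d → ‖b - b'‖ ≤ d →
      ‖a * b - a' * b'‖ ≤ 2 * d := by
    intro a a' b b' d ha hb' haa hbb
    have : a * b - a' * b' = a * (b - b') + (a - a') * b' := by ring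
    rw [this]
    refine (norm_add_le _ _).trans ?_
    rw [norm_mul, norm_mul]
    nlinarith [norm_nonneg a, norm_nonneg b', norm_nonneg (a - a'), norm_nonneg (b - b')]
  set H : (Sym2 (Fin n) → Bool) → ℂ := fun c => G c j i ^ 2 + G c j j * G c i i with hH
  set H₀ : (Sym2 (Fin n) → Bool) → ℂ := fun c => G₀ c j i ^ 2 + G₀ c j j * G₀ c i i with hH₀
  have hHdiff : ∀ c, ‖H c - H₀ c‖ ≤ 8 * ε := by
    intro c
    have h1 := hprod (G c j i) (G₀ c j i) (G c j i) (G₀ c j i) _ (hGle c j i) (hG₀le c j i)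
      (hdle c j i) (hdle c j i)
    have h2 := hprod (G c j j) (G₀ c j j) (G c i i) (G₀ c i i) _ (hGle c j j) (hG₀le c i i)
      (hdle c j j) (hdle c i i)
    have h3 : H c - H₀ c = (G c j i * G c j i - G₀ c j i * G₀ c j i) +
        (G c j j * G c i i - G₀ c j j * G₀ c i i) := by simp only [hH, hH₀]; ring
    rw [h3]
    refine (norm_add_le _ _).trans ?_
    linarith [hε (c e)]
  have hr1 : ∀ c, ‖(β e (c e) : ℂ) * G c j i - (β e (c e) : ℂ) * G₀ c j i +
      ((β e (c e) ^ 2 : ℝ) : ℂ) * H₀ c‖ ≤ 4 * ε * β e (c e) ^ 2 := by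
    intro c
    have h1 : (β e (c e) : ℂ) * G c j i - (β e (c e) : ℂ) * G₀ c j i +
        ((β e (c e) ^ 2 : ℝ) : ℂ) * H₀ c = ((β e (c e) ^ 2 : ℝ) : ℂ) *
          (G₀ c j i * (G₀ c j i - G c j i) + G₀ c j j * (G₀ c i i - G c i i)) := by
      rw [← mul_sub, hdiff]
      simp only [hH₀]
      push_cast
      ring
    rw [h1, norm_mul, Complex.norm_real, Real.norm_of_nonneg (sq_nonneg _), mul_comm]
    refine mul_le_mul_of_nonneg_right ?_ (sq_nonneg _)
    refine (norm_add_le _ _).trans ?_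
    rw [norm_mul, norm_mul]
    have h2 := hdle c j i
    have h3 := hdle c i i
    rw [norm_sub_rev] at h2 h3
    have h4 := mul_le_mul (hG₀le c j i) h2 (norm_nonneg _) zero_le_one
    have h5 := mul_le_mul (hG₀le c j j) h3 (norm_nonneg _) zero_le_one
    linarith [hε (c e)]
  have hup : ∀ c y, b₀ (Function.update c e y) = b₀ c := by
    intro c y
    ext e'
    by_cases h : e' = e
    · subst h
      simp [b₀]
    · simp [b₀, Function.update_of_ne h]
  have hG₀up : ∀ c y, G₀ (Function.update c e y) = G₀ c := fun c y => by
    simp only [hG₀, hup]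
  have i1 : ∫ c, (β e (c e) : ℂ) * G₀ c j i ∂(Measure.pi μ) = 0 := by
    rw [integral_mul_of_update_eq μ e (fun y => (β e y : ℂ)) (fun c => G₀ c j i)
      (fun c y => by rw [hG₀up]), integral_complex_ofReal, hmean]
    simp
  have i2 : ∫ c, ((β e (c e) ^ 2 : ℝ) : ℂ) * H₀ c ∂(Measure.pi μ) =
      (v : ℂ) * ∫ c, H₀ c ∂(Measure.pi μ) := by
    rw [integral_mul_of_update_eq μ e (fun y => ((β e y ^ 2 : ℝ) : ℂ)) H₀
      (fun c y => by simp only [hH₀, hG₀up]), integral_complex_ofReal]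
  have i3 : ∫ c, β e (c e) ^ 2 ∂(Measure.pi μ) = v :=
    integral_comp_eval (μ := μ) (i := e) (f := fun y => β e y ^ 2) .of_discrete
  have hsplit : ∫ c, (β e (c e) : ℂ) * G c j i ∂(Measure.pi μ) + (v : ℂ) * ∫ c, H c ∂(Measure.pi μ) =
      ∫ c, ((β e (c e) : ℂ) * G c j i - (β e (c e) : ℂ) * G₀ c j i +
        ((β e (c e) ^ 2 : ℝ) : ℂ) * H₀ c) ∂(Measure.pi μ) +
      (v : ℂ) * ∫ c, (H c - H₀ c) ∂(Measure.pi μ) := by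
    have s1 : ∀ A B D : (Sym2 (Fin n) → Bool) → ℂ, ∫ c, (A c - B c + D c) ∂(Measure.pi μ) =
        ∫ c, A c ∂(Measure.pi μ) - ∫ c, B c ∂(Measure.pi μ) + ∫ c, D c ∂(Measure.pi μ) := by
      intro A B D
      rw [integral_add Integrable.of_finite Integrable.of_finite,
        integral_sub Integrable.of_finite Integrable.of_finite]
    rw [s1, i1, i2, integral_sub (f := H) Integrable.of_finite Integrable.of_finite]
    ring
  rw [hsplit]
  refine (norm_add_le _ _).trans ?_
  have h1 : ‖∫ c, ((β e (c e) : ℂ) * G c j i - (β e (c e) : ℂ) * G₀ c j i +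
        ((β e (c e) ^ 2 : ℝ) : ℂ) * H₀ c) ∂(Measure.pi μ)‖ ≤ 4 * ε * v := by
    refine (norm_integral_le_integral_norm _).trans ?_
    refine (integral_mono Integrable.of_finite Integrable.of_finite hr1).trans ?_
    rw [integral_const_mul, i3]
  have h2 : ‖(v : ℂ) * ∫ c, (H c - H₀ c) ∂(Measure.pi μ)‖ ≤ v * (8 * ε) := by
    rw [norm_mul, Complex.norm_real, Real.norm_of_nonneg hv0]
    refine mul_le_mul_of_nonneg_left ?_ hv0
    refine (norm_integral_le_integral_norm _).trans ?_
    refine (integral_mono Integrable.of_finite Integrable.of_finite hHdiff).trans ?_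
    simp
  linarith

lemma sum_mul_randomResolvent (z : ℂ) (hz : z.im ≠ 0) (c : Sym2 (Fin n) → Bool) (i : Fin n) :
    ∑ j, (β s(i, j) (c s(i, j)) : ℂ) * randomResolvent β z c j i =
      1 + z * randomResolvent β z c i i := by
  have h := congrFun (congrFun
    (sub_mul_matResolvent (symMatrix_isHermitian fun e => β e (c e)) hz) i) i
  rw [sub_mul, smul_mul_assoc, one_mul, Matrix.sub_apply, Matrix.smul_apply, Matrix.mul_apply,
    Matrix.one_apply_eq, sub_eq_iff_eq_add] at h
  exact h

/-- Approximate self-consistent equation for the mean diagonal entries of the resolvent. -/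
lemma norm_resolvent_equation_le (z : ℂ) (hz : 1 ≤ z.im) (ε K : ℝ)
    (hmean : ∀ e, ∫ y, β e y ∂(μ e) = 0) (hε : ∀ e y, |β e y| ≤ ε)
    (hK : ∀ e, ∫ y, β e y ^ 2 ∂(μ e) ≤ K / n) (hK0 : 0 ≤ K) (i : Fin n) :
    ‖1 + z * ∫ c, randomResolvent β z c i i ∂(Measure.pi μ) +
      ∑ j, ((∫ y, β s(i, j) y ^ 2 ∂(μ s(i, j)) : ℝ) : ℂ) *
        ∫ c, randomResolvent β z c j j * randomResolvent β z c i i ∂(Measure.pi μ)‖ ≤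
      12 * ε * K + ε + 3 * (K / n) := by
  have hn : (0 : ℝ) < n := by exact_mod_cast i.pos
  have hz0 : 0 < z.im := by linarith
  have hε0 : 0 ≤ ε := (abs_nonneg _).trans (hε s(i, i) true)
  set G := randomResolvent β z with hG
  set v : Sym2 (Fin n) → ℝ := fun e => ∫ y, β e y ^ 2 ∂(μ e) with hv
  have hv0 : ∀ e, 0 ≤ v e := fun e => integral_nonneg fun y => sq_nonneg _
  have hle1 : 1 / z.im ≤ 1 := by rw [div_le_one hz0]; exact hz
  have hGle : ∀ c x y, ‖G c x y‖ ≤ 1 := fun c x y =>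
    (norm_matResolvent_le (symMatrix_isHermitian _) hz0 x y).trans hle1
  have e1 : 1 + z * ∫ c, G c i i ∂(Measure.pi μ) =
      ∑ j, ∫ c, (β s(i, j) (c s(i, j)) : ℂ) * G c j i ∂(Measure.pi μ) := by
    rw [← integral_finsetSum _ fun _ _ => Integrable.of_finite]
    simp_rw [hG, sum_mul_randomResolvent β z hz0.ne']
    rw [integral_add Integrable.of_finite Integrable.of_finite, integral_const_mul]
    simp
  set T : Fin n → ℂ := fun j => ∫ c, (β s(i, j) (c s(i, j)) : ℂ) * G c j i ∂(Measure.pi μ) +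
    (v s(i, j) : ℂ) * ∫ c, (G c j i ^ 2 + G c j j * G c i i) ∂(Measure.pi μ) with hT
  have e2 : 1 + z * ∫ c, G c i i ∂(Measure.pi μ) +
      ∑ j, (v s(i, j) : ℂ) * ∫ c, G c j j * G c i i ∂(Measure.pi μ) =
      ∑ j, T j - ∑ j, (v s(i, j) : ℂ) * ∫ c, G c j i ^ 2 ∂(Measure.pi μ) := by
    rw [e1, ← Finset.sum_add_distrib, ← Finset.sum_sub_distrib]
    refine Finset.sum_congr rfl fun j _ => ?_
    simp only [hT]
    rw [integral_add Integrable.of_finite Integrable.of_finite]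
    ring
  rw [e2]
  refine (norm_sub_le _ _).trans ?_
  -- The loop `j = i` is estimated crudely: it is a single term, so it needs no cancellation.
  have hTle : ∀ j, ‖T j‖ ≤ 12 * ε * (K / n) + if j = i then ε + 2 * (K / n) else 0 := by
    intro j
    have hKn : 0 ≤ K / n := by positivity
    by_cases hji : j = i
    · subst hji
      rw [if_pos rfl]
      have h1 : ‖∫ c, (β s(j, j) (c s(j, j)) : ℂ) * G c j j ∂(Measure.pi μ)‖ ≤ ε := by
        refine (norm_integral_le_integral_norm _).trans ?_
        have : ∀ c, ‖(β s(j, j) (c s(j, j)) : ℂ) * G c j j‖ ≤ ε := by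
          intro c
          rw [norm_mul, Complex.norm_real, Real.norm_eq_abs]
          have := mul_le_mul (hε s(j, j) (c s(j, j))) (hGle c j j) (norm_nonneg _) hε0
          linarith
        refine (integral_mono Integrable.of_finite Integrable.of_finite this).trans ?_
        simp
      have h2 : ‖∫ c, (G c j j ^ 2 + G c j j * G c j j) ∂(Measure.pi μ)‖ ≤ 2 := by
        refine (norm_integral_le_integral_norm _).trans ?_
        have : ∀ c, ‖G c j j ^ 2 + G c j j * G c j j‖ ≤ 2 := by
          intro c
          rw [← sq, ← two_mul, norm_mul, norm_pow, RCLike.norm_ofNat]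
          have := pow_le_one₀ (n := 2) (norm_nonneg _) (hGle c j j)
          linarith
        refine (integral_mono Integrable.of_finite Integrable.of_finite this).trans ?_
        simp
      refine (norm_add_le _ _).trans ?_
      rw [norm_mul, Complex.norm_real, Real.norm_of_nonneg (hv0 _)]
      have h3 := mul_le_mul (hK s(j, j)) h2 (norm_nonneg _) hKn
      have h4 : 0 ≤ 12 * ε * (K / n) := by positivity
      linarith
    · rw [if_neg hji, add_zero]
      refine (norm_integral_mul_randomResolvent_add_le μ β z hz ε i j (Ne.symm hji) (hmean _)
        (hε _)).trans ?_
      exact mul_le_mul_of_nonneg_left (hK _) (by positivity)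
  have hs1 : ‖∑ j, T j‖ ≤ 12 * ε * K + (ε + 2 * (K / n)) := by
    refine (norm_sum_le _ _).trans ((Finset.sum_le_sum fun j _ => hTle j).trans ?_)
    rw [Finset.sum_add_distrib, Finset.sum_ite_eq' Finset.univ i]
    simp only [Finset.sum_const, Finset.card_univ, Fintype.card_fin, nsmul_eq_mul,
      Finset.mem_univ, if_true]
    refine le_of_eq ?_
    field_simp
  -- The squared off-diagonal entries are negligible: each has weight at most `K / n`, and their sum
  -- is bounded by the Ward identity.
  have hs2 : ‖∑ j, (v s(i, j) : ℂ) * ∫ c, G c j i ^ 2 ∂(Measure.pi μ)‖ ≤ K / n := by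
    have : ∀ j ∈ Finset.univ, ‖(v s(i, j) : ℂ) * ∫ c, G c j i ^ 2 ∂(Measure.pi μ)‖ ≤
        K / n * ∫ c, ‖G c i j‖ ^ 2 ∂(Measure.pi μ) := by
      intro j _
      rw [norm_mul, Complex.norm_real, Real.norm_of_nonneg (hv0 _)]
      refine mul_le_mul (hK _) ?_ (norm_nonneg _) (by positivity)
      refine (norm_integral_le_integral_norm _).trans (le_of_eq ?_)
      refine integral_congr_ae (ae_of_all _ fun c => ?_)
      simp only [norm_pow]
      rw [hG, randomResolvent, matResolvent_symm (symMatrix_isHermitian _)]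
    refine (norm_sum_le _ _).trans ((Finset.sum_le_sum this).trans ?_)
    rw [← Finset.mul_sum, ← integral_finsetSum _ fun _ _ => Integrable.of_finite]
    refine mul_le_of_le_one_right (by positivity) ?_
    have : ∀ c, ∑ j, ‖G c i j‖ ^ 2 ≤ 1 := fun c =>
      (sum_norm_sq_matResolvent_le (symMatrix_isHermitian _) hz0 i).trans
        (pow_le_one₀ (by positivity) hle1)
    refine (integral_mono Integrable.of_finite Integrable.of_finite this).trans ?_
    simp
  linarith

end RandomMatrix

end ChungLu

namespace ChungLu

section RandomMatrix

open Matrix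

variable {n : ℕ} (μ : Sym2 (Fin n) → Measure Bool) [∀ e, IsProbabilityMeasure (μ e)]
  (β : Sym2 (Fin n) → Bool → ℝ)

/-- Changing one entry moves it by at most `2 ε`; the resolvent identity then gives two sums `∑
|G_ka| |G'_bk|`, each at most `1` by the arithmetic–geometric mean inequality and the Ward identity.
The gain of `1 / n` is the normalisation. -/
lemma norm_weighted_trace_sub_le (z : ℂ) (hz : 1 ≤ z.im) (ε C : ℝ) (hε : ∀ e y, |β e y| ≤ ε)
    (x : Fin n → ℝ) (hx : ∀ i, |x i| ≤ C) (c c' : Sym2 (Fin n) → Bool) (e : Sym2 (Fin n))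
    (hc : ∀ e', e' ≠ e → c e' = c' e') :
    ‖(1 / (n : ℂ)) * ∑ k, (x k : ℂ) * randomResolvent β z c k k -
      (1 / (n : ℂ)) * ∑ k, (x k : ℂ) * randomResolvent β z c' k k‖ ≤ 4 * C * ε / n := by
  induction e using Sym2.ind with
  | _ i j =>
  have hz0 : 0 < z.im := by linarith
  have hn : (0 : ℝ) < n := by exact_mod_cast i.pos
  have hC : 0 ≤ C := (abs_nonneg _).trans (hx i)
  have hε0 : 0 ≤ ε := (abs_nonneg _).trans (hε s(i, j) true)
  have hle1 : (1 / z.im) ^ 2 ≤ 1 :=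
    pow_le_one₀ (by positivity) (by rw [div_le_one hz0]; exact hz)
  set G := randomResolvent β z with hG
  have hsymm : ∀ c a b, G c a b = G c b a := fun c a b =>
    matResolvent_symm (symMatrix_isHermitian _) z a b
  have hsum : ∀ c a, ∑ k, ‖G c a k‖ ^ 2 ≤ 1 := fun c a =>
    (sum_norm_sq_matResolvent_le (symMatrix_isHermitian _) hz0 a).trans hle1
  have hcs : ∀ a b, ∑ k, ‖G c k a‖ * ‖G c' b k‖ ≤ 1 := by
    intro a b
    have : ∀ k ∈ Finset.univ, ‖G c k a‖ * ‖G c' b k‖ ≤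
        (‖G c a k‖ ^ 2 + ‖G c' b k‖ ^ 2) / 2 := by
      intro k _
      rw [hsymm c k a]
      nlinarith [sq_nonneg (‖G c a k‖ - ‖G c' b k‖)]
    refine (Finset.sum_le_sum this).trans ?_
    rw [← Finset.sum_div, Finset.sum_add_distrib]
    linarith [hsum c a, hsum c' b]
  have hent : ∀ k, ‖G c k k - G c' k k‖ ≤
      2 * ε * (‖G c k i‖ * ‖G c' j k‖ + ‖G c k j‖ * ‖G c' i k‖) := by
    intro k
    have h1 := matResolvent_sub (symMatrix_isHermitian fun e => β e (c e))
      (symMatrix_isHermitian fun e => β e (c' e)) hz0.ne'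
    have h2 := congrFun (congrFun h1 k) k
    rw [Matrix.neg_apply, mul_symMatrix_single_mul _ _ _ _ i j (fun e' he' => by
      rw [hc e' he'])] at h2
    have h3 : G c k k - G c' k k = _ := h2
    rw [h3, norm_neg, norm_mul, Complex.norm_real, Real.norm_eq_abs]
    refine mul_le_mul ?_ ?_ (norm_nonneg _) (by positivity)
    · refine (abs_sub _ _).trans ?_
      linarith [hε s(i, j) (c s(i, j)), hε s(i, j) (c' s(i, j))]
    · refine (norm_add_le _ _).trans ?_
      rw [norm_mul]
      refine add_le_add le_rfl ?_
      split_ifs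
      · rw [norm_zero]
        positivity
      · rw [norm_mul]
        exact le_rfl
  rw [← mul_sub, ← Finset.sum_sub_distrib, norm_mul, norm_div, norm_one, Complex.norm_natCast]
  have hfin : ‖∑ k, ((x k : ℂ) * G c k k - (x k : ℂ) * G c' k k)‖ ≤ 4 * C * ε := by
    have : ∀ k ∈ Finset.univ, ‖(x k : ℂ) * G c k k - (x k : ℂ) * G c' k k‖ ≤
        C * (2 * ε) * (‖G c k i‖ * ‖G c' j k‖ + ‖G c k j‖ * ‖G c' i k‖) := by
      intro k _
      rw [← mul_sub, norm_mul, Complex.norm_real, Real.norm_eq_abs, mul_assoc C]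
      exact mul_le_mul (hx k) (hent k) (norm_nonneg _) hC
    refine (norm_sum_le _ _).trans ((Finset.sum_le_sum this).trans ?_)
    rw [← Finset.mul_sum, Finset.sum_add_distrib]
    have h4 := add_le_add (hcs i j) (hcs j i)
    have h5 := mul_le_mul_of_nonneg_left h4 (by positivity : 0 ≤ C * (2 * ε))
    linarith
  calc 1 / (n : ℝ) * ‖∑ k, ((x k : ℂ) * G c k k - (x k : ℂ) * G c' k k)‖
      ≤ 1 / (n : ℝ) * (4 * C * ε) := by gcongr
    _ = _ := by ring

/-- Bounded differences with each edge as its own block: at most `n²` blocks with increments `4 C ε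
/ n`, so the fluctuation scale is `σ = 4 C ε`. Real and imaginary parts contribute `6 σ` each. -/
lemma integral_norm_weighted_trace_sub_le (hn0 : 0 < n) (z : ℂ) (hz : 1 ≤ z.im) (ε C : ℝ)
    (hε0 : 0 < ε) (hC : 0 < C) (hε : ∀ e y, |β e y| ≤ ε) (x : Fin n → ℝ) (hx : ∀ i, |x i| ≤ C) :
    ∫ c, ‖(1 / (n : ℂ)) * ∑ k, (x k : ℂ) * randomResolvent β z c k k -
      ∫ c, (1 / (n : ℂ)) * ∑ k, (x k : ℂ) * randomResolvent β z c k k ∂(Measure.pi μ)‖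
        ∂(Measure.pi μ) ≤ 48 * C * ε := by
  have hn : (0 : ℝ) < n := by exact_mod_cast hn0
  set g : (Sym2 (Fin n) → Bool) → ℂ :=
    fun c => (1 / (n : ℂ)) * ∑ k, (x k : ℂ) * randomResolvent β z c k k with hg
  set r : Sym2 (Fin n) → ℕ := fun e => (Fintype.equivFin (Sym2 (Fin n)) e : ℕ) with hr
  have hcard : Fintype.card (Sym2 (Fin n)) ≤ n * n := by
    have := Fintype.card_le_of_surjective (fun p : Fin n × Fin n => s(p.1, p.2))
      (fun e => by induction e using Sym2.ind with | _ a b => exact ⟨(a, b), rfl⟩)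
    simpa using this
  have hdiff : ∀ k c c', (∀ e, r e ≠ k → c e = c' e) → ‖g c - g c'‖ ≤ 4 * C * ε / n := by
    intro k c c' h
    by_cases hk : ∃ e, r e = k
    · obtain ⟨e, he⟩ := hk
      refine norm_weighted_trace_sub_le β z hz ε C hε x hx c c' e fun e' he' => h e' ?_
      rw [← he]
      intro hcon
      exact he' ((Fintype.equivFin _).injective (Fin.ext hcon))
    · push Not at hk
      have : c = c' := funext fun e => h e (hk e)
      rw [this, sub_self, norm_zero]
      positivity
  have hσ : (Fintype.card (Sym2 (Fin n)) : ℝ) * (4 * C * ε / n) ^ 2 ≤ (4 * C * ε) ^ 2 := by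
    have h1 : (Fintype.card (Sym2 (Fin n)) : ℝ) ≤ n * n := by exact_mod_cast hcard
    calc (Fintype.card (Sym2 (Fin n)) : ℝ) * (4 * C * ε / n) ^ 2
        ≤ (n * n) * (4 * C * ε / n) ^ 2 := by gcongr
      _ = (4 * C * ε) ^ 2 := by field_simp
  have hre := integral_abs_sub_integral_le μ _ r (fun e => (Fintype.equivFin _ e).2)
    (4 * C * ε / n) (by positivity) (fun c => (g c).re) (fun k c c' h => by
      rw [← Complex.sub_re]
      exact (Complex.abs_re_le_norm _).trans (hdiff k c c' h)) (4 * C * ε) (by positivity) hσ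
  have him := integral_abs_sub_integral_le μ _ r (fun e => (Fintype.equivFin _ e).2)
    (4 * C * ε / n) (by positivity) (fun c => (g c).im) (fun k c c' h => by
      rw [← Complex.sub_im]
      exact (Complex.abs_im_le_norm _).trans (hdiff k c c' h)) (4 * C * ε) (by positivity) hσ
  have ere : ∫ c, (g c).re ∂(Measure.pi μ) = (∫ c, g c ∂(Measure.pi μ)).re :=
    Complex.reCLM.integral_comp_comm (φ := g) Integrable.of_finite
  have eim : ∫ c, (g c).im ∂(Measure.pi μ) = (∫ c, g c ∂(Measure.pi μ)).im :=
    Complex.imCLM.integral_comp_comm (φ := g) Integrable.of_finite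
  rw [ere] at hre
  rw [eim] at him
  have hpt : ∀ c, ‖g c - ∫ c, g c ∂(Measure.pi μ)‖ ≤
      |(g c).re - (∫ c, g c ∂(Measure.pi μ)).re| + |(g c).im - (∫ c, g c ∂(Measure.pi μ)).im| := by
    intro c
    rw [← Complex.sub_re, ← Complex.sub_im]
    exact Complex.norm_le_abs_re_add_abs_im _
  refine (integral_mono Integrable.of_finite Integrable.of_finite hpt).trans ?_
  rw [integral_add Integrable.of_finite Integrable.of_finite]
  linarith

/-- Approximate self-consistent equation for a rank one variance profile. -/
lemma norm_rankOne_resolvent_equation_le (z : ℂ) (hz : 1 ≤ z.im) (ε C δ : ℝ) (hε0 : 0 < ε)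
    (hC : 1 ≤ C) (hmean : ∀ e, ∫ y, β e y ∂(μ e) = 0) (hε : ∀ e y, |β e y| ≤ ε)
    (x : Fin n → ℝ) (hx : ∀ i, |x i| ≤ C)
    (hvar_le : ∀ e, ∫ y, β e y ^ 2 ∂(μ e) ≤ C ^ 2 / n)
    (hvar : ∀ i j, |∫ y, β s(i, j) y ^ 2 ∂(μ s(i, j)) - x i * x j / n| ≤ δ / n) (i : Fin n) :
    ‖1 + z * ∫ c, randomResolvent β z c i i ∂(Measure.pi μ) +
      x i * (∫ c, randomResolvent β z c i i ∂(Measure.pi μ)) *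
        ((1 / (n : ℂ)) * ∑ j, (x j : ℂ) * ∫ c, randomResolvent β z c j j ∂(Measure.pi μ))‖ ≤
      (61 * C ^ 2 + 1) * ε + 3 * (C ^ 2 / n) + δ := by
  have hn : (0 : ℝ) < n := by exact_mod_cast i.pos
  have hn' : (n : ℂ) ≠ 0 := by exact_mod_cast hn.ne'
  have hz0 : 0 < z.im := by linarith
  have hle1 : 1 / z.im ≤ 1 := by rw [div_le_one hz0]; exact hz
  have hGle : ∀ c a b, ‖randomResolvent β z c a b‖ ≤ 1 := fun c a b =>
    (norm_matResolvent_le (symMatrix_isHermitian _) hz0 a b).trans hle1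
  have h1 := norm_resolvent_equation_le μ β z hz ε (C ^ 2) hmean hε hvar_le (by positivity) i
  have h2 := integral_norm_weighted_trace_sub_le μ β i.pos z hz ε C hε0 (by linarith) hε x hx
  set G := randomResolvent β z with hG
  set v : Sym2 (Fin n) → ℝ := fun e => ∫ y, β e y ^ 2 ∂(μ e) with hv
  set g : (Sym2 (Fin n) → Bool) → ℂ := fun c => (1 / (n : ℂ)) * ∑ k, (x k : ℂ) * G c k k with hg
  have hgint : ∫ c, g c ∂(Measure.pi μ) =
      (1 / (n : ℂ)) * ∑ j, (x j : ℂ) * ∫ c, G c j j ∂(Measure.pi μ) := by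
    simp only [hg]
    rw [integral_const_mul, integral_finsetSum _ fun _ _ => Integrable.of_finite]
    simp_rw [integral_const_mul]
  rw [← hgint]
  have e1 : ∑ j, ((x i * x j / n : ℝ) : ℂ) * ∫ c, G c j j * G c i i ∂(Measure.pi μ) =
      x i * ∫ c, G c i i * g c ∂(Measure.pi μ) := by
    have : ∀ c, G c i i * g c = ∑ j, ((x j : ℂ) / n) * (G c j j * G c i i) := by
      intro c
      simp only [hg]
      rw [← mul_assoc, Finset.mul_sum]
      refine Finset.sum_congr rfl fun j _ => ?_
      ring
    simp_rw [this]
    rw [integral_finsetSum _ fun _ _ => Integrable.of_finite, Finset.mul_sum]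
    refine Finset.sum_congr rfl fun j _ => ?_
    rw [integral_const_mul]
    push_cast
    ring
  -- Two corrections lead from the general equation to the rank one equation: replacing the true
  -- variances by `x i * x j / n`, and replacing `𝔼 (G_ii g)` by the product of the means, which
  -- concentration of `g` permits.
  have e2 : 1 + z * ∫ c, G c i i ∂(Measure.pi μ) +
      x i * (∫ c, G c i i ∂(Measure.pi μ)) * ∫ c, g c ∂(Measure.pi μ) =
      (1 + z * ∫ c, G c i i ∂(Measure.pi μ) +
        ∑ j, (v s(i, j) : ℂ) * ∫ c, G c j j * G c i i ∂(Measure.pi μ)) -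
      ∑ j, ((v s(i, j) - x i * x j / n : ℝ) : ℂ) * ∫ c, G c j j * G c i i ∂(Measure.pi μ) -
      x i * ∫ c, G c i i * (g c - ∫ c, g c ∂(Measure.pi μ)) ∂(Measure.pi μ) := by
    simp_rw [mul_sub (G _ i i)]
    rw [integral_sub Integrable.of_finite Integrable.of_finite, integral_mul_const, mul_sub, ← e1]
    simp_rw [Complex.ofReal_sub, sub_mul]
    rw [Finset.sum_sub_distrib]
    ring
  rw [e2]
  refine (norm_sub_le _ _).trans ((add_le_add (norm_sub_le _ _) le_rfl).trans ?_)
  have h3 : ‖∑ j, ((v s(i, j) - x i * x j / n : ℝ) : ℂ) *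
      ∫ c, G c j j * G c i i ∂(Measure.pi μ)‖ ≤ δ := by
    have : ∀ j ∈ Finset.univ, ‖((v s(i, j) - x i * x j / n : ℝ) : ℂ) *
      ∫ c, G c j j * G c i i ∂(Measure.pi μ)‖ ≤ δ / n := by
      intro j _
      rw [norm_mul, Complex.norm_real, Real.norm_eq_abs]
      have h4 : ‖∫ c, G c j j * G c i i ∂(Measure.pi μ)‖ ≤ 1 := by
        refine (norm_integral_le_integral_norm _).trans ?_
        have : ∀ c, ‖G c j j * G c i i‖ ≤ 1 := fun c => by
          rw [norm_mul]
          exact mul_le_one₀ (hGle c j j) (norm_nonneg _) (hGle c i i)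
        refine (integral_mono Integrable.of_finite Integrable.of_finite this).trans ?_
        simp
      have h5 := mul_le_mul (hvar i j) h4 (norm_nonneg _) ((abs_nonneg _).trans (hvar i j))
      linarith
    refine (norm_sum_le _ _).trans ((Finset.sum_le_sum this).trans (le_of_eq ?_))
    simp only [Finset.sum_const, Finset.card_univ, Fintype.card_fin, nsmul_eq_mul]
    field_simp
  have h6 : ‖(x i : ℂ) * ∫ c, G c i i * (g c - ∫ c, g c ∂(Measure.pi μ)) ∂(Measure.pi μ)‖ ≤
      C * (48 * C * ε) := by
    rw [norm_mul, Complex.norm_real, Real.norm_eq_abs]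
    refine mul_le_mul (hx i) ?_ (norm_nonneg _) (by linarith)
    refine (norm_integral_le_integral_norm _).trans (le_trans ?_ h2)
    refine integral_mono Integrable.of_finite Integrable.of_finite fun c => ?_
    rw [norm_mul]
    exact mul_le_of_le_one_left (norm_nonneg _) (hGle c i i)
  have h7 : 0 ≤ C ^ 2 * ε := by positivity
  nlinarith [h1, h3, h6, h7]

end RandomMatrix

end ChungLu

namespace ChungLu

/-! ### The mean spectral distribution: Stieltjes transform, second moment, tightness. -/

section MeanESD

/-- The mean spectral distribution of the random symmetric matrix with entries `β e (c e)`. -/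
noncomputable def meanESD {n : ℕ} (μ : Sym2 (Fin n) → Measure Bool)
    (β : Sym2 (Fin n) → Bool → ℝ) : Measure ℝ :=
  ∑ i, ((n : ENNReal)⁻¹) • (Measure.pi μ).map
    (fun c => (symMatrix_isHermitian fun e => β e (c e)).eigenvalues i)

variable {n : ℕ} (μ : Sym2 (Fin n) → Measure Bool) [∀ e, IsProbabilityMeasure (μ e)]
  (β : Sym2 (Fin n) → Bool → ℝ)

lemma integrable_meanESD {E : Type*} [NormedAddCommGroup E] (f : ℝ → E) (hf : StronglyMeasurable f)
    (i : Fin n) :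
    Integrable f (((n : ENNReal)⁻¹) • (Measure.pi μ).map
      (fun c => (symMatrix_isHermitian fun e => β e (c e)).eigenvalues i)) := by
  have hn : (n : ENNReal) ≠ 0 := by exact_mod_cast i.pos.ne'
  refine Integrable.smul_measure ?_ (ENNReal.inv_ne_top.2 hn)
  rw [integrable_map_measure hf.aestronglyMeasurable (measurable_of_finite _).aemeasurable]
  exact Integrable.of_finite

lemma integral_meanESD {E : Type*} [NormedAddCommGroup E] [NormedSpace ℝ E] (f : ℝ → E)
    (hf : StronglyMeasurable f) :
    ∫ x, f x ∂(meanESD μ β) = ∫ c, ((1 / (n : ℝ)) • ∑ i,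
      f ((symMatrix_isHermitian fun e => β e (c e)).eigenvalues i)) ∂(Measure.pi μ) := by
  rw [meanESD, integral_finsetSum_measure fun i _ => integrable_meanESD μ β f hf i, integral_smul,
    integral_finsetSum _ fun _ _ => Integrable.of_finite, Finset.smul_sum]
  refine Finset.sum_congr rfl fun i _ => ?_
  rw [integral_smul_measure, integral_map (measurable_of_finite _).aemeasurable
    hf.aestronglyMeasurable]
  simp

lemma isProbabilityMeasure_meanESD (hn : 0 < n) : IsProbabilityMeasure (meanESD μ β) := by
  refine ⟨?_⟩
  rw [meanESD, Measure.finsetSum_apply]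
  have : ∀ i ∈ Finset.univ, (((n : ENNReal)⁻¹) • (Measure.pi μ).map
      (fun c => (symMatrix_isHermitian fun e => β e (c e)).eigenvalues i)) Set.univ =
      (n : ENNReal)⁻¹ := by
    intro i _
    rw [Measure.smul_apply, Measure.map_apply (measurable_of_finite _) MeasurableSet.univ]
    simp
  rw [Finset.sum_congr rfl this]
  simp only [Finset.sum_const, Finset.card_univ, Fintype.card_fin, nsmul_eq_mul]
  exact ENNReal.mul_inv_cancel (by exact_mod_cast hn.ne') (ENNReal.natCast_ne_top n)

lemma stieltjes_meanESD (z : ℂ) (hz : z.im ≠ 0) :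
    ∫ x : ℝ, ((x : ℂ) - z)⁻¹ ∂(meanESD μ β) =
      (1 / (n : ℂ)) * ∑ i, ∫ c, randomResolvent β z c i i ∂(Measure.pi μ) := by
  rw [integral_meanESD μ β _ (Measurable.stronglyMeasurable (by fun_prop)),
    ← integral_finsetSum _ fun _ _ => Integrable.of_finite, ← integral_const_mul]
  refine integral_congr_ae (ae_of_all _ fun c => ?_)
  simp only [randomResolvent]
  rw [trace_matResolvent (symMatrix_isHermitian _) hz, Complex.real_smul]
  push_cast
  rfl

/-- The second moment is the normalised mean trace of the squared matrix, a sum of `n²` entry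
variances divided by `n`. It provides tightness. -/
lemma integral_sq_meanESD_le (K : ℝ) (hK0 : 0 ≤ K) (hK : ∀ e, ∫ y, β e y ^ 2 ∂(μ e) ≤ K / n) :
    ∫ x, x ^ 2 ∂(meanESD μ β) ≤ K := by
  rw [integral_meanESD μ β _ (Measurable.stronglyMeasurable (by fun_prop)), integral_smul]
  simp_rw [sum_sq_eigenvalues]
  rw [integral_finsetSum _ fun _ _ => Integrable.of_finite]
  have h1 : ∀ i ∈ (Finset.univ : Finset (Fin n)),
      ∫ c, ∑ j, symMatrix (fun e => β e (c e)) i j ^ 2 ∂(Measure.pi μ) ≤ K := by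
    intro i _
    have hn : (0 : ℝ) < n := by exact_mod_cast i.pos
    rw [integral_finsetSum _ fun _ _ => Integrable.of_finite]
    have h2 : ∀ j ∈ (Finset.univ : Finset (Fin n)),
        ∫ c, symMatrix (fun e => β e (c e)) i j ^ 2 ∂(Measure.pi μ) ≤ K / n := by
      intro j _
      refine le_trans (le_of_eq ?_) (hK s(i, j))
      exact integral_comp_eval (μ := μ) (i := s(i, j)) (f := fun y => β s(i, j) y ^ 2) .of_discrete
    refine (Finset.sum_le_sum h2).trans (le_of_eq ?_)
    simp only [Finset.sum_const, Finset.card_univ, Fintype.card_fin, nsmul_eq_mul]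
    field_simp
  rcases Nat.eq_zero_or_pos n with h0 | h0
  · subst h0
    simpa using hK0
  · have hn : (0 : ℝ) < n := by exact_mod_cast h0
    have h3 := Finset.sum_le_sum h1
    simp only [Finset.sum_const, Finset.card_univ, Fintype.card_fin, nsmul_eq_mul] at h3
    rw [smul_eq_mul]
    calc _ ≤ 1 / (n : ℝ) * (n * K) := by gcongr
      _ = K := by field_simp

lemma integrable_sq_meanESD : Integrable (fun x : ℝ => x ^ 2) (meanESD μ β) := by
  rw [meanESD, integrable_finsetSum_measure]
  exact fun i _ => integrable_meanESD μ β _ (Measurable.stronglyMeasurable (by fun_prop)) i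

lemma meanESD_real_Iic (hn : 0 < n) (x : ℝ) : (meanESD μ β).real (Set.Iic x) =
    ∫ c, esd (symMatrix_isHermitian fun e => β e (c e)) x ∂(Measure.pi μ) := by
  have := isProbabilityMeasure_meanESD μ β hn
  rw [← integral_indicator_one measurableSet_Iic, integral_meanESD μ β _
    (Measurable.stronglyMeasurable (measurable_one.indicator measurableSet_Iic))]
  refine integral_congr_ae (ae_of_all _ fun c => ?_)
  simp only [esd, smul_eq_mul]
  congr 1
  rw [Finset.card_filter]
  push_cast
  refine Finset.sum_congr rfl fun i _ => ?_
  simp [Set.indicator_apply]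

lemma isTightMeasureSet_of_integral_sq_le (S : Set (Measure ℝ)) (K : ℝ)
    (hS : ∀ ν ∈ S, IsProbabilityMeasure ν ∧ Integrable (fun x : ℝ => x ^ 2) ν ∧
      ∫ x, x ^ 2 ∂ν ≤ K) : IsTightMeasureSet S := by
  rw [isTightMeasureSet_iff_exists_isCompact_measure_compl_le]
  intro ε hε
  obtain ⟨N, hN⟩ : ∃ N : ℕ, ENNReal.ofReal (K / ((N : ℝ) + 1) ^ 2) < ε := by
    have h1 : Tendsto (fun N : ℕ => ENNReal.ofReal (K / ((N : ℝ) + 1) ^ 2)) atTop (𝓝 0) := by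
      have h2 : Tendsto (fun N : ℕ => ((N : ℝ) + 1) ^ 2) atTop atTop :=
        (tendsto_pow_atTop two_ne_zero).comp
          (tendsto_atTop_add_const_right _ _ tendsto_natCast_atTop_atTop)
      simpa using ENNReal.tendsto_ofReal (h2.const_div_atTop K)
    exact (h1.eventually (gt_mem_nhds hε)).exists
  refine ⟨Set.Icc (-((N : ℝ) + 1)) ((N : ℝ) + 1), isCompact_Icc, fun ν hν => ?_⟩
  obtain ⟨hp, hi, hle⟩ := hS ν hν
  refine le_trans ?_ hN.le
  rw [← ofReal_measureReal]
  refine ENNReal.ofReal_le_ofReal ?_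
  rw [le_div_iff₀ (by positivity)]
  have h3 := mul_meas_ge_le_integral_of_nonneg (μ := ν) (f := fun x : ℝ => x ^ 2)
    (ae_of_all _ fun x => sq_nonneg x) hi (((N : ℝ) + 1) ^ 2)
  have h4 : ν.real (Set.Icc (-((N : ℝ) + 1)) ((N : ℝ) + 1))ᶜ ≤
      ν.real {x : ℝ | ((N : ℝ) + 1) ^ 2 ≤ x ^ 2} := by
    refine measureReal_mono fun x hx => ?_
    rw [Set.mem_compl_iff, Set.mem_Icc, ← abs_le, not_le] at hx
    simp only [Set.mem_ofPred_eq]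
    rw [← sq_abs x]
    gcongr
  have h5 : (0 : ℝ) < ((N : ℝ) + 1) ^ 2 := by positivity
  nlinarith

end MeanESD

end ChungLu

namespace ChungLu

/-! ### Convergence of the mean spectral distributions. -/

section Limit

/-- A centred random symmetric matrix with entries bounded by `ε` whose variance profile is close to
the rank one profile `x i * x j / n`. -/
structure IsNearRankOne {n : ℕ} (μ : Sym2 (Fin n) → Measure Bool) (β : Sym2 (Fin n) → Bool → ℝ)
    (x : Fin n → ℝ) (C ε δ : ℝ) : Prop where
  pos : 0 < n
  bound_pos : 0 < ε
  mean : ∀ e, ∫ y, β e y ∂(μ e) = 0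
  bound : ∀ e y, |β e y| ≤ ε
  weight_le : ∀ i, |x i| ≤ C
  variance_le : ∀ e, ∫ y, β e y ^ 2 ∂(μ e) ≤ C ^ 2 / n
  variance_near : ∀ i j, |∫ y, β s(i, j) y ^ 2 ∂(μ s(i, j)) - x i * x j / n| ≤ δ / n

/-- The averages `(1/n) ∑ i, x i ^ k 𝔼 G i i` of the mean diagonal resolvent entries. -/
noncomputable def weightedTrace {n : ℕ} (μ : Sym2 (Fin n) → Measure Bool)
    (β : Sym2 (Fin n) → Bool → ℝ) (x : Fin n → ℝ) (z : ℂ) (k : ℕ) : ℂ :=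
  (1 / (n : ℂ)) * ∑ i, (x i : ℂ) ^ k * ∫ c, randomResolvent β z c i i ∂(Measure.pi μ)

lemma norm_average_le {n : ℕ} (hn : 0 < n) (f : Fin n → ℂ) (D : ℝ) (hf : ∀ i, ‖f i‖ ≤ D) :
    ‖(1 / (n : ℂ)) * ∑ i, f i‖ ≤ D := by
  have hn' : (0 : ℝ) < n := by exact_mod_cast hn
  rw [norm_mul, norm_div, norm_one, Complex.norm_natCast]
  have : ‖∑ i, f i‖ ≤ n * D := by
    refine (norm_sum_le _ _).trans ((Finset.sum_le_sum fun i _ => hf i).trans (le_of_eq ?_))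
    simp
  calc 1 / (n : ℝ) * ‖∑ i, f i‖ ≤ 1 / (n : ℝ) * (n * D) := by gcongr
    _ = D := by field_simp

lemma norm_weightedTrace_le {n : ℕ} {μ : Sym2 (Fin n) → Measure Bool}
    [∀ e, IsProbabilityMeasure (μ e)] {β : Sym2 (Fin n) → Bool → ℝ}
    {x : Fin n → ℝ} {C ε δ : ℝ} (h : IsNearRankOne μ β x C ε δ) (z : ℂ) (hz : 0 < z.im) (k : ℕ) :
    ‖weightedTrace μ β x z k‖ ≤ C ^ k / z.im := by
  refine norm_average_le h.pos _ _ fun i => ?_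
  rw [norm_mul, norm_pow, Complex.norm_real, Real.norm_eq_abs, div_eq_mul_one_div]
  refine mul_le_mul (pow_le_pow_left₀ (abs_nonneg _) (h.weight_le i) k) ?_ (norm_nonneg _)
    (pow_nonneg ((abs_nonneg _).trans (h.weight_le i)) k)
  refine (norm_integral_le_integral_norm _).trans ?_
  have : ∀ c, ‖randomResolvent β z c i i‖ ≤ 1 / z.im := fun c =>
    norm_matResolvent_le (symMatrix_isHermitian _) hz i i
  refine (integral_mono Integrable.of_finite Integrable.of_finite this).trans ?_
  simp

/-- The rank one equation is multiplied by `x i ^ k` and averaged over `i`. The case `k = 0` links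
the Stieltjes transform itself to `weightedTrace` at `1`. -/
lemma norm_weightedTrace_recursion_le {n : ℕ} {μ : Sym2 (Fin n) → Measure Bool}
    [∀ e, IsProbabilityMeasure (μ e)] {β : Sym2 (Fin n) → Bool → ℝ}
    {x : Fin n → ℝ} {C ε δ : ℝ} (h : IsNearRankOne μ β x C ε δ) (hC : 1 ≤ C) (z : ℂ)
    (hz : 1 ≤ z.im) (k : ℕ) :
    ‖z * weightedTrace μ β x z k + ((1 / (n : ℝ) * ∑ i, x i ^ k : ℝ) : ℂ) +
      weightedTrace μ β x z (k + 1) * weightedTrace μ β x z 1‖ ≤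
      C ^ k * ((61 * C ^ 2 + 1) * ε + 3 * (C ^ 2 / n) + δ) := by
  have heq : z * weightedTrace μ β x z k + ((1 / (n : ℝ) * ∑ i, x i ^ k : ℝ) : ℂ) +
      weightedTrace μ β x z (k + 1) * weightedTrace μ β x z 1 =
      (1 / (n : ℂ)) * ∑ i, (x i : ℂ) ^ k *
        (1 + z * ∫ c, randomResolvent β z c i i ∂(Measure.pi μ) +
          x i * (∫ c, randomResolvent β z c i i ∂(Measure.pi μ)) * weightedTrace μ β x z 1) := by
    simp_rw [mul_add, Finset.sum_add_distrib, mul_add]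
    have e1 : (1 / (n : ℂ)) * ∑ i, (x i : ℂ) ^ k *
        (z * ∫ c, randomResolvent β z c i i ∂(Measure.pi μ)) = z * weightedTrace μ β x z k := by
      rw [weightedTrace, mul_left_comm, Finset.mul_sum _ _ z]
      congr 1
      exact Finset.sum_congr rfl fun i _ => by ring
    have e2 : (1 / (n : ℂ)) * ∑ i, (x i : ℂ) ^ k *
        (x i * (∫ c, randomResolvent β z c i i ∂(Measure.pi μ)) * weightedTrace μ β x z 1) =
        weightedTrace μ β x z (k + 1) * weightedTrace μ β x z 1 := by
      conv_rhs => arg 1; rw [weightedTrace]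
      rw [mul_assoc, Finset.sum_mul]
      congr 1
      exact Finset.sum_congr rfl fun i _ => by ring
    rw [e1, e2]
    push_cast
    simp only [mul_one]
    ring
  rw [heq]
  refine norm_average_le h.pos _ _ fun i => ?_
  rw [norm_mul, norm_pow, Complex.norm_real, Real.norm_eq_abs]
  refine mul_le_mul (pow_le_pow_left₀ (abs_nonneg _) (h.weight_le i) k) ?_ (norm_nonneg _)
    (by positivity)
  have := norm_rankOne_resolvent_equation_le μ β z hz ε C δ h.bound_pos hC h.mean h.bound x
    h.weight_le h.variance_le h.variance_near i
  simpa only [weightedTrace, pow_one] using this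

lemma stieltjes_continuous_bounded (η : ℝ) (hη : 1 ≤ η) :
    ∃ f : BoundedContinuousFunction ℝ ℂ, ∀ x : ℝ, f x = ((x : ℂ) - Complex.I * η)⁻¹ := by
  have hne : ∀ x : ℝ, (x : ℂ) - Complex.I * η ≠ 0 := by
    intro x h
    have := congrArg Complex.im h
    simp at this
    linarith
  refine ⟨BoundedContinuousFunction.ofNormedAddCommGroup
    (fun x : ℝ => ((x : ℂ) - Complex.I * η)⁻¹) (Continuous.inv₀ (by fun_prop) hne) 1 fun x => ?_,
    fun x => rfl⟩
  rw [norm_inv]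
  refine inv_le_one_of_one_le₀ ?_
  have := Complex.abs_im_le_norm ((x : ℂ) - Complex.I * η)
  simp only [Complex.sub_im, Complex.ofReal_im, Complex.mul_im, Complex.I_re, Complex.I_im,
    Complex.ofReal_re] at this
  rw [abs_of_neg (by linarith)] at this
  linarith

lemma abs_le_pow_of_tendsto_average (μ : ∀ n, Sym2 (Fin n) → Measure Bool)
    (β : ∀ n, Sym2 (Fin n) → Bool → ℝ) (x : ∀ n, Fin n → ℝ) (ε δ : ℕ → ℝ) (C : ℝ) (Λ : ℕ → ℝ)
    (h : ∀ᶠ n in atTop, IsNearRankOne (μ n) (β n) (x n) C (ε n) (δ n))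
    (hΛ : ∀ k, 1 ≤ k → Tendsto (fun n : ℕ => 1 / (n : ℝ) * ∑ i, x n i ^ k) atTop (𝓝 (Λ k)))
    (k : ℕ) (hk : 1 ≤ k) : |Λ k| ≤ C ^ k := by
  refine le_of_tendsto (hΛ k hk).abs ?_
  filter_upwards [h] with n hn
  have := norm_average_le hn.pos (fun i => ((x n i ^ k : ℝ) : ℂ)) (C ^ k) fun i => by
    rw [Complex.norm_real, norm_pow]
    exact pow_le_pow_left₀ (abs_nonneg _) (hn.weight_le i) k
  have h2 : (1 / (n : ℂ)) * ∑ i, ((x n i ^ k : ℝ) : ℂ) =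
      ((1 / (n : ℝ) * ∑ i, x n i ^ k : ℝ) : ℂ) := by
    push_cast
    rfl
  rwa [h2, Complex.norm_real] at this

variable (μ : ∀ n, Sym2 (Fin n) → Measure Bool) [∀ n e, IsProbabilityMeasure (μ n e)]
  (β : ∀ n, Sym2 (Fin n) → Bool → ℝ) (x : ∀ n, Fin n → ℝ) (ε δ : ℕ → ℝ) (C : ℝ) (Λ : ℕ → ℝ)

/-- Along an ultrafilter the bounded weighted traces converge for all `η` and `k` at once, without
any extraction of subsequences. The approximate recursion becomes exact in the limit, and its
solution has the Lagrange expansion. -/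
lemma moments_of_ultrafilter_limit (hC : 1 ≤ C)
    (h : ∀ᶠ n in atTop, IsNearRankOne (μ n) (β n) (x n) C (ε n) (δ n))
    (hε : Tendsto ε atTop (𝓝 0)) (hδ : Tendsto δ atTop (𝓝 0))
    (hΛ : ∀ k, 1 ≤ k → Tendsto (fun n : ℕ => 1 / (n : ℝ) * ∑ i, x n i ^ k) atTop (𝓝 (Λ k)))
    (ν : ℕ → ProbabilityMeasure ℝ) (hν : ∀ n, 0 < n → (ν n : Measure ℝ) = meanESD (μ n) (β n))
    (U : Ultrafilter ℕ) (hU : (U : Filter ℕ) ≤ atTop) (F : ProbabilityMeasure ℝ)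
    (hF : Tendsto ν U (𝓝 F)) :
    (∀ k : ℕ, Integrable (fun x : ℝ => x ^ k) (F : Measure ℝ)) ∧
      (∀ s : ℕ, ∫ x, x ^ (2 * s) ∂(F : Measure ℝ) = limitMoment Λ s) ∧
      ∀ s : ℕ, ∫ x, x ^ (2 * s + 1) ∂(F : Measure ℝ) = 0 := by
  have him : ∀ η : ℝ, (Complex.I * (η : ℂ)).im = η := fun η => by simp
  have hex : ∀ (η : ℝ) (k : ℕ), ∃ m : ℂ, 1 ≤ η →
      ‖m‖ ≤ C ^ k / η ∧ Tendsto (fun n => weightedTrace (μ n) (β n) (x n) (Complex.I * η) k) U (𝓝 m) := by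
    intro η k
    by_cases hη : 1 ≤ η
    swap
    · exact ⟨0, fun h => absurd h hη⟩
    have hev : ∀ᶠ n in (U : Filter ℕ),
        weightedTrace (μ n) (β n) (x n) (Complex.I * η) k ∈ Metric.closedBall (0 : ℂ) (C ^ k / η) := by
      filter_upwards [hU h] with n hn
      rw [mem_closedBall_zero_iff]
      have := norm_weightedTrace_le hn (Complex.I * η) (by rw [him]; linarith) k
      rwa [him] at this
    obtain ⟨m, hm, hlim⟩ := (isCompact_closedBall (0 : ℂ) (C ^ k / η)).ultrafilter_le_nhds
      (U.map fun n => weightedTrace (μ n) (β n) (x n) (Complex.I * η) k) (le_principal_iff.2 hev)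
    exact ⟨m, fun _ => ⟨mem_closedBall_zero_iff.1 hm, hlim⟩⟩
  choose m hm using hex
  have hn0 : ∀ᶠ n : ℕ in (U : Filter ℕ), 0 < n := hU (eventually_gt_atTop 0)
  have hrel : ∀ η, 1 ≤ η → ∀ k (L : ℝ),
      Tendsto (fun n : ℕ => 1 / (n : ℝ) * ∑ i, x n i ^ k) U (𝓝 L) →
      Complex.I * η * m η k + L + m η (k + 1) * m η 1 = 0 := by
    intro η hη k L hL
    have t1 : Tendsto (fun n => Complex.I * η * weightedTrace (μ n) (β n) (x n) (Complex.I * η) k +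
        ((1 / (n : ℝ) * ∑ i, x n i ^ k : ℝ) : ℂ) +
        weightedTrace (μ n) (β n) (x n) (Complex.I * η) (k + 1) *
          weightedTrace (μ n) (β n) (x n) (Complex.I * η) 1) U
        (𝓝 (Complex.I * η * m η k + L + m η (k + 1) * m η 1)) :=
      (((hm η k hη).2.const_mul _).add ((Complex.continuous_ofReal.tendsto L).comp hL)).add
        ((hm η (k + 1) hη).2.mul (hm η 1 hη).2)
    refine tendsto_nhds_unique t1 ?_
    have t2 : Tendsto (fun n : ℕ => C ^ k * ((61 * C ^ 2 + 1) * ε n + 3 * (C ^ 2 / n) + δ n)) U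
        (𝓝 0) := by
      have a1 := (hε.mono_left hU).const_mul (61 * C ^ 2 + 1)
      have a2 := ((tendsto_natCast_atTop_atTop (R := ℝ)).const_div_atTop (C ^ 2)).const_mul 3
      have a3 := ((a1.add (a2.mono_left hU)).add (hδ.mono_left hU)).const_mul (C ^ k)
      simpa using a3
    refine squeeze_zero_norm' ?_ t2
    filter_upwards [hU h] with n hn
    exact norm_weightedTrace_recursion_le hn hC _ (by rw [him]; exact hη) k
  have hL0 : Tendsto (fun n : ℕ => 1 / (n : ℝ) * ∑ i, x n i ^ 0) U (𝓝 1) := by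
    refine tendsto_const_nhds.congr' ?_
    filter_upwards [hn0] with n hn
    have : (n : ℝ) ≠ 0 := by exact_mod_cast hn.ne'
    simp [this]
  have hS : ∀ η : ℝ, 1 ≤ η → m η 0 = ∫ y : ℝ, ((y : ℂ) - Complex.I * η)⁻¹ ∂(F : Measure ℝ) := by
    intro η hη
    obtain ⟨f, hf⟩ := stieltjes_continuous_bounded η hη
    have t1 := (ProbabilityMeasure.tendsto_iff_forall_integral_rclike_tendsto ℂ).1 hF f
    simp_rw [hf] at t1
    refine tendsto_nhds_unique (hm η 0 hη).2 (t1.congr' ?_)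
    filter_upwards [hn0] with n hn
    rw [hν n hn, stieltjes_meanESD _ _ _ (by rw [him]; linarith)]
    simp [weightedTrace]
  refine moments_of_stieltjes_expansion F (limitMoment Λ) fun K => ?_
  refine stieltjes_expansion_of_recursion Λ C (by linarith)
    (fun η => ∫ y : ℝ, ((y : ℂ) - Complex.I * η)⁻¹ ∂(F : Measure ℝ)) m ?_ ?_
    (fun η hη k => (hm η k hη).1) K
  · intro η hη
    have := hrel η hη 0 1 hL0
    rw [hS η hη] at this
    simpa using this
  · intro η hη k
    exact hrel η hη (k + 1) _ ((hΛ (k + 1) (by omega)).mono_left hU)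

/-- Weak convergence of the mean spectral distributions to a law with the limiting moments. -/
lemma exists_tendsto_meanESD (hC : 1 ≤ C)
    (h : ∀ᶠ n in atTop, IsNearRankOne (μ n) (β n) (x n) C (ε n) (δ n))
    (hε : Tendsto ε atTop (𝓝 0)) (hδ : Tendsto δ atTop (𝓝 0))
    (hΛ : ∀ k, 1 ≤ k → Tendsto (fun n : ℕ => 1 / (n : ℝ) * ∑ i, x n i ^ k) atTop (𝓝 (Λ k)))
    (ν : ℕ → ProbabilityMeasure ℝ) (hν : ∀ n, 0 < n → (ν n : Measure ℝ) = meanESD (μ n) (β n)) :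
    ∃ F : ProbabilityMeasure ℝ, Tendsto ν atTop (𝓝 F) ∧
      (∀ k : ℕ, Integrable (fun x : ℝ => x ^ k) (F : Measure ℝ)) ∧
      (∀ s : ℕ, ∫ x, x ^ (2 * s) ∂(F : Measure ℝ) = limitMoment Λ s) ∧
      (∀ s : ℕ, ∫ x, x ^ (2 * s + 1) ∂(F : Measure ℝ) = 0) ∧
      ∀ G : Measure ℝ, IsProbabilityMeasure G → (∀ k : ℕ, Integrable (fun x : ℝ => x ^ k) G) →
        (∀ k : ℕ, ∫ x, x ^ k ∂G = ∫ x, x ^ k ∂(F : Measure ℝ)) → G = F := by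
  have hmom := moments_of_ultrafilter_limit μ β x ε δ C Λ hC h hε hδ hΛ ν hν
  have hΛC := abs_le_pow_of_tendsto_average μ β x ε δ C Λ h hΛ
  have hbound : ∀ s, limitMoment Λ s ≤ (4 * C ^ 2) ^ s := by
    intro s
    rcases Nat.eq_zero_or_pos s with rfl | hs
    · simp [limitMoment]
    · rw [limitMoment, if_neg hs.ne']
      exact (le_abs_self _).trans (abs_evenMoment_le Λ C hΛC hs)
  have huniq : ∀ F G : Measure ℝ, IsProbabilityMeasure F → IsProbabilityMeasure G →
      (∀ k : ℕ, Integrable (fun x : ℝ => x ^ k) F) → (∀ k : ℕ, Integrable (fun x : ℝ => x ^ k) G) →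
      (∀ s : ℕ, ∫ x, x ^ (2 * s) ∂F = limitMoment Λ s) →
      (∀ k : ℕ, ∫ x, x ^ k ∂G = ∫ x, x ^ k ∂F) → G = F := by
    intro F G _ _ hF hG hm he
    exact eq_of_moments_eq F G (4 * C ^ 2) (by positivity) hF hG
      (fun s => by rw [hm]; exact hbound s) he
  set S : Set (ProbabilityMeasure ℝ) := {G | Integrable (fun x : ℝ => x ^ 2) (G : Measure ℝ) ∧
    ∫ x, x ^ 2 ∂(G : Measure ℝ) ≤ C ^ 2} with hSdef
  have hScomp : IsCompact (closure S) := by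
    refine isCompact_closure_of_isTightMeasureSet (isTightMeasureSet_of_integral_sq_le _ (C ^ 2) ?_)
    rintro _ ⟨G, hG, rfl⟩
    exact ⟨inferInstance, hG⟩
  have hνS : ∀ᶠ n in atTop, ν n ∈ S := by
    filter_upwards [h] with n hn
    simp only [hSdef, Set.mem_ofPred_eq, hν n hn.pos]
    exact ⟨integrable_sq_meanESD _ _, integral_sq_meanESD_le _ _ _ (by positivity) hn.variance_le⟩
  have hlim : ∀ U : Ultrafilter ℕ, (U : Filter ℕ) ≤ atTop → ∃ F, Tendsto ν U (𝓝 F) := by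
    intro U hU
    obtain ⟨F, -, hF⟩ := hScomp.ultrafilter_le_nhds (U.map ν)
      (le_principal_iff.2 (Filter.mem_of_superset (hU hνS) fun n hn => subset_closure hn))
    exact ⟨F, hF⟩
  obtain ⟨F, hF⟩ := hlim (Ultrafilter.of atTop) (Ultrafilter.of_le _)
  obtain ⟨f1, f2, f3⟩ := hmom _ (Ultrafilter.of_le _) F hF
  refine ⟨F, ?_, f1, f2, f3, fun G hG g1 g2 => huniq F G inferInstance hG f1 g1 f2 g2⟩
  -- By tightness every ultrafilter has a limit, and all such limits share the moments of `F`;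
  -- determinacy makes them equal to `F`.
  rw [tendsto_iff_ultrafilter]
  intro U hU
  obtain ⟨F', hF'⟩ := hlim U hU
  obtain ⟨g1, g2, g3⟩ := hmom U hU F' hF'
  have : F' = F := by
    apply Subtype.ext
    refine huniq F F' inferInstance inferInstance f1 g1 f2 fun k => ?_
    rcases Nat.even_or_odd' k with ⟨j, rfl | rfl⟩
    · rw [f2, g2]
    · rw [f3, g3]
  rwa [← this]

end Limit

end ChungLu

namespace ChungLu

/-! ### Stability of empirical distributions, and criteria for convergence. -/

section EmpiricalDistribution

lemma esd_congr {n : ℕ} {A B : Matrix (Fin n) (Fin n) ℝ} (hA : A.IsHermitian) (hB : B.IsHermitian)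
    (h : A = B) (x : ℝ) : esd hA x = esd hB x := by
  subst h
  rfl

lemma esd_mono {n : ℕ} {A : Matrix (Fin n) (Fin n) ℝ} (hA : A.IsHermitian) : Monotone (esd hA) := by
  intro x y hxy
  unfold esd
  gcongr

lemma esd_sub_le {n : ℕ} {A B : Matrix (Fin n) (Fin n) ℝ} (hA : A.IsHermitian) (hB : B.IsHermitian)
    (d : ℕ) (hd : (A - B).rank ≤ d) (x : ℝ) : esd hA x - esd hB x ≤ d / n := by
  classical
  have h := (card_eigenvalues_le_add_rank hA hB x).trans (Nat.add_le_add_left hd _)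
  have hcard : ∀ {M : Matrix (Fin n) (Fin n) ℝ} (hM : M.IsHermitian),
      esd hM x = 1 / (n : ℝ) * (Fintype.card {i // hM.eigenvalues i ≤ x} : ℝ) := by
    intro M hM
    rw [esd, Fintype.card_subtype]
  rw [hcard, hcard, ← mul_sub]
  have h' : (Fintype.card {i // hA.eigenvalues i ≤ x} : ℝ) -
      Fintype.card {i // hB.eigenvalues i ≤ x} ≤ d := by
    rw [sub_le_iff_le_add']
    exact_mod_cast h
  calc _ ≤ 1 / (n : ℝ) * d := by gcongr
    _ = _ := by ring

lemma abs_esd_sub_le {n : ℕ} {A B : Matrix (Fin n) (Fin n) ℝ} (hA : A.IsHermitian)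
    (hB : B.IsHermitian) (d : ℕ) (hd : (A - B).rank ≤ d) (hd' : (B - A).rank ≤ d) (x : ℝ) :
    |esd hA x - esd hB x| ≤ d / n := by
  rw [abs_le]
  have h1 := esd_sub_le hA hB d hd x
  have h2 := esd_sub_le hB hA d hd' x
  constructor <;> linarith

/-- The larger endpoint of an edge. -/
def edgeMax {n : ℕ} (e : Sym2 (Fin n)) : ℕ :=
  Sym2.lift (α := Fin n) (β := ℕ) ⟨fun i j => max (i : ℕ) (j : ℕ), fun _ _ => max_comm _ _⟩ e

lemma edgeMax_lt {n : ℕ} (e : Sym2 (Fin n)) : edgeMax e < n := by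
  induction e using Sym2.ind with
  | _ i j => exact max_lt i.2 j.2

/-- Edges with larger endpoint `k` all lie in row and column `k`, so the difference has rank at most
two. Grouping edges this way gives only `n` blocks with increment `2 / n`; treating the edges singly
would give order `n²` blocks. -/
lemma abs_esd_symMatrix_sub_le {n : ℕ} (b b' : Sym2 (Fin n) → ℝ) (k : ℕ)
    (h : ∀ e, edgeMax e ≠ k → b e = b' e) (x : ℝ) :
    |esd (symMatrix_isHermitian b) x - esd (symMatrix_isHermitian b') x| ≤ 2 / n := by
  by_cases hk : k < n
  · have hent : ∀ i j : Fin n, i ≠ ⟨k, hk⟩ → j ≠ ⟨k, hk⟩ → b s(i, j) = b' s(i, j) := by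
      intro i j hi hj
      refine h _ fun hmax => ?_
      have hi' : (i : ℕ) ≠ k := fun hh => hi (Fin.ext hh)
      have hj' : (j : ℕ) ≠ k := fun hh => hj (Fin.ext hh)
      have hmax' : max (i : ℕ) (j : ℕ) = k := hmax
      rcases max_choice (i : ℕ) (j : ℕ) with hc | hc
      · exact hi' (hc ▸ hmax')
      · exact hj' (hc ▸ hmax')
    exact_mod_cast abs_esd_sub_le _ _ 2
      (rank_le_two_of_cross ⟨k, hk⟩ fun i j hi hj => by simp [symMatrix, hent i j hi hj])
      (rank_le_two_of_cross ⟨k, hk⟩ fun i j hi hj => by simp [symMatrix, hent i j hi hj]) x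
  · have : b = b' := funext fun e => h e (by have := edgeMax_lt e; omega)
    subst this
    rw [sub_self, abs_zero]
    positivity

lemma tendsto_cdf_of_tendsto (ν : ℕ → ProbabilityMeasure ℝ) (F : ProbabilityMeasure ℝ)
    (h : Tendsto ν atTop (𝓝 F)) (x : ℝ) (hx : ContinuousAt (cdf (F : Measure ℝ)) x) :
    Tendsto (fun n => (ν n : Measure ℝ).real (Set.Iic x)) atTop
      (𝓝 (cdf (F : Measure ℝ) x)) := by
  rw [cdf_eq_real]
  have h0 : (F : Measure ℝ) {x} = 0 := by
    rw [← measure_cdf (F : Measure ℝ), StieltjesFunction.measure_singleton,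
      leftLim_eq_of_tendsto (hx.tendsto.mono_left nhdsWithin_le_nhds)]
    simp
  have := ProbabilityMeasure.tendsto_measure_of_null_frontier_of_tendsto' h (E := Set.Iic x)
    (by rw [frontier_Iic]; exact h0)
  exact (ENNReal.tendsto_toReal (measure_ne_top _ _)).comp this

/-- Convergence of monotone functions at a dense set of points implies convergence at all
continuity points. -/
lemma weaklyConverges_of_dense (Fn : ℕ → ℝ → ℝ) (F : ℝ → ℝ) (hmono : ∀ n, Monotone (Fn n))
    (D : Set ℝ) (hD : Dense D) (h : ∀ x ∈ D, Tendsto (fun n => Fn n x) atTop (𝓝 (F x))) :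
    WeaklyConverges Fn F := by
  intro x hx
  rw [tendsto_order]
  constructor
  · intro a ha
    have hev : ∀ᶠ y in 𝓝 x, a < F y := hx.eventually (lt_mem_nhds ha)
    obtain ⟨l, hl, hsub⟩ := (mem_nhdsLE_iff_exists_Ioc_subset' (sub_one_lt x)).1
      (mem_nhdsWithin_of_mem_nhds hev)
    obtain ⟨d, hdD, hd⟩ := hD.exists_between hl
    filter_upwards [(h d hdD).eventually (lt_mem_nhds (hsub ⟨hd.1, hd.2.le⟩))] with n hn
    exact hn.trans_le (hmono n hd.2.le)
  · intro a ha
    have hev : ∀ᶠ y in 𝓝 x, F y < a := hx.eventually (gt_mem_nhds ha)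
    obtain ⟨u, hu, hsub⟩ := (mem_nhdsGE_iff_exists_Ico_subset' (lt_add_one x)).1
      (mem_nhdsWithin_of_mem_nhds hev)
    obtain ⟨d, hdD, hd⟩ := hD.exists_between hu
    filter_upwards [(h d hdD).eventually (gt_mem_nhds (hsub ⟨hd.1.le, hd.2⟩))] with n hn
    exact (hmono n hd.1.le).trans_lt hn

/-- First Borel–Cantelli lemma at the thresholds `1 / (k + 1)`. Only marginal tails enter, so no
independence over `n` is needed. -/
lemma ae_tendsto_sub_of_exp_tail {Ω : Type*} [MeasurableSpace Ω] (P : Measure Ω)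
    [IsProbabilityMeasure P] (X : ℕ → Ω → ℝ) (m : ℕ → ℝ)
    (h : ∀ n : ℕ, 0 < n → ∀ δ : ℝ, 0 < δ →
      P.real {ω | δ ≤ |X n ω - m n|} ≤ 2 * Real.exp (-(δ ^ 2 / 2 * n))) :
    ∀ᵐ ω ∂P, Tendsto (fun n => X n ω - m n) atTop (𝓝 0) := by
  have hall : ∀ k : ℕ, ∀ᵐ ω ∂P, ∀ᶠ n in atTop, |X n ω - m n| < 1 / ((k : ℝ) + 1) := by
    intro k
    set δ : ℝ := 1 / ((k : ℝ) + 1) with hδ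
    have hδ0 : 0 < δ := by positivity
    have hle : ∀ n : ℕ, P {ω | δ ≤ |X n ω - m n|} ≤
        ENNReal.ofReal (2 * Real.exp (-(δ ^ 2 / 2)) ^ n) := by
      intro n
      rw [← ofReal_measureReal]
      refine ENNReal.ofReal_le_ofReal ?_
      rcases Nat.eq_zero_or_pos n with rfl | hn
      · refine measureReal_le_one.trans ?_
        norm_num
      · refine (h n hn δ hδ0).trans (le_of_eq ?_)
        rw [← Real.exp_nat_mul]
        congr 2
        ring
    have hsum : ∑' n, P {ω | δ ≤ |X n ω - m n|} ≠ ⊤ := by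
      refine ne_top_of_le_ne_top ?_ (ENNReal.tsum_le_tsum hle)
      have hs : Summable fun n : ℕ => 2 * Real.exp (-(δ ^ 2 / 2)) ^ n :=
        (summable_geometric_of_lt_one (Real.exp_pos _).le
          (by rw [Real.exp_lt_one_iff]; linarith [show 0 < δ ^ 2 / 2 by positivity])).mul_left 2
      exact hs.tsum_ofReal_ne_top
    filter_upwards [ae_eventually_notMem hsum] with ω hω
    filter_upwards [hω] with n hn
    simpa only [Set.mem_ofPred_eq, not_le] using hn
  filter_upwards [ae_all_iff.2 hall] with ω hω
  rw [Metric.tendsto_atTop']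
  intro r hr
  obtain ⟨k, hk⟩ := exists_nat_one_div_lt hr
  obtain ⟨N, hN⟩ := eventually_atTop.1 (hω k)
  refine ⟨N, fun n hn => ?_⟩
  rw [Real.dist_eq, sub_zero]
  exact (hN n hn.le).trans hk

end EmpiricalDistribution

end ChungLu

namespace ChungLu

/-! ### Reduction of the graph model to a product measure on edge configurations. -/

section Model

variable {Ω : Type*} [MeasurableSpace Ω] (P : Measure Ω)
  (w : ∀ n : ℕ, Fin n → ℝ) (a : ∀ n : ℕ, Sym2 (Fin n) → Ω → ℝ)

open scoped Classical in
/-- The edge set of the `n`-th graph as a 0-1 configuration. -/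
noncomputable def edgeConfig (n : ℕ) (ω : Ω) (e : Sym2 (Fin n)) : Bool :=
  decide (a n e ω = 1)

/-- The law of the indicator of an edge. -/
noncomputable def edgeLaw (n : ℕ) (e : Sym2 (Fin n)) : Measure Bool :=
  P.map fun ω => edgeConfig a n ω e

/-- The numerical value of an indicator. -/
def bit (y : Bool) : ℝ := if y then 1 else 0

/-- The probability of an edge. -/
noncomputable def edgeProb (n : ℕ) (e : Sym2 (Fin n)) : ℝ :=
  ∫ y, bit y ∂(edgeLaw P a n e)

/-- The centred and normalized entry of the adjacency matrix. -/
noncomputable def centredEntry (n : ℕ) (e : Sym2 (Fin n)) (y : Bool) : ℝ :=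
  Real.sqrt (n * invVolume w n) * (bit y - edgeProb P a n e)

lemma bit_sq (y : Bool) : bit y ^ 2 = bit y := by
  cases y <;> simp [bit]

lemma bit_nonneg (y : Bool) : 0 ≤ bit y := by
  cases y <;> simp [bit]

lemma bit_le_one (y : Bool) : bit y ≤ 1 := by
  cases y <;> simp [bit]

variable {P w a}

lemma measurable_edgeConfig (hg : IsChungLuGraph P w a) (n : ℕ) (e : Sym2 (Fin n)) :
    Measurable fun ω => edgeConfig a n ω e := by
  refine measurable_to_bool ?_
  have : (fun ω => edgeConfig a n ω e) ⁻¹' {true} = a n e ⁻¹' {1} := by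
    ext ω
    simp [edgeConfig]
  rw [this]
  exact hg.measurable n e (measurableSet_singleton _)

lemma bit_edgeConfig (hg : IsChungLuGraph P w a) (n : ℕ) (e : Sym2 (Fin n)) (ω : Ω) :
    bit (edgeConfig a n ω e) = a n e ω := by
  rcases hg.zero_or_one n e ω with h | h <;> simp [bit, edgeConfig, h]

lemma edgeProb_nonneg (n : ℕ) (e : Sym2 (Fin n)) : 0 ≤ edgeProb P a n e :=
  integral_nonneg bit_nonneg

lemma map_edgeConfig (hg : IsChungLuGraph P w a) (n : ℕ) :
    P.map (edgeConfig a n) = Measure.pi (edgeLaw P a n) := by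
  classical
  have h : iIndepFun (fun e ω => edgeConfig a n ω e) P :=
    (hg.indep n).comp (fun _ t => decide (t = 1)) fun _ => by
      refine measurable_to_bool ?_
      have : (fun t : ℝ => decide (t = 1)) ⁻¹' {true} = {1} := by
        ext t
        simp
      rw [this]
      exact measurableSet_singleton _
  exact h.map_fun_eq_pi_map fun e => (measurable_edgeConfig hg n e).aemeasurable

lemma edgeProb_mk (hg : IsChungLuGraph P w a) (n : ℕ) (i j : Fin n) :
    edgeProb P a n s(i, j) = invVolume w n * w n i * w n j := by
  rw [edgeProb, edgeLaw, integral_map (measurable_edgeConfig hg n _).aemeasurable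
    (by fun_prop), ← hg.mean n i j]
  simp only [bit_edgeConfig hg]

/-- The empirical spectral distribution function of the adjacency matrix of a configuration. -/
noncomputable def configESD (w : ∀ n : ℕ, Fin n → ℝ) (n : ℕ) (x : ℝ)
    (c : Sym2 (Fin n) → Bool) : ℝ :=
  esd (symMatrix_isHermitian fun e => Real.sqrt (n * invVolume w n) * bit (c e)) x

lemma esd_adjMatrix (hg : IsChungLuGraph P w a) (n : ℕ) (ω : Ω) (x : ℝ) :
    esd (adjMatrix_isHermitian w a n ω) x = configESD w n x (edgeConfig a n ω) := by
  refine esd_congr _ _ ?_ x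
  ext i j
  simp [adjMatrix, symMatrix, bit_edgeConfig hg]

variable [IsProbabilityMeasure P]

lemma isProbabilityMeasure_edgeLaw (hg : IsChungLuGraph P w a) (n : ℕ) (e : Sym2 (Fin n)) :
    IsProbabilityMeasure (edgeLaw P a n e) :=
  Measure.isProbabilityMeasure_map (measurable_edgeConfig hg n e).aemeasurable

lemma edgeProb_le_one (hg : IsChungLuGraph P w a) (n : ℕ) (e : Sym2 (Fin n)) :
    edgeProb P a n e ≤ 1 := by
  have := isProbabilityMeasure_edgeLaw hg n e
  calc edgeProb P a n e ≤ ∫ _, (1 : ℝ) ∂(edgeLaw P a n e) :=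
        integral_mono Integrable.of_finite Integrable.of_finite bit_le_one
    _ = 1 := by rw [integral_const, probReal_univ, one_smul]

lemma integral_centredEntry (hg : IsChungLuGraph P w a) (n : ℕ) (e : Sym2 (Fin n)) :
    ∫ y, centredEntry P w a n e y ∂(edgeLaw P a n e) = 0 := by
  have := isProbabilityMeasure_edgeLaw hg n e
  simp only [centredEntry]
  rw [integral_const_mul, integral_sub Integrable.of_finite Integrable.of_finite]
  rw [integral_const, probReal_univ, one_smul, edgeProb, sub_self, mul_zero]

lemma abs_centredEntry_le (hg : IsChungLuGraph P w a) (n : ℕ) (e : Sym2 (Fin n)) (y : Bool) :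
    |centredEntry P w a n e y| ≤ Real.sqrt (n * invVolume w n) := by
  rw [centredEntry, abs_mul, abs_of_nonneg (Real.sqrt_nonneg _)]
  refine mul_le_of_le_one_right (Real.sqrt_nonneg _) (abs_le.2 ⟨?_, ?_⟩)
  · linarith [bit_nonneg y, edgeProb_le_one hg n e]
  · linarith [bit_le_one y, edgeProb_nonneg (P := P) (a := a) n e]

lemma integral_centredEntry_sq (hg : IsChungLuGraph P w a) (n : ℕ)
    (h0 : 0 ≤ n * invVolume w n) (e : Sym2 (Fin n)) :
    ∫ y, centredEntry P w a n e y ^ 2 ∂(edgeLaw P a n e) =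
      n * invVolume w n * (edgeProb P a n e * (1 - edgeProb P a n e)) := by
  have := isProbabilityMeasure_edgeLaw hg n e
  have h : ∀ y, centredEntry P w a n e y ^ 2 = n * invVolume w n *
      ((1 - 2 * edgeProb P a n e) * bit y + edgeProb P a n e ^ 2) := by
    intro y
    rw [centredEntry, mul_pow, Real.sq_sqrt h0, sub_sq, bit_sq]
    ring
  simp_rw [h]
  rw [integral_const_mul, integral_add Integrable.of_finite Integrable.of_finite,
    integral_const_mul]
  simp only [integral_const, probReal_univ, one_smul]
  rw [← edgeProb]
  ring

/-- For edge probability `p = ρ w_i w_j` the variance is `n ρ p (1 - p)`, and `n ρ p = x_i x_j / n`.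
The defect `n ρ p²` is at most `C² / n` times `ρ ŵ²`. -/
lemma isNearRankOne_centredEntry (hg : IsChungLuGraph P w a) (n : ℕ) (hn : 0 < n)
    (hw : ∀ i, 0 ≤ w n i) (hpos : 0 < ∑ i, w n i) (C : ℝ)
    (hC : n * invVolume w n * maxDeg w n ≤ C) :
    IsNearRankOne (edgeLaw P a n) (centredEntry P w a n)
      (fun i => n * invVolume w n * w n i) C (Real.sqrt (n * invVolume w n))
      (C ^ 2 * (invVolume w n * maxDeg w n ^ 2)) := by
  have hρ : 0 < invVolume w n := one_div_pos.2 hpos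
  have hn' : (0 : ℝ) < n := by exact_mod_cast hn
  have hnρ : 0 < n * invVolume w n := mul_pos hn' hρ
  have hmax : ∀ i, w n i ≤ maxDeg w n := fun i => le_ciSup (Set.finite_range _).bddAbove i
  have hx0 : ∀ i, 0 ≤ n * invVolume w n * w n i := fun i => mul_nonneg hnρ.le (hw i)
  have hxC : ∀ i, n * invVolume w n * w n i ≤ C := fun i =>
    (mul_le_mul_of_nonneg_left (hmax i) hnρ.le).trans hC
  have hmain : ∀ i j, n * invVolume w n * edgeProb P a n s(i, j) ≤ C ^ 2 / n := by
    intro i j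
    have : n * invVolume w n * edgeProb P a n s(i, j) =
        (n * invVolume w n * w n i) * (n * invVolume w n * w n j) / n := by
      rw [edgeProb_mk hg]
      field_simp
    rw [this, sq]
    exact div_le_div_of_nonneg_right
      (mul_le_mul (hxC i) (hxC j) (hx0 j) ((hx0 i).trans (hxC i))) hn'.le
  refine ⟨hn, Real.sqrt_pos.2 hnρ, integral_centredEntry hg n, abs_centredEntry_le hg n,
    fun i => ?_, fun e => ?_, fun i j => ?_⟩
  · rw [abs_of_nonneg (hx0 i)]
    exact hxC i
  · rw [integral_centredEntry_sq hg n hnρ.le]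
    induction e using Sym2.ind with
    | _ i j =>
      refine le_trans ?_ (hmain i j)
      refine mul_le_mul_of_nonneg_left ?_ hnρ.le
      exact mul_le_of_le_one_right (edgeProb_nonneg n _)
        (by linarith [edgeProb_nonneg (P := P) (a := a) n s(i, j)])
  · rw [integral_centredEntry_sq hg n hnρ.le]
    have hp0 := edgeProb_nonneg (P := P) (a := a) n s(i, j)
    have hp : edgeProb P a n s(i, j) ≤ invVolume w n * maxDeg w n ^ 2 := by
      rw [edgeProb_mk hg, mul_assoc, sq]
      gcongr
      · exact hw j
      · exact (hw i).trans (hmax i)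
      · exact hmax i
      · exact hmax j
    have heq : n * invVolume w n * (edgeProb P a n s(i, j) * (1 - edgeProb P a n s(i, j))) -
        n * invVolume w n * w n i * (n * invVolume w n * w n j) / n =
        -(n * invVolume w n * edgeProb P a n s(i, j) * edgeProb P a n s(i, j)) := by
      have : n * invVolume w n * w n i * (n * invVolume w n * w n j) / n =
          n * invVolume w n * edgeProb P a n s(i, j) := by
        rw [edgeProb_mk hg]
        field_simp
      rw [this]
      ring
    rw [heq, abs_neg, abs_of_nonneg (by positivity)]
    calc _ ≤ C ^ 2 / n * (invVolume w n * maxDeg w n ^ 2) := by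
          gcongr
          exact hmain i j
      _ = _ := by ring

/-- Bounded differences over the `n` blocks of `edgeMax`: with increments `2 / n` the exponent `2 δ²
/ (n (2 / n)²)` equals `δ² n / 2`. -/
lemma measure_abs_configESD_sub_ge_le (hg : IsChungLuGraph P w a) (n : ℕ) (hn : 0 < n) (x : ℝ)
    (δ : ℝ) (hδ : 0 < δ) :
    P.real {ω | δ ≤ |configESD w n x (edgeConfig a n ω) -
      ∫ c, configESD w n x c ∂(Measure.pi (edgeLaw P a n))|} ≤
      2 * Real.exp (-(δ ^ 2 / 2 * n)) := by
  have := isProbabilityMeasure_edgeLaw hg n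
  have hn' : (0 : ℝ) < n := by exact_mod_cast hn
  have h := measure_abs_sub_integral_ge_le (edgeLaw P a n) n hn edgeMax edgeMax_lt (2 / n)
    (by positivity) (configESD w n x)
    (fun k c c' hc => abs_esd_symMatrix_sub_le _ _ k (fun e he => by rw [hc e he]) x) δ hδ
  rw [← map_edgeConfig hg, map_measureReal_apply
    (measurable_pi_lambda _ fun e => measurable_edgeConfig hg n e)
    (Set.toFinite _).measurableSet, map_edgeConfig hg] at h
  refine h.trans (le_of_eq ?_)
  congr 3
  field_simp

/-- The matrix of means is the outer product of multiples of `w n`, loops included. Centring is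
therefore a rank one change for every configuration. -/
lemma abs_integral_configESD_sub_le (hg : IsChungLuGraph P w a) (n : ℕ) (hn : 0 < n) (x : ℝ) :
    |∫ c, configESD w n x c ∂(Measure.pi (edgeLaw P a n)) -
      (meanESD (edgeLaw P a n) (centredEntry P w a n)).real (Set.Iic x)| ≤ 1 / n := by
  have := isProbabilityMeasure_edgeLaw hg n
  set κ := Real.sqrt (n * invVolume w n) with hκ
  have hdiff : ∀ c : Sym2 (Fin n) → Bool,
      symMatrix (fun e => κ * bit (c e)) - symMatrix (fun e => centredEntry P w a n e (c e)) =
      Matrix.vecMulVec (fun i => κ * invVolume w n * w n i) (w n) := by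
    intro c
    ext i j
    simp only [symMatrix, Matrix.sub_apply, Matrix.of_apply, Matrix.vecMulVec_apply, centredEntry,
      edgeProb_mk hg, ← hκ]
    ring
  rw [meanESD_real_Iic _ _ hn, ← integral_sub Integrable.of_finite Integrable.of_finite,
    ← Real.norm_eq_abs]
  refine (norm_integral_le_of_norm_le_const (C := 1 / (n : ℝ)) (ae_of_all _ fun c => ?_)).trans
    (by simp)
  rw [Real.norm_eq_abs]
  have h1 : (Matrix.vecMulVec (fun i => κ * invVolume w n * w n i) (w n)).rank ≤ 1 :=
    Matrix.rank_vecMulVec_le _ _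
  have h2 : (-Matrix.vecMulVec (fun i => κ * invVolume w n * w n i) (w n)).rank ≤ 1 := by
    rw [← Matrix.neg_vecMulVec]
    exact Matrix.rank_vecMulVec_le _ _
  rw [← hdiff c] at h1 h2
  rw [neg_sub] at h2
  exact_mod_cast abs_esd_sub_le (symMatrix_isHermitian _) (symMatrix_isHermitian _) 1 h1 h2 x

end Model

end ChungLu

/-! ### Assembly: convergence in mean and almost surely. -/

namespace ChungLu

lemma exists_tendsto_meanESD_centredEntry {Ω : Type*} [MeasurableSpace Ω] {P : Measure Ω}
    [IsProbabilityMeasure P] {w : ∀ n : ℕ, Fin n → ℝ} {Λ : ℕ → ℝ}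
    {a : ∀ n : ℕ, Sym2 (Fin n) → Ω → ℝ} (hw_nonneg : ∀ n i, 0 ≤ w n i)
    (hw_pos : ∀ n, 1 ≤ n → 0 < ∑ i, w n i) (hsparse : SparseGraphical w)
    (hΛ : HasPowerSumLimits w Λ) (hgrowth : ControlledGrowth w) (hg : IsChungLuGraph P w a) :
    ∃ F : ProbabilityMeasure ℝ,
      (∀ x, ContinuousAt (cdf (F : Measure ℝ)) x → Tendsto (fun n =>
        (meanESD (edgeLaw P a n) (centredEntry P w a n)).real (Set.Iic x)) atTop
          (𝓝 (cdf (F : Measure ℝ) x))) ∧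
      (∀ k : ℕ, Integrable (fun x : ℝ => x ^ k) (F : Measure ℝ)) ∧
      (∀ s : ℕ, ∫ x, x ^ (2 * s) ∂(F : Measure ℝ) = limitMoment Λ s) ∧
      (∀ s : ℕ, ∫ x, x ^ (2 * s + 1) ∂(F : Measure ℝ) = 0) ∧
      ∀ G : Measure ℝ, IsProbabilityMeasure G → (∀ k : ℕ, Integrable (fun x : ℝ => x ^ k) G) →
        (∀ k : ℕ, ∫ x, x ^ k ∂G = ∫ x, x ^ k ∂(F : Measure ℝ)) → G = F := by
  have hprob := isProbabilityMeasure_edgeLaw hg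
  obtain ⟨C, hC⟩ := hgrowth.maxNormalized.bound
  have hC' : ∀ᶠ n : ℕ in atTop, n * invVolume w n * maxDeg w n ≤ max C 1 := by
    filter_upwards [hC] with n hn
    rw [norm_one, mul_one] at hn
    exact (le_abs_self _).trans (hn.trans (le_max_left _ _))
  have hε : Tendsto (fun n : ℕ => Real.sqrt (n * invVolume w n)) atTop (𝓝 0) := by
    have h := (isLittleO_one_iff ℝ).1 hgrowth.invAvgDeg
    simpa using h.sqrt
  have hδ : Tendsto (fun n => (max C 1) ^ 2 * (invVolume w n * maxDeg w n ^ 2)) atTop (𝓝 0) := by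
    simpa using hsparse.tendsto_zero.const_mul ((max C 1) ^ 2)
  -- For `n = 0` the mean spectral distribution is the zero measure, so a Dirac mass stands in; the
  -- limit is unaffected.
  let ν : ℕ → ProbabilityMeasure ℝ := fun n =>
    if hn : 0 < n then ⟨meanESD (edgeLaw P a n) (centredEntry P w a n),
      isProbabilityMeasure_meanESD _ _ hn⟩ else ⟨Measure.dirac 0, inferInstance⟩
  have hν : ∀ n, 0 < n → (ν n : Measure ℝ) = meanESD (edgeLaw P a n) (centredEntry P w a n) := by
    intro n hn
    have : ν n = ⟨meanESD (edgeLaw P a n) (centredEntry P w a n),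
        isProbabilityMeasure_meanESD _ _ hn⟩ := dif_pos hn
    rw [this, ProbabilityMeasure.coe_mk]
  obtain ⟨F, hF, h⟩ := exists_tendsto_meanESD (edgeLaw P a) (centredEntry P w a)
    (fun n i => n * invVolume w n * w n i) _ _ (max C 1) Λ (le_max_right _ _)
    (by
      filter_upwards [hC', eventually_gt_atTop 0] with n hn hn0
      exact isNearRankOne_centredEntry hg n hn0 (hw_nonneg n) (hw_pos n hn0) _ hn)
    hε hδ hΛ ν hν
  refine ⟨F, fun x hx => ?_, h⟩
  refine (tendsto_cdf_of_tendsto ν F hF x hx).congr' ?_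
  filter_upwards [eventually_gt_atTop 0] with n hn
  rw [hν n hn]

lemma ae_tendsto_esd {Ω : Type*} [MeasurableSpace Ω] {P : Measure Ω}
    [IsProbabilityMeasure P] {w : ∀ n : ℕ, Fin n → ℝ} {a : ∀ n : ℕ, Sym2 (Fin n) → Ω → ℝ}
    (hg : IsChungLuGraph P w a) (x y : ℝ)
    (h : Tendsto (fun n => (meanESD (edgeLaw P a n) (centredEntry P w a n)).real (Set.Iic x))
      atTop (𝓝 y)) :
    ∀ᵐ ω ∂P, Tendsto (fun n => esd (adjMatrix_isHermitian w a n ω) x) atTop (𝓝 y) := by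
  have hmean : Tendsto (fun n => ∫ c, configESD w n x c ∂(Measure.pi (edgeLaw P a n))) atTop
      (𝓝 y) := by
    have h0 : Tendsto (fun n => ∫ c, configESD w n x c ∂(Measure.pi (edgeLaw P a n)) -
        (meanESD (edgeLaw P a n) (centredEntry P w a n)).real (Set.Iic x)) atTop (𝓝 0) := by
      refine squeeze_zero_norm' ?_ tendsto_one_div_atTop_nhds_zero_nat
      filter_upwards [eventually_gt_atTop 0] with n hn
      exact abs_integral_configESD_sub_le hg n hn x
    simpa using h0.add h
  filter_upwards [ae_tendsto_sub_of_exp_tail P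
    (fun n ω => configESD w n x (edgeConfig a n ω)) _
    fun n hn δ hδ => measure_abs_configESD_sub_ge_le hg n hn x δ hδ] with ω hω
  simpa [esd_adjMatrix hg] using hω.add hmean

end ChungLu

theorem theorem2 {Ω : Type*} [MeasurableSpace Ω] (P : Measure Ω) [IsProbabilityMeasure P]
    (w : ∀ n : ℕ, Fin n → ℝ) (Λ : ℕ → ℝ) (a : ∀ n : ℕ, Sym2 (Fin n) → Ω → ℝ)
    (hw_nonneg : ∀ n i, 0 ≤ w n i)
    (hw_pos : ∀ n, 1 ≤ n → 0 < ∑ i, w n i)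
    (hsparse : ChungLu.SparseGraphical w)
    (hΛ : ChungLu.HasPowerSumLimits w Λ)
    (hgrowth : ChungLu.ControlledGrowth w)
    (hgraph : ChungLu.IsChungLuGraph P w a) :
    ∃ F : Measure ℝ, IsProbabilityMeasure F ∧
      -- almost sure weak convergence of the empirical spectral distributions
      (∀ᵐ ω ∂P, ChungLu.WeaklyConverges
        (fun n => ChungLu.esd (ChungLu.adjMatrix_isHermitian w a n ω)) (cdf F)) ∧
      -- the moments of the limit are finite and determine it uniquely
      (∀ k : ℕ, Integrable (fun x : ℝ => x ^ k) F) ∧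
      (∀ G : Measure ℝ, IsProbabilityMeasure G →
        (∀ k : ℕ, Integrable (fun x : ℝ => x ^ k) G) →
        (∀ k : ℕ, ∫ x, x ^ k ∂G = ∫ x, x ^ k ∂F) → G = F) ∧
      -- the values of the moments
      (∀ s : ℕ, 1 ≤ s → ∫ x, x ^ (2 * s) ∂F = ChungLu.evenMoment Λ s) ∧
      (∀ s : ℕ, ∫ x, x ^ (2 * s + 1) ∂F = 0) := by
  obtain ⟨F, hF, hint, heven, hodd, huniq⟩ := ChungLu.exists_tendsto_meanESD_centredEntry
    hw_nonneg hw_pos hsparse hΛ hgrowth hgraph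
  refine ⟨F, inferInstance, ?_, hint, huniq, fun s hs => ?_, hodd⟩
  -- Exceptional null sets depend on the point. A monotone function has countably many
  -- discontinuities, so a countable dense set of continuity points suffices, and monotonicity of
  -- `F_n` extends the convergence to the other continuity points.
  · have hdense : Dense {x | ContinuousAt (cdf (F : Measure ℝ)) x} := by
      simpa [Set.compl_def] using
        ((monotone_cdf (F : Measure ℝ)).countable_not_continuousAt).dense_compl ℝ
    obtain ⟨D, hD, hDc, hDd⟩ := hdense.exists_countable_dense_subset
    have hae : ∀ᵐ ω ∂P, ∀ x ∈ D, Tendsto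
        (fun n => ChungLu.esd (ChungLu.adjMatrix_isHermitian w a n ω) x) atTop
        (𝓝 (cdf (F : Measure ℝ) x)) :=
      (ae_ball_iff hDc).2 fun x hx => ChungLu.ae_tendsto_esd hgraph x _ (hF x (hD hx))
    filter_upwards [hae] with ω hω
    exact ChungLu.weaklyConverges_of_dense _ _ (fun n => ChungLu.esd_mono _) D hDd hω
  · rw [heven, ChungLu.limitMoment, if_neg (by omega)]
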